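/- Let $\Omega\subset\mathbb{C}^n$ be a bounded pseudoconvex domain with $C^\infty$ boundary. Let $\bar\partial$ be the maximal closed extension (in the sense of distributions on $\Omega$) of the Cauchy–Riemann operator on $L^2(\Omega)$ and on $L^2_{(0,1)}(\Omega)$, and let $\bar\partial^*$ be the Hilbert space adjoint of $\bar\partial\colon L^2(\Omega)\to L^2_{(0,1)}(\Omega)$. Write $\|\cdot\|$ for $L^2(\Omega)$-norms and, for $u=\sum_{j=1}^n u_j\,d\bar z_j\in L^2_{(0,1)}(\Omega)$, let $\|u\|_{-1}^2=\sum_{j=1}^n\|u_j\|_{-1}^2$, where the norm of $u_j$ is that of $W^{-1}(\Omega)$, the dual of $W^1_0(\Omega)$. Suppose that $f\in C^2(\overline\Omega)$ is a (complex-valued) compactness multiplier, that is, for every $\varepsilon>0$ there is $C_{\varepsilon,f}>0$ such that $$\|fu\|^2\le\varepsilon\left(\|\bar\partial u\|^2+\|\bar\partial^*u\|^2\right)+C_{\varepsilon,f}\|u\|_{-1}^2$$ for all $u\in\mathrm{Dom}(\bar\partial)\cap\mathrm{Dom}(\bar\partial^*)\subset L^2_{(0,1)}(\Omega)$. Then the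 vector field $\partial f=\sum_{j=1}^n\frac{\partial f}{\partial z_j}\frac{\partial}{\partial z_j}$ is allowable, that is, for every $\varepsilon>0$ there is $C_{\varepsilon,\partial f}>0$ such that $$\Big\|\sum_{j=1}^n\frac{\partial f}{\partial z_j}u_j\Big\|^2\le\varepsilon\left(\|\bar\partial u\|^2+\|\bar\partial^*u\|^2\right)+C_{\varepsilon,\partial f}\|u\|_{-1}^2$$ for all $u=\sum_{j=1}^n u_j\,d\bar z_j\in\mathrm{Dom}(\bar\partial)\cap\mathrm{Dom}(\bar\partial^*)\subset L^2_{(0,1)}(\Omega)$. -/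

import Mathlib

open MeasureTheory Complex
open scoped ContDiff

noncomputable section

namespace DbarNeumann

/-- Complex Euclidean space `ℂⁿ`. -/
abbrev Cn (n : ℕ) : Type := EuclideanSpace ℂ (Fin n)

variable {n : ℕ}

/-- The Wirtinger derivative `∂f/∂z_j = (1/2) (∂f/∂x_j - i ∂f/∂y_j)`. -/
def dz (j : Fin n) (f : Cn n → ℂ) (z : Cn n) : ℂ :=
  (1 / 2) * (fderiv ℝ f z (EuclideanSpace.single j 1)
    - I * fderiv ℝ f z (EuclideanSpace.single j I))

/-- The Wirtinger derivative `∂f/∂z̄_j = (1/2) (∂f/∂x_j + i ∂f/∂y_j)`. -/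
def dzbar (j : Fin n) (f : Cn n → ℂ) (z : Cn n) : ℂ :=
  (1 / 2) * (fderiv ℝ f z (EuclideanSpace.single j 1)
    + I * fderiv ℝ f z (EuclideanSpace.single j I))

/-! ### Smooth bounded pseudoconvex domains -/

/-- `r` is a `C^∞` defining function of `Ω`: `Ω = {r < 0}` and `dr ≠ 0` on the boundary
(on which `r = 0` by continuity). -/
structure IsDefiningFunction (Ω : Set (Cn n)) (r : Cn n → ℝ) : Prop where
  smooth : ContDiff ℝ ∞ r
  eq_neg : Ω = {z | r z < 0}
  fderiv_ne_zero : ∀ p ∈ frontier Ω, fderiv ℝ r p ≠ 0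

/-- The Levi form `∑_{j,k} (∂²r/∂z_j∂z̄_k)(p) w_j w̄_k`; it is real since `r` is real. -/
def leviForm (r : Cn n → ℝ) (p w : Cn n) : ℝ :=
  (∑ j, ∑ k, dz j (dzbar k (fun z => (r z : ℂ))) p * w j * star (w k)).re

/-- Bounded pseudoconvex domain with `C^∞` boundary: the Levi form of a smooth defining function
is nonnegative on complex tangent vectors at every boundary point. -/
structure IsSmoothBoundedPseudoconvexDomain (Ω : Set (Cn n)) : Prop where
  isOpen : IsOpen Ω
  isConnected : IsConnected Ω
  isBounded : Bornology.IsBounded Ω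
  pseudoconvex : ∃ r : Cn n → ℝ, IsDefiningFunction Ω r ∧
    ∀ p ∈ frontier Ω, ∀ w : Cn n,
      ∑ j, dz j (fun z => (r z : ℂ)) p * w j = 0 → 0 ≤ leviForm r p w

/-! ### The `L²` spaces and the operators `∂̄` and `∂̄*` -/

/-- `g ∈ L²(Ω)`. -/
def MemL2 (Ω : Set (Cn n)) (g : Cn n → ℂ) : Prop :=
  MemLp g 2 (volume.restrict Ω)

/-- The squared norm `‖g‖² = ∫_Ω |g|² dV` of `g ∈ L²(Ω)`. -/
def normSqL2 (Ω : Set (Cn n)) (g : Cn n → ℂ) : ℝ :=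
  ∫ z in Ω, ‖g z‖ ^ 2

/-- The inner product `(g, h) = ∫_Ω g h̄ dV` of `L²(Ω)`. -/
def innerL2 (Ω : Set (Cn n)) (g h : Cn n → ℂ) : ℂ :=
  ∫ z in Ω, g z * star (h z)

/-- Test functions: complex-valued `C^∞` functions with compact support in `Ω`. -/
structure IsTestFunction (Ω : Set (Cn n)) (φ : Cn n → ℂ) : Prop where
  smooth : ContDiff ℝ ∞ φ
  hasCompactSupport : HasCompactSupport φ
  tsupport_subset : tsupport φ ⊆ Ω

/-- `g ∈ Dom(∂̄) ⊆ L²(Ω)` and `∂̄g = ∑_j w_j dz̄_j` in the sense of distributions on `Ω`,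
with all `w_j ∈ L²(Ω)`. -/
structure IsDbarFun (Ω : Set (Cn n)) (g : Cn n → ℂ) (w : Fin n → Cn n → ℂ) : Prop where
  memL2 : MemL2 Ω g
  memL2_dbar : ∀ j, MemL2 Ω (w j)
  weak : ∀ j, ∀ φ, IsTestFunction Ω φ →
    ∫ z in Ω, g z * dzbar j φ z = - ∫ z in Ω, w j z * φ z

/-- `u = ∑_j u_j dz̄_j ∈ Dom(∂̄) ⊆ L²_{(0,1)}(Ω)` and `∂̄u = ∑_{j<k} G_{jk} dz̄_j ∧ dz̄_k`, that is
`∂u_k/∂z̄_j - ∂u_j/∂z̄_k = G_{jk} ∈ L²(Ω)` in the sense of distributions on `Ω`. -/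
structure IsDbarForm (Ω : Set (Cn n)) (u : Fin n → Cn n → ℂ)
    (G : Fin n → Fin n → Cn n → ℂ) : Prop where
  memL2 : ∀ j, MemL2 Ω (u j)
  memL2_dbar : ∀ j k, MemL2 Ω (G j k)
  weak : ∀ j k, ∀ φ, IsTestFunction Ω φ →
    ∫ z in Ω, (u k z * dzbar j φ z - u j z * dzbar k φ z) = - ∫ z in Ω, G j k z * φ z

/-- `u ∈ Dom(∂̄*) ⊆ L²_{(0,1)}(Ω)` and `∂̄*u = v`, where `∂̄*` is the Hilbert space adjoint of
`∂̄ : L²(Ω) → L²_{(0,1)}(Ω)`: `(u, ∂̄g) = (v, g)` for all `g ∈ Dom(∂̄)`. -/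
structure IsDbarAdjoint (Ω : Set (Cn n)) (u : Fin n → Cn n → ℂ) (v : Cn n → ℂ) : Prop where
  memL2 : ∀ j, MemL2 Ω (u j)
  memL2_adjoint : MemL2 Ω v
  adjoint : ∀ g w, IsDbarFun Ω g w → ∑ j, innerL2 Ω (u j) (w j) = innerL2 Ω v g

/-- `‖u‖²` for a `(0,1)`-form `u`. -/
def normSqForm (Ω : Set (Cn n)) (u : Fin n → Cn n → ℂ) : ℝ :=
  ∑ j, normSqL2 Ω (u j)

/-- `‖G‖²` for a `(0,2)`-form `G = ∑_{j<k} G_{jk} dz̄_j ∧ dz̄_k`. -/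
def normSqForm2 (Ω : Set (Cn n)) (G : Fin n → Fin n → Cn n → ℂ) : ℝ :=
  ∑ j, ∑ k ∈ Finset.Ioi j, normSqL2 Ω (G j k)

/-! ### The Sobolev `(-1)`-norm -/

/-- The squared `W¹(Ω)`-norm of a `C¹` function. -/
def normSqW1 (Ω : Set (Cn n)) (φ : Cn n → ℂ) : ℝ :=
  normSqL2 Ω φ + ∑ j, (normSqL2 Ω (fun z => fderiv ℝ φ z (EuclideanSpace.single j 1))
    + normSqL2 Ω (fun z => fderiv ℝ φ z (EuclideanSpace.single j I)))

/-- The norm of `g ∈ L²(Ω)` in `W^{-1}(Ω)`, the dual of `W¹₀(Ω)`. The supremum is over a nonempty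
set bounded above by the `L²`-norm of `g`. -/
def normNegOne (Ω : Set (Cn n)) (g : Cn n → ℂ) : ℝ :=
  sSup {t : ℝ | ∃ φ, IsTestFunction Ω φ ∧ normSqW1 Ω φ ≤ 1 ∧ t = ‖innerL2 Ω g φ‖}

/-- `‖u‖_{-1}²` for a `(0,1)`-form `u`, computed componentwise. -/
def normSqNegOne (Ω : Set (Cn n)) (u : Fin n → Cn n → ℂ) : ℝ :=
  ∑ j, normNegOne Ω (u j) ^ 2

/-! ### Compactness multipliers and allowable vector fields -/

/-- `f ∈ C(Ω̄)` is a compactness multiplier (on the level of `(0,1)`-forms). In the estimate `u`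
runs through `Dom(∂̄) ∩ Dom(∂̄*)`, with `G = ∂̄u` and `v = ∂̄*u`. -/
def IsCompactnessMultiplier (Ω : Set (Cn n)) (f : Cn n → ℂ) : Prop :=
  ContinuousOn f (closure Ω) ∧
  ∀ ε > (0 : ℝ), ∃ C > (0 : ℝ), ∀ u G v, IsDbarForm Ω u G → IsDbarAdjoint Ω u v →
    normSqForm Ω (fun j z => f z * u j z)
      ≤ ε * (normSqForm2 Ω G + normSqL2 Ω v) + C * normSqNegOne Ω u

/-- The vector field `∑_j a_j ∂/∂z_j` of type `(1,0)` is allowable: the function `∑_j a_j u_j` is in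
`L²(Ω)` and satisfies the compactness estimate, for all `u ∈ Dom(∂̄) ∩ Dom(∂̄*)`, with `G = ∂̄u` and
`v = ∂̄*u`. -/
def IsAllowable (Ω : Set (Cn n)) (a : Fin n → Cn n → ℂ) : Prop :=
  ∀ ε > (0 : ℝ), ∃ C > (0 : ℝ), ∀ u G v, IsDbarForm Ω u G → IsDbarAdjoint Ω u v →
    MemL2 Ω (fun z => ∑ j, a j z * u j z) ∧
    normSqL2 Ω (fun z => ∑ j, a j z * u j z)
      ≤ ε * (normSqForm2 Ω G + normSqL2 Ω v) + C * normSqNegOne Ω u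

end DbarNeumann

end

open MeasureTheory Complex
open scoped ContDiff

noncomputable section

namespace DbarNeumann

variable {n : ℕ}


/-! ### Wirtinger calculus and integration by parts for compactly supported functions. -/

section Calculus

open Filter Topology

variable {j k : Fin n} {f g : Cn n → ℂ} {z : Cn n}

/-! Put h = ∑_j (∂f/∂z_j) u_j and Q = ‖∂̄u‖² + ‖∂̄*u‖². The function h is a commutator, ∂̄*(fu) = f
∂̄*u − h, so pairing this identity with h itself gives ‖h‖² = (∂̄*u, f̄h) − (fu, ∂̄h). Each term
contains one factor controlled by fu: pointwise |f̄h| = |∑_j (∂f/∂z_j) f u_j| ≤ const·|fu|, and fu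
occurs openly in the second term. The other factors must be bounded by the energy Q. For ∂̄h this
requires the second derivatives of f, bounded because f is C² up to the boundary, and all the
derivatives ∂u_j/∂z̄_k, whose L² norms are bounded by Q on a pseudoconvex domain. Cauchy–Schwarz
with a parameter then yields ‖h‖² ≤ (A/s)‖fu‖² + sDQ for every s > 0
(`exists_contraction_estimate`). The theorem follows by fixing a small s and then applying the
multiplier estimate with a still smaller ε.

Most of the work is `basic_estimate`: for every u in the two domains, ‖u‖² and all ‖∂u_j/∂z̄_k‖² are
at most CQ. No boundary integral and no density of forms smooth up to the boundary is used;
Hörmander's method of three weights replaces both. The Kohn–Morrey–Hörmander identity is proved for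
smooth compactly supported forms (`kohn_morrey`), where it has no boundary term, and passes to
weakly differentiable ones by mollification (`kohn_morrey_weak`). Cutoffs θ_ν carry it to forms on Ω
measured with the weights φ − 2η, φ − η, φ: if e^η dominates |∂θ_ν|², the commutators with θ_ν
vanish in the limit, and if the Levi form of φ is large, the error |∂η|² is absorbed
(`weighted_estimate`).

Pseudoconvexity enters through the strictly plurisubharmonic exhaustion −log(−r) + A|z|²
(`exists_strictExhaustion`). It supplies a sequence of such weight triples that dominate τ|z|² and
agree with it on larger and larger compact sets (`exists_weightSeq`). In `limit_estimate` the
weighted problems are solved with the data of u; the solutions satisfy uniform bounds, converge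
weakly, and an orthogonality argument identifies their limit with u. Since the ∂u_j/∂z̄_k are not
known beforehand to be square integrable, their bound is carried through all limits in dual form, as
a bound on pairings of u with derivatives of test functions, and becomes an L² function only at the
end, by Riesz representation (`exists_weak_dzbar`). -/

theorem dz_congr (h : f =ᶠ[𝓝 z] g) : dz j f z = dz j g z := by
  simp only [dz, h.fderiv_eq]

theorem dzbar_congr (h : f =ᶠ[𝓝 z] g) : dzbar j f z = dzbar j g z := by
  simp only [dzbar, h.fderiv_eq]

theorem dz_add (hf : DifferentiableAt ℝ f z) (hg : DifferentiableAt ℝ g z) :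
    dz j (fun x => f x + g x) z = dz j f z + dz j g z := by
  simp only [dz, fderiv_fun_add hf hg, add_apply]; ring

theorem dzbar_add (hf : DifferentiableAt ℝ f z) (hg : DifferentiableAt ℝ g z) :
    dzbar j (fun x => f x + g x) z = dzbar j f z + dzbar j g z := by
  simp only [dzbar, fderiv_fun_add hf hg, add_apply]; ring

theorem dz_mul (hf : DifferentiableAt ℝ f z) (hg : DifferentiableAt ℝ g z) :
    dz j (fun x => f x * g x) z = dz j f z * g z + f z * dz j g z := by
  simp only [dz, fderiv_fun_mul hf hg, add_apply, smul_apply, smul_eq_mul]; ring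

theorem dzbar_mul (hf : DifferentiableAt ℝ f z) (hg : DifferentiableAt ℝ g z) :
    dzbar j (fun x => f x * g x) z = dzbar j f z * g z + f z * dzbar j g z := by
  simp only [dzbar, fderiv_fun_mul hf hg, add_apply, smul_apply, smul_eq_mul]; ring

theorem dz_sub (hf : DifferentiableAt ℝ f z) (hg : DifferentiableAt ℝ g z) :
    dz j (fun x => f x - g x) z = dz j f z - dz j g z := by
  simp only [dz, fderiv_fun_sub hf hg, sub_apply]; ring

theorem dzbar_sub (hf : DifferentiableAt ℝ f z) (hg : DifferentiableAt ℝ g z) :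
    dzbar j (fun x => f x - g x) z = dzbar j f z - dzbar j g z := by
  simp only [dzbar, fderiv_fun_sub hf hg, sub_apply]; ring

theorem dz_const_mul (c : ℂ) (hf : DifferentiableAt ℝ f z) :
    dz j (fun x => c * f x) z = c * dz j f z := by
  simp only [dz, fderiv_const_mul hf, smul_apply, smul_eq_mul]; ring

theorem dzbar_const_mul (c : ℂ) (hf : DifferentiableAt ℝ f z) :
    dzbar j (fun x => c * f x) z = c * dzbar j f z := by
  simp only [dzbar, fderiv_const_mul hf, smul_apply, smul_eq_mul]; ring

@[simp] theorem dz_const (c : ℂ) : dz j (fun _ => c) z = 0 := by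
  simp [dz]

@[simp] theorem dzbar_const (c : ℂ) : dzbar j (fun _ => c) z = 0 := by
  simp [dzbar]

theorem fderiv_star_apply (v : Cn n) :
    fderiv ℝ (fun x => star (f x)) z v = star (fderiv ℝ f z v) := by
  have := fderiv_star (𝕜 := ℝ) (f := f) (x := z)
  rw [this]; rfl

theorem dz_star : dz j (fun x => star (f x)) z = star (dzbar j f z) := by
  simp only [dz, dzbar, fderiv_star_apply]
  simp; ring

theorem dzbar_star : dzbar j (fun x => star (f x)) z = star (dz j f z) := by
  simp only [dz, dzbar, fderiv_star_apply]
  simp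

theorem dzbar_ofReal (r : Cn n → ℝ) :
    dzbar j (fun x => (r x : ℂ)) z = star (dz j (fun x => (r x : ℂ)) z) := by
  rw [← dzbar_star]; simp

theorem fderiv_ofReal_apply {r : Cn n → ℝ} (hr : DifferentiableAt ℝ r z) (v : Cn n) :
    fderiv ℝ (fun x => (r x : ℂ)) z v = (fderiv ℝ r z v : ℂ) := by
  have := (Complex.ofRealCLM.hasFDerivAt (x := r z)).comp z hr.hasFDerivAt
  have h2 : HasFDerivAt (fun x => (r x : ℂ)) (Complex.ofRealCLM.comp (fderiv ℝ r z)) z := this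
  rw [h2.fderiv]; rfl

theorem fderiv_real_comp {ψ : Cn n → ℝ} {F : ℝ → ℝ} (hF : DifferentiableAt ℝ F (ψ z))
    (hψ : DifferentiableAt ℝ ψ z) (v : Cn n) :
    fderiv ℝ (fun x => F (ψ x)) z v = deriv F (ψ z) * fderiv ℝ ψ z v := by
  have : HasFDerivAt (fun x => F (ψ x)) (deriv F (ψ z) • fderiv ℝ ψ z) z :=
    hF.hasDerivAt.comp_hasFDerivAt z hψ.hasFDerivAt
  rw [this.fderiv]; simp

theorem dz_comp {ψ : Cn n → ℝ} {F : ℝ → ℝ} (hF : DifferentiableAt ℝ F (ψ z))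
    (hψ : DifferentiableAt ℝ ψ z) :
    dz j (fun x => (F (ψ x) : ℂ)) z = deriv F (ψ z) * dz j (fun x => (ψ x : ℂ)) z := by
  have hc : DifferentiableAt ℝ (fun x => F (ψ x)) z := hF.comp z hψ
  simp only [dz, fderiv_ofReal_apply hc, fderiv_ofReal_apply hψ, fderiv_real_comp hF hψ]
  push_cast; ring

theorem dzbar_comp {ψ : Cn n → ℝ} {F : ℝ → ℝ} (hF : DifferentiableAt ℝ F (ψ z))
    (hψ : DifferentiableAt ℝ ψ z) :
    dzbar j (fun x => (F (ψ x) : ℂ)) z = deriv F (ψ z) * dzbar j (fun x => (ψ x : ℂ)) z := by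
  rw [dzbar_ofReal, dz_comp hF hψ, dzbar_ofReal]
  simp

theorem _root_.ContDiffAt.fderiv_apply_const {m l : WithTop ℕ∞} (hf : ContDiffAt ℝ l f z)
    (h : m + 1 ≤ l) (v : Cn n) : ContDiffAt ℝ m (fun x => fderiv ℝ f x v) z :=
  (hf.fderiv_right h).clm_apply contDiffAt_const

theorem _root_.ContDiffAt.dz {m l : WithTop ℕ∞} (hf : ContDiffAt ℝ l f z) (h : m + 1 ≤ l) :
    ContDiffAt ℝ m (dz j f) z :=
  contDiffAt_const.mul ((ContDiffAt.fderiv_apply_const hf h _).sub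
    (contDiffAt_const.mul (ContDiffAt.fderiv_apply_const hf h _)))

theorem _root_.ContDiffAt.dzbar {m l : WithTop ℕ∞} (hf : ContDiffAt ℝ l f z) (h : m + 1 ≤ l) :
    ContDiffAt ℝ m (dzbar j f) z :=
  contDiffAt_const.mul ((ContDiffAt.fderiv_apply_const hf h _).add
    (contDiffAt_const.mul (ContDiffAt.fderiv_apply_const hf h _)))

theorem _root_.ContDiff.dz {m l : WithTop ℕ∞} (hf : ContDiff ℝ l f) (h : m + 1 ≤ l) :
    ContDiff ℝ m (dz j f) :=
  contDiff_iff_contDiffAt.2 fun _ => ContDiffAt.dz hf.contDiffAt h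

theorem _root_.ContDiff.dzbar {m l : WithTop ℕ∞} (hf : ContDiff ℝ l f) (h : m + 1 ≤ l) :
    ContDiff ℝ m (dzbar j f) :=
  contDiff_iff_contDiffAt.2 fun _ => ContDiffAt.dzbar hf.contDiffAt h

theorem fderiv_fderiv_apply_comm (hf : ContDiffAt ℝ 2 f z) (v w : Cn n) :
    fderiv ℝ (fun x => fderiv ℝ f x v) z w = fderiv ℝ (fun x => fderiv ℝ f x w) z v := by
  have hd : DifferentiableAt ℝ (fderiv ℝ f) z :=
    (hf.fderiv_right (m := 1) (by norm_num)).differentiableAt (by norm_num)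
  have h1 : ∀ v w : Cn n, fderiv ℝ (fun x => fderiv ℝ f x v) z w
      = fderiv ℝ (fderiv ℝ f) z w v := by
    intro v w
    rw [fderiv_clm_apply hd (differentiableAt_const v)]
    simp
  rw [h1, h1, (hf.isSymmSndFDerivAt (by simp)).eq]

/-- Both Wirtinger derivatives have the shape ½(D_v + c D_w), with c = −i or c = i, so this one
formula serves the commutation rules and the bounds on second derivatives. -/
theorem fderiv_wirtinger (hf : ContDiffAt ℝ 2 f z) (c : ℂ) (v w e : Cn n) :
    fderiv ℝ (fun x => (1 / 2 : ℂ) * (fderiv ℝ f x v + c * fderiv ℝ f x w)) z e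
      = (1 / 2 : ℂ) * (fderiv ℝ (fun x => fderiv ℝ f x v) z e
        + c * fderiv ℝ (fun x => fderiv ℝ f x w) z e) := by
  have hd : ∀ v : Cn n, DifferentiableAt ℝ (fun x => fderiv ℝ f x v) z := fun v =>
    ((hf.fderiv_right (m := 1) (by norm_num)).differentiableAt (by norm_num)).clm_apply
      (differentiableAt_const v)
  rw [fderiv_const_mul ((hd v).fun_add ((hd w).const_mul c)), fderiv_fun_add (hd v)
    ((hd w).const_mul c), fderiv_const_mul (hd w)]
  simp; ring

theorem dz_eq_wirtinger (i : Fin n) : dz i f = fun x => (1 / 2 : ℂ) *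
    (fderiv ℝ f x (EuclideanSpace.single i 1)
      + (-I) * fderiv ℝ f x (EuclideanSpace.single i I)) := by
  ext x; simp only [dz]; ring

theorem dzbar_eq_wirtinger (i : Fin n) : dzbar i f = fun x => (1 / 2 : ℂ) *
    (fderiv ℝ f x (EuclideanSpace.single i 1)
      + I * fderiv ℝ f x (EuclideanSpace.single i I)) := rfl

theorem dzbar_dz_comm (hf : ContDiffAt ℝ 2 f z) :
    dzbar j (dz k f) z = dz k (dzbar j f) z := by
  rw [dz_eq_wirtinger (f := f) k, dzbar_eq_wirtinger (f := f) j]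
  simp only [dz, dzbar, fderiv_wirtinger hf]
  rw [fderiv_fderiv_apply_comm hf (EuclideanSpace.single k 1) (EuclideanSpace.single j 1),
    fderiv_fderiv_apply_comm hf (EuclideanSpace.single k 1) (EuclideanSpace.single j I),
    fderiv_fderiv_apply_comm hf (EuclideanSpace.single k I) (EuclideanSpace.single j 1),
    fderiv_fderiv_apply_comm hf (EuclideanSpace.single k I) (EuclideanSpace.single j I)]
  ring

theorem dzbar_dzbar_comm (hf : ContDiffAt ℝ 2 f z) :
    dzbar j (dzbar k f) z = dzbar k (dzbar j f) z := by
  rw [dzbar_eq_wirtinger (f := f) k, dzbar_eq_wirtinger (f := f) j]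
  simp only [dzbar, fderiv_wirtinger hf]
  rw [fderiv_fderiv_apply_comm hf (EuclideanSpace.single k 1) (EuclideanSpace.single j 1),
    fderiv_fderiv_apply_comm hf (EuclideanSpace.single k 1) (EuclideanSpace.single j I),
    fderiv_fderiv_apply_comm hf (EuclideanSpace.single k I) (EuclideanSpace.single j 1),
    fderiv_fderiv_apply_comm hf (EuclideanSpace.single k I) (EuclideanSpace.single j I)]
  ring

theorem dz_eq_zero_of_notMem_tsupport (h : z ∉ tsupport f) : dz j f z = 0 := by
  rw [dz_congr (g := fun _ => 0) (notMem_tsupport_iff_eventuallyEq.1 h)]; simp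

theorem dzbar_eq_zero_of_notMem_tsupport (h : z ∉ tsupport f) : dzbar j f z = 0 := by
  rw [dzbar_congr (g := fun _ => 0) (notMem_tsupport_iff_eventuallyEq.1 h)]; simp

theorem tsupport_dz_subset : tsupport (dz j f) ⊆ tsupport f :=
  closure_minimal (fun z hz => by
    by_contra h; exact hz (dz_eq_zero_of_notMem_tsupport h)) (isClosed_tsupport f)

theorem tsupport_dzbar_subset : tsupport (dzbar j f) ⊆ tsupport f :=
  closure_minimal (fun z hz => by
    by_contra h; exact hz (dzbar_eq_zero_of_notMem_tsupport h)) (isClosed_tsupport f)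

theorem _root_.HasCompactSupport.dz (h : HasCompactSupport f) : HasCompactSupport (dz j f) :=
  h.of_isClosed_subset (isClosed_tsupport _) tsupport_dz_subset

theorem _root_.HasCompactSupport.dzbar (h : HasCompactSupport f) : HasCompactSupport (dzbar j f) :=
  h.of_isClosed_subset (isClosed_tsupport _) tsupport_dzbar_subset

theorem integral_fderiv_eq_zero (hf : ContDiff ℝ 1 f) (hc : HasCompactSupport f) (v : Cn n) :
    ∫ z, fderiv ℝ f z v = 0 := by
  have hcont : Continuous (fun z => fderiv ℝ f z v) :=
    (hf.continuous_fderiv (by norm_num)).clm_apply continuous_const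
  have hc' : HasCompactSupport (fun z => fderiv ℝ f z v) := hc.fderiv_apply (𝕜 := ℝ) v
  -- Integration by parts against the constant function 1.
  have := integral_mul_fderiv_eq_neg_fderiv_mul_of_integrable (μ := (volume : Measure (Cn n)))
    (f := fun _ => (1 : ℂ)) (g := f) (v := v) (by simp)
    (by simpa using hcont.integrable_of_hasCompactSupport hc')
    (by simpa using hf.continuous.integrable_of_hasCompactSupport hc)
    (fun x _ => differentiableAt_const _) (fun x _ => hf.differentiable (by norm_num) x)
  simpa using this

theorem integral_dz_eq_zero (hf : ContDiff ℝ 1 f) (hc : HasCompactSupport f) :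
    ∫ z, dz j f z = 0 := by
  have hi : ∀ v : Cn n, Integrable (fun z => fderiv ℝ f z v) := fun v =>
    ((hf.continuous_fderiv (by norm_num)).clm_apply
      continuous_const).integrable_of_hasCompactSupport (hc.fderiv_apply (𝕜 := ℝ) v)
  simp only [dz]
  rw [integral_const_mul, integral_sub (hi _) ((hi _).const_mul I), integral_const_mul,
    integral_fderiv_eq_zero hf hc, integral_fderiv_eq_zero hf hc]
  simp

theorem integral_dzbar_eq_zero (hf : ContDiff ℝ 1 f) (hc : HasCompactSupport f) :
    ∫ z, dzbar j f z = 0 := by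
  have hi : ∀ v : Cn n, Integrable (fun z => fderiv ℝ f z v) := fun v =>
    ((hf.continuous_fderiv (by norm_num)).clm_apply
      continuous_const).integrable_of_hasCompactSupport (hc.fderiv_apply (𝕜 := ℝ) v)
  simp only [dzbar]
  rw [integral_const_mul, integral_add (hi _) ((hi _).const_mul I), integral_const_mul,
    integral_fderiv_eq_zero hf hc, integral_fderiv_eq_zero hf hc]
  simp

end Calculus

/-! ### The Kohn–Morrey–Hörmander identity for smooth compactly supported forms. -/

section KohnMorrey

theorem dz_exp_neg {φ : Cn n → ℝ} (hφ : ContDiff ℝ ∞ φ) (j : Fin n) (z : Cn n) :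
    dz j (fun z => ((Real.exp (-φ z) : ℝ) : ℂ)) z
      = -(dz j (fun z => (φ z : ℂ)) z * (Real.exp (-φ z) : ℝ)) := by
  have hd : HasDerivAt (fun t : ℝ => Real.exp (-t)) (-Real.exp (-φ z)) (φ z) := by
    simpa using (hasDerivAt_neg (φ z)).exp
  rw [dz_comp (F := fun t => Real.exp (-t)) hd.differentiableAt
    (hφ.differentiable (by simp) z), hd.deriv]
  push_cast; ring

theorem dzbar_exp_neg {φ : Cn n → ℝ} (hφ : ContDiff ℝ ∞ φ) (j : Fin n) (z : Cn n) :
    dzbar j (fun z => ((Real.exp (-φ z) : ℝ) : ℂ)) z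
      = -(star (dz j (fun z => (φ z : ℂ)) z) * (Real.exp (-φ z) : ℝ)) := by
  rw [dzbar_ofReal, dz_exp_neg hφ, star_neg, star_mul', star_def, conj_ofReal]

theorem contDiff_ofReal {φ : Cn n → ℝ} {l : WithTop ℕ∞} (hφ : ContDiff ℝ l φ) :
    ContDiff ℝ l (fun z => (φ z : ℂ)) :=
  Complex.ofRealCLM.contDiff.comp hφ

theorem contDiff_star {f : Cn n → ℂ} {l : WithTop ℕ∞} (hf : ContDiff ℝ l f) :
    ContDiff ℝ l (fun z => star (f z)) :=
  (starL' ℝ (A := ℂ)).contDiff.comp hf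

theorem hasCompactSupport_of_zero {E F G : Type*} [TopologicalSpace E] [Zero F] [Zero G]
    {f : E → F} {g : E → G} (hf : HasCompactSupport f)
    (h : ∀ z, f z = 0 → g z = 0) : HasCompactSupport g :=
  hf.mono fun z hz hz' => hz (h z hz')

/-- The pointwise identity behind the Kohn–Morrey formula. -/
theorem kohn_morrey_pointwise {φ : Cn n → ℝ} (hφ : ContDiff ℝ ∞ φ) {u v : Cn n → ℂ}
    (hu : ContDiff ℝ ∞ u) (hv : ContDiff ℝ ∞ v) (j k : Fin n) (z : Cn n) :
    (dz j u z - dz j (fun z => (φ z : ℂ)) z * u z)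
        * star (dz k v z - dz k (fun z => (φ z : ℂ)) z * v z) * (Real.exp (-φ z) : ℝ)
      - dzbar k u z * star (dzbar j v z) * (Real.exp (-φ z) : ℝ)
      - dz j (dzbar k (fun z => (φ z : ℂ))) z * u z * star (v z) * (Real.exp (-φ z) : ℝ)
    = dz j (fun z => u z * (Real.exp (-φ z) : ℝ)
          * star (dz k v z - dz k (fun z => (φ z : ℂ)) z * v z)) z
      - dzbar k (fun z => u z * (Real.exp (-φ z) : ℝ) * star (dzbar j v z)) z := by
  have hφc : ContDiff ℝ ∞ (fun z => (φ z : ℂ)) := contDiff_ofReal hφ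
  have hW : ContDiff ℝ ∞ (fun z => ((Real.exp (-φ z) : ℝ) : ℂ)) :=
    contDiff_ofReal (Real.contDiff_exp.comp hφ.neg)
  have D : ∀ {f : Cn n → ℂ}, ContDiff ℝ ∞ f → DifferentiableAt ℝ f z :=
    fun h => h.differentiable (by simp) z
  have hdk : ContDiff ℝ ∞ (dz k v) := hv.dz (by simp)
  have hbj : ContDiff ℝ ∞ (dzbar j v) := hv.dzbar (by simp)
  have hak : ContDiff ℝ ∞ (dz k (fun z => (φ z : ℂ))) := hφc.dz (by simp)
  have hδ : ContDiff ℝ ∞ (fun z => dz k v z - dz k (fun z => (φ z : ℂ)) z * v z) :=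
    hdk.sub (hak.mul hv)
  have hH : star (dzbar j (dz k (fun z => (φ z : ℂ))) z)
      = dz j (dzbar k (fun z => (φ z : ℂ))) z := by
    rw [← dz_star]
    congr 1; ext x; rw [dzbar_ofReal]
  -- After expansion the second derivatives of `v` cancel because ∂/∂z̄_j and ∂/∂z_k commute, and
  -- the terms pairing ∂φ/∂z_k with ∂v/∂z̄_j cancel because the weight e^{-φ} produces the same
  -- term. Only the second derivative of φ survives.
  rw [dz_mul (D (hu.mul hW)) (D (contDiff_star hδ)), dz_mul (D hu) (D hW), dz_star,
    dzbar_sub (D hdk) (D (hak.mul hv)), dzbar_mul (D hak) (D hv),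
    dzbar_dz_comm (hv.contDiffAt.of_le (by norm_cast)),
    dzbar_mul (D (hu.mul hW)) (D (contDiff_star hbj)), dzbar_mul (D hu) (D hW), dzbar_star,
    dz_exp_neg hφ, dzbar_exp_neg hφ]
  simp only [star_sub, star_add, star_mul', hH]
  ring

theorem leviForm_toLp (φ : Cn n → ℝ) (z : Cn n) (w : Fin n → ℂ) :
    leviForm φ z (WithLp.toLp 2 w)
      = (∑ j, ∑ k, dz j (dzbar k (fun z => (φ z : ℂ))) z * w j * star (w k)).re := rfl

theorem normSq_sum_eq_re (a : Fin n → ℂ) :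
    ‖∑ j, a j‖ ^ 2 = (∑ j, ∑ k, a j * star (a k)).re := by
  rw [← Finset.sum_mul_sum, ← star_sum, star_def, Complex.mul_conj, Complex.normSq_eq_norm_sq,
    ofReal_re]

/-- Expand |a − b|². The mixed sum on the right is what commuting derivatives produces in the
Kohn–Morrey computation, and this turns it into ∂̄u; the factor ½ appears because every pair j < k
occurs twice. -/
theorem half_sum_normSq_sub (A : Fin n → Fin n → ℂ) :
    (1 / 2) * ∑ j, ∑ k, ‖A k j - A j k‖ ^ 2
      = ∑ j, ∑ k, ‖A j k‖ ^ 2 - (∑ j, ∑ k, A j k * star (A k j)).re := by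
  have h : ∀ j k, ‖A k j - A j k‖ ^ 2
      = ‖A k j‖ ^ 2 + ‖A j k‖ ^ 2 - 2 * (A j k * star (A k j)).re := by
    intro j k
    simp only [← Complex.normSq_eq_norm_sq, Complex.normSq_apply, Complex.mul_re, sub_re, sub_im,
      star_def, conj_re, conj_im]
    ring
  simp only [h, Finset.sum_sub_distrib, Finset.sum_add_distrib, ← Finset.mul_sum, re_sum]
  rw [Finset.sum_comm]
  ring

/-- The Kohn–Morrey–Hörmander identity for compactly supported smooth forms. -/
theorem kohn_morrey {φ : Cn n → ℝ} (hφ : ContDiff ℝ ∞ φ) {u : Fin n → Cn n → ℂ}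
    (hu : ∀ j, ContDiff ℝ ∞ (u j)) (hc : ∀ j, HasCompactSupport (u j)) :
    ∫ z, (∑ j, ∑ k, ‖dzbar k (u j) z‖ ^ 2) * Real.exp (-φ z)
      = (∫ z, ‖∑ j, (dz j (u j) z - dz j (fun z => (φ z : ℂ)) z * u j z)‖ ^ 2 * Real.exp (-φ z))
        + (∫ z, (1 / 2 * ∑ j, ∑ k, ‖dzbar j (u k) z - dzbar k (u j) z‖ ^ 2) * Real.exp (-φ z))
        - ∫ z, leviForm φ z (WithLp.toLp 2 fun j => u j z) * Real.exp (-φ z) := by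
  have hφc : ContDiff ℝ ∞ (fun z => (φ z : ℂ)) := contDiff_ofReal hφ
  have hWr : Continuous (fun z => Real.exp (-φ z)) := Real.continuous_exp.comp hφ.continuous.neg
  have hW : ContDiff ℝ ∞ (fun z => ((Real.exp (-φ z) : ℝ) : ℂ)) :=
    contDiff_ofReal (Real.contDiff_exp.comp hφ.neg)
  have c1 : ∀ j k, Continuous (dzbar k (u j)) := fun j k => ((hu j).dzbar (m := ∞) (by simp)).continuous
  have c2 : ∀ j k, Continuous (dz k (u j)) := fun j k => ((hu j).dz (m := ∞) (by simp)).continuous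
  have c3 : ∀ j, Continuous (dz j (fun z => (φ z : ℂ))) :=
    fun j => (hφc.dz (m := ∞) (by simp)).continuous
  have c4 : ∀ j k, Continuous (dz j (dzbar k (fun z => (φ z : ℂ)))) :=
    fun j k => ((hφc.dzbar (m := ∞) (by simp)).dz (m := ∞) (by simp)).continuous
  have c5 : ∀ j, Continuous (u j) := fun j => (hu j).continuous
  set K : Set (Cn n) := ⋃ j, tsupport (u j) with hK
  have hKc : IsCompact K := isCompact_iUnion fun j => hc j
  have hKz : ∀ z, z ∉ K → ∀ j, z ∉ tsupport (u j) := fun z hz j hj =>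
    hz (Set.mem_iUnion.2 ⟨j, hj⟩)
  have hint : ∀ F : Cn n → ℝ, Continuous F → (∀ z, z ∉ K → F z = 0) → Integrable F :=
    fun F hF h0 => hF.integrable_of_hasCompactSupport (HasCompactSupport.intro hKc h0)
  have z1 : ∀ z, z ∉ K → ∀ j, u j z = 0 := fun z hz j => image_eq_zero_of_notMem_tsupport (hKz z hz j)
  have z2 : ∀ z, z ∉ K → ∀ j k, dz k (u j) z = 0 := fun z hz j k =>
    dz_eq_zero_of_notMem_tsupport (hKz z hz j)
  have z3 : ∀ z, z ∉ K → ∀ j k, dzbar k (u j) z = 0 := fun z hz j k =>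
    dzbar_eq_zero_of_notMem_tsupport (hKz z hz j)
  have i1 : Integrable (fun z => (∑ j, ∑ k, ‖dzbar k (u j) z‖ ^ 2) * Real.exp (-φ z)) := by
    refine hint _ (by fun_prop) fun z hz => by simp [z3 z hz]
  have i2 : Integrable (fun z => ‖∑ j, (dz j (u j) z - dz j (fun z => (φ z : ℂ)) z * u j z)‖ ^ 2
      * Real.exp (-φ z)) := by
    refine hint _ (by fun_prop) fun z hz => by simp [z1 z hz, z2 z hz]
  have i3 : Integrable (fun z => (1 / 2 * ∑ j, ∑ k, ‖dzbar j (u k) z - dzbar k (u j) z‖ ^ 2)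
      * Real.exp (-φ z)) := by
    refine hint _ (by fun_prop) fun z hz => by simp [z3 z hz]
  have i4 : Integrable (fun z => leviForm φ z (WithLp.toLp 2 fun j => u j z)
      * Real.exp (-φ z)) := by
    simp only [leviForm_toLp]
    refine hint _ ?_ fun z hz => by simp [z1 z hz]
    exact (Complex.continuous_re.comp (by fun_prop)).mul hWr
  -- The pointwise identity is a difference of divergences of `X` and `Y`. Both are compactly
  -- supported, so they integrate to zero and no boundary term arises.
  set X : Fin n → Fin n → Cn n → ℂ := fun j k z => u j z * (Real.exp (-φ z) : ℝ)
          * star (dz k (u k) z - dz k (fun z => (φ z : ℂ)) z * u k z) with hX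
  set Y : Fin n → Fin n → Cn n → ℂ := fun j k z => u j z * (Real.exp (-φ z) : ℝ)
          * star (dzbar j (u k) z) with hY
  have hXs : ∀ j k, ContDiff ℝ ∞ (X j k) := fun j k => ((hu j).mul hW).mul
    (contDiff_star (((hu k).dz (by simp)).sub ((hφc.dz (by simp)).mul (hu k))))
  have hYs : ∀ j k, ContDiff ℝ ∞ (Y j k) := fun j k => ((hu j).mul hW).mul
    (contDiff_star ((hu k).dzbar (by simp)))
  have hXc : ∀ j k, HasCompactSupport (X j k) := fun j k =>
    hasCompactSupport_of_zero (hc j) fun z hz => by simp [hX, hz]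
  have hYc : ∀ j k, HasCompactSupport (Y j k) := fun j k =>
    hasCompactSupport_of_zero (hc j) fun z hz => by simp [hY, hz]
  have iX : ∀ j k, Integrable (dz j (X j k)) := fun j k =>
    ((hXs j k).dz (m := ∞) (by simp)).continuous.integrable_of_hasCompactSupport (hXc j k).dz
  have iY : ∀ j k, Integrable (dzbar k (Y j k)) := fun j k =>
    ((hYs j k).dzbar (m := ∞) (by simp)).continuous.integrable_of_hasCompactSupport (hYc j k).dzbar
  have iXY : ∀ j k, Integrable (fun z => dz j (X j k) z - dzbar k (Y j k) z) := fun j k =>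
    (iX j k).sub (iY j k)
  have hzero : ∫ z, (∑ j, ∑ k, (dz j (X j k) z - dzbar k (Y j k) z)) = 0 := by
    rw [integral_finsetSum _ fun j _ => integrable_finsetSum _ fun k _ => iXY j k]
    refine Finset.sum_eq_zero fun j _ => ?_
    rw [integral_finsetSum _ fun k _ => iXY j k]
    refine Finset.sum_eq_zero fun k _ => ?_
    rw [integral_sub (iX j k) (iY j k),
      integral_dz_eq_zero ((hXs j k).of_le (by exact_mod_cast le_top)) (hXc j k),
      integral_dzbar_eq_zero ((hYs j k).of_le (by exact_mod_cast le_top)) (hYc j k), sub_zero]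
  have hre : ∫ z, (∑ j, ∑ k, (dz j (X j k) z - dzbar k (Y j k) z)).re = 0 := by
    have := Complex.reCLM.integral_comp_comm (μ := (volume : Measure (Cn n)))
      (φ := fun z => ∑ j, ∑ k, (dz j (X j k) z - dzbar k (Y j k) z))
      (integrable_finsetSum _ fun j _ => integrable_finsetSum _ fun k _ => iXY j k)
    rw [hzero] at this
    exact this
  have hpt : ∀ z, (∑ j, ∑ k, (dz j (X j k) z - dzbar k (Y j k) z)).re
      = ‖∑ j, (dz j (u j) z - dz j (fun z => (φ z : ℂ)) z * u j z)‖ ^ 2 * Real.exp (-φ z)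
        + (1 / 2 * ∑ j, ∑ k, ‖dzbar j (u k) z - dzbar k (u j) z‖ ^ 2) * Real.exp (-φ z)
        - leviForm φ z (WithLp.toLp 2 fun j => u j z) * Real.exp (-φ z)
        - (∑ j, ∑ k, ‖dzbar k (u j) z‖ ^ 2) * Real.exp (-φ z) := by
    intro z
    rw [normSq_sum_eq_re, half_sum_normSq_sub (fun j k => dzbar k (u j) z), leviForm_toLp]
    have : ∑ j, ∑ k, (dz j (X j k) z - dzbar k (Y j k) z) =
        (∑ j, ∑ k, (dz j (u j) z - dz j (fun z => (φ z : ℂ)) z * u j z)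
        * star (dz k (u k) z - dz k (fun z => (φ z : ℂ)) z * u k z)
        - ∑ j, ∑ k, dzbar k (u j) z * star (dzbar j (u k) z)
        - ∑ j, ∑ k, dz j (dzbar k (fun z => (φ z : ℂ))) z * u j z * star (u k z))
          * (Real.exp (-φ z) : ℝ) := by
      simp only [← Finset.sum_sub_distrib, Finset.sum_mul]
      refine Finset.sum_congr rfl fun j _ => Finset.sum_congr rfl fun k _ => ?_
      rw [← kohn_morrey_pointwise hφ (hu j) (hu k) j k z]
      ring
    rw [this, Complex.re_mul_ofReal]
    simp only [sub_re]
    ring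
  simp only [hpt] at hre
  have e1 := integral_sub ((i2.add i3).sub i4) i1
  have e2 := integral_sub (i2.add i3) i4
  have e3 := integral_add i2 i3
  simp only [Pi.add_apply, Pi.sub_apply] at e1 e2 e3
  linarith

end KohnMorrey

/-! ### Mollifiers and their convergence in L². -/

section Mollification

open Filter Topology
open scoped ENNReal Convolution

/-- Convolution of `g` with the kernel `ρ`. -/
def mollify (ρ : Cn n → ℂ) (g : Cn n → ℂ) (x : Cn n) : ℂ := ∫ y, g y * ρ (x - y)

theorem mollify_eq_convolution (ρ g : Cn n → ℂ) :
    mollify ρ g = convolution ρ g (ContinuousLinearMap.mul ℝ ℂ) volume := by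
  ext x
  rw [convolution_eq_swap]
  simp [mollify, mul_comm]

theorem contDiff_mollify {ρ g : Cn n → ℂ} (hρ : ContDiff ℝ ∞ ρ) (hc : HasCompactSupport ρ)
    (hg : LocallyIntegrable g) : ContDiff ℝ ∞ (mollify ρ g) := by
  rw [mollify_eq_convolution]
  exact hc.contDiff_convolution_left _ hρ hg

theorem hasCompactSupport_mollify {ρ g : Cn n → ℂ} (hc : HasCompactSupport ρ)
    (hg : HasCompactSupport g) : HasCompactSupport (mollify ρ g) := by
  rw [mollify_eq_convolution]
  exact hc.convolution _ hg

theorem fderiv_mollify {ρ g : Cn n → ℂ} (hρ : ContDiff ℝ ∞ ρ) (hc : HasCompactSupport ρ)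
    (hg : LocallyIntegrable g) (x v : Cn n) :
    fderiv ℝ (mollify ρ g) x v = ∫ y, g y * fderiv ℝ ρ (x - y) v := by
  have h := hc.hasFDerivAt_convolution_left (ContinuousLinearMap.mul ℝ ℂ)
    (μ := (volume : Measure (Cn n))) (hρ.of_le (by norm_cast)) hg x
  rw [mollify_eq_convolution, h.fderiv, convolution_eq_swap]
  have hint : Integrable (fun y => ((ContinuousLinearMap.mul ℝ ℂ).precompL (Cn n))
      (fderiv ℝ ρ (x - y)) (g y)) := by
    have := (hc.fderiv (𝕜 := ℝ)).convolutionExists_left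
      ((ContinuousLinearMap.mul ℝ ℂ).precompL (Cn n)) (hρ.continuous_fderiv (by simp)) hg x
    exact this.integrable_swap
  rw [ContinuousLinearMap.integral_apply hint]
  simp [ContinuousLinearMap.precompL_apply, mul_comm]

theorem fderiv_comp_sub_left {ρ : Cn n → ℂ} (hρ : ContDiff ℝ ∞ ρ) (x y v : Cn n) :
    fderiv ℝ (fun y => ρ (x - y)) y v = -fderiv ℝ ρ (x - y) v := by
  have h := ((hρ.differentiable (by simp) (x - y)).hasFDerivAt).comp y
    ((hasFDerivAt_id y).const_sub x)
  have h' : HasFDerivAt (fun y => ρ (x - y))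
    ((fderiv ℝ ρ (x - y)).comp (-ContinuousLinearMap.id ℝ (Cn n))) y := h
  rw [h'.fderiv]
  simp

theorem integrable_mul_of_locallyIntegrable {g ρ : Cn n → ℂ} (hg : LocallyIntegrable g)
    (hρ : Continuous ρ) (hc : HasCompactSupport ρ) : Integrable (fun y => g y * ρ y) := by
  have := hg.integrable_smul_left_of_hasCompactSupport hρ hc
  simpa [mul_comm] using this

theorem integral_mul_fderiv_reflect {ρ g : Cn n → ℂ} (hρ : ContDiff ℝ ∞ ρ)
    (hc : HasCompactSupport ρ) (hg : LocallyIntegrable g) (x v : Cn n) :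
    Integrable (fun y => g y * fderiv ℝ (fun y => ρ (x - y)) y v) := by
  have h1 : ContDiff ℝ ∞ (fun y => ρ (x - y)) := hρ.comp (contDiff_const.sub contDiff_id)
  have h2 : HasCompactSupport (fun y => ρ (x - y)) :=
    hc.comp_homeomorph (Homeomorph.subLeft x)
  exact integrable_mul_of_locallyIntegrable hg
    ((h1.continuous_fderiv (by simp)).clm_apply continuous_const) (h2.fderiv_apply (𝕜 := ℝ) v)

/-- The derivative falls on the kernel, and passing from the variable x to y changes the sign. In
this form the kernel ρ(x − ·) acts as a test function, so weak equations for `g` can be inserted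
directly. -/
theorem dz_mollify {ρ g : Cn n → ℂ} (hρ : ContDiff ℝ ∞ ρ) (hc : HasCompactSupport ρ)
    (hg : LocallyIntegrable g) (j : Fin n) (x : Cn n) :
    dz j (mollify ρ g) x = -∫ y, g y * dz j (fun y => ρ (x - y)) y := by
  have hi := integral_mul_fderiv_reflect hρ hc hg x
  have e : ∀ y, g y * dz j (fun y => ρ (x - y)) y = (1 / 2) *
    (g y * fderiv ℝ (fun y => ρ (x - y)) y (EuclideanSpace.single j 1)
      - I * (g y * fderiv ℝ (fun y => ρ (x - y)) y (EuclideanSpace.single j I))) := by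
    intro y; simp only [dz]; ring
  simp only [e]
  rw [integral_const_mul, integral_sub (hi _) ((hi _).const_mul I), integral_const_mul]
  simp only [dz, fderiv_mollify hρ hc hg, fderiv_comp_sub_left hρ, mul_neg, integral_neg]
  ring

theorem dzbar_mollify {ρ g : Cn n → ℂ} (hρ : ContDiff ℝ ∞ ρ) (hc : HasCompactSupport ρ)
    (hg : LocallyIntegrable g) (j : Fin n) (x : Cn n) :
    dzbar j (mollify ρ g) x = -∫ y, g y * dzbar j (fun y => ρ (x - y)) y := by
  have hi := integral_mul_fderiv_reflect hρ hc hg x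
  have e : ∀ y, g y * dzbar j (fun y => ρ (x - y)) y = (1 / 2) *
    (g y * fderiv ℝ (fun y => ρ (x - y)) y (EuclideanSpace.single j 1)
      + I * (g y * fderiv ℝ (fun y => ρ (x - y)) y (EuclideanSpace.single j I))) := by
    intro y; simp only [dzbar]; ring
  simp only [e]
  rw [integral_const_mul, integral_add (hi _) ((hi _).const_mul I), integral_const_mul]
  simp only [dzbar, fderiv_mollify hρ hc hg, fderiv_comp_sub_left hρ, mul_neg, integral_neg]
  ring

/-- A smooth nonnegative bump of integral one supported in the ball of radius `1 / (i + 1)`. -/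
def bumpSeq (i : ℕ) : ContDiffBump (0 : Cn n) :=
  ⟨1 / (2 * (i + 1)), 1 / (i + 1), by positivity, by
    apply one_div_lt_one_div_of_lt <;> nlinarith [(Nat.cast_nonneg i : (0 : ℝ) ≤ i)]⟩

/-- The corresponding complex-valued mollifier. -/
def molKer (i : ℕ) (z : Cn n) : ℂ := ((bumpSeq (n := n) i).normed volume z : ℝ)

theorem molKer_smooth (i : ℕ) : ContDiff ℝ ∞ (molKer (n := n) i) :=
  contDiff_ofReal (bumpSeq i).contDiff_normed

theorem molKer_hasCompactSupport (i : ℕ) : HasCompactSupport (molKer (n := n) i) :=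
  hasCompactSupport_of_zero ((bumpSeq (n := n) i).hasCompactSupport_normed (μ := volume))
    fun z hz => by simp [molKer, hz]

theorem mollify_molKer_eq (i : ℕ) (g : Cn n → ℂ) :
    mollify (molKer i) g = convolution ((bumpSeq (n := n) i).normed volume) g
      (ContinuousLinearMap.lsmul ℝ ℝ) volume := by
  ext x
  rw [convolution_eq_swap]
  simp [mollify, molKer, mul_comm]

theorem lintegral_molKer (i : ℕ) : ∫⁻ t : Cn n, ‖molKer i t‖ₑ = 1 := by
  have h := (bumpSeq (n := n) i).integral_normed (μ := volume)
  have h2 := ofReal_integral_eq_lintegral_ofReal ((bumpSeq (n := n) i).integrable_normed (μ := volume))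
    (ae_of_all _ fun t => (bumpSeq (n := n) i).nonneg_normed t)
  rw [h, ENNReal.ofReal_one] at h2
  rw [h2]
  refine lintegral_congr fun t => ?_
  rw [molKer, ← ofReal_norm, Complex.norm_real, Real.norm_of_nonneg
    ((bumpSeq (n := n) i).nonneg_normed t)]

/-- Jensen's inequality for the square and the probability density `k`: split k = k^{1/2} k^{1/2}
and use Hölder with both exponents 2. -/
theorem sq_lintegral_le {α : Type*} [MeasurableSpace α] {μ : Measure α} {k a : α → ℝ≥0∞}
    (hk : AEMeasurable k μ) (ha : AEMeasurable a μ) (h1 : ∫⁻ t, k t ∂μ = 1) :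
    (∫⁻ t, k t * a t ∂μ) ^ 2 ≤ ∫⁻ t, k t * a t ^ 2 ∂μ := by
  have h := ENNReal.lintegral_mul_le_Lp_mul_Lq μ (p := 2) (q := 2) (by
    constructor <;> norm_num) (f := fun t => k t ^ (1 / 2 : ℝ))
    (g := fun t => k t ^ (1 / 2 : ℝ) * a t) (hk.pow_const _) ((hk.pow_const _).mul ha)
  have e1 : ∀ t, k t ^ (1 / 2 : ℝ) * k t ^ (1 / 2 : ℝ) = k t := fun t => by
    rw [← ENNReal.rpow_add_of_nonneg _ _ (by norm_num) (by norm_num)]; norm_num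
  have e2 : ∀ t, (k t ^ (1 / 2 : ℝ)) ^ (2 : ℝ) = k t := fun t => by
    rw [← ENNReal.rpow_mul]; norm_num
  simp only [Pi.mul_apply, ← mul_assoc, e1, e2, h1, ENNReal.mul_rpow_of_nonneg _ _ (zero_le_two)]
    at h
  rw [ENNReal.one_rpow, one_mul] at h
  calc (∫⁻ t, k t * a t ∂μ) ^ 2 ≤ ((∫⁻ t, k t * a t ^ (2 : ℝ) ∂μ) ^ (1 / 2 : ℝ)) ^ 2 := by
        gcongr
    _ = ∫⁻ t, k t * a t ^ 2 ∂μ := by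
        rw [← ENNReal.rpow_natCast, ← ENNReal.rpow_mul]; norm_num

theorem eLpNorm_two_sq {α E : Type*} [MeasurableSpace α] [NormedAddCommGroup E] (μ : Measure α)
    (f : α → E) : eLpNorm f 2 μ ^ 2 = ∫⁻ x, ‖f x‖ₑ ^ 2 ∂μ := by
  rw [eLpNorm_eq_lintegral_rpow_enorm_toReal (by norm_num) (by norm_num), ← ENNReal.rpow_natCast,
    ← ENNReal.rpow_mul]
  norm_num

/-- Young's inequality for a kernel of mass one: Jensen at each point, then Tonelli and translation
invariance. -/
theorem eLpNorm_mollify_le (i : ℕ) {g : Cn n → ℂ} (hg : AEStronglyMeasurable g volume) :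
    eLpNorm (mollify (molKer i) g) 2 volume ≤ eLpNorm g 2 volume := by
  -- Replacing `g` by a measurable representative changes the mollification at no point and leaves
  -- the L² norm alone.
  wlog hm : StronglyMeasurable g generalizing g
  · have h1 : mollify (molKer i) g = mollify (molKer i) (hg.mk g) := by
      ext x
      refine integral_congr_ae ?_
      filter_upwards [hg.ae_eq_mk] with y hy
      rw [hy]
    rw [h1, eLpNorm_congr_ae hg.ae_eq_mk]
    exact this hg.stronglyMeasurable_mk.aestronglyMeasurable hg.stronglyMeasurable_mk
  rw [← ENNReal.pow_le_pow_left_iff two_ne_zero, eLpNorm_two_sq, eLpNorm_two_sq]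
  have hk : Measurable (fun t : Cn n => ‖molKer i t‖ₑ) :=
    (molKer_smooth i).continuous.measurable.enorm
  have hgm := hm.measurable
  have h1 : ∀ x, ‖mollify (molKer i) g x‖ₑ ^ 2 ≤ ∫⁻ t, ‖molKer i t‖ₑ * ‖g (x - t)‖ₑ ^ 2 := by
    intro x
    refine le_trans ?_ (sq_lintegral_le hk.aemeasurable (by fun_prop) (lintegral_molKer i))
    gcongr
    rw [mollify_eq_convolution, convolution_def]
    refine (enorm_integral_le_lintegral_enorm _).trans_eq ?_
    simp
  calc ∫⁻ x, ‖mollify (molKer i) g x‖ₑ ^ 2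
      ≤ ∫⁻ x, ∫⁻ t, ‖molKer i t‖ₑ * ‖g (x - t)‖ₑ ^ 2 := lintegral_mono h1
    _ = ∫⁻ t, ∫⁻ x, ‖molKer i t‖ₑ * ‖g (x - t)‖ₑ ^ 2 := by
        rw [lintegral_lintegral_swap]
        apply Measurable.aemeasurable
        exact (hk.comp measurable_snd).mul
          ((hgm.comp (measurable_fst.sub measurable_snd)).enorm.pow_const 2)
    _ = ∫⁻ t, ‖molKer i t‖ₑ * ∫⁻ x, ‖g x‖ₑ ^ 2 := by
        refine lintegral_congr fun t => ?_
        rw [lintegral_const_mul _ (by fun_prop), lintegral_sub_right_eq_self (fun x => ‖g x‖ₑ ^ 2)]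
    _ = ∫⁻ x, ‖g x‖ₑ ^ 2 := by
        rw [lintegral_mul_const _ hk, lintegral_molKer, one_mul]

theorem mollify_sub {i : ℕ} {f g : Cn n → ℂ} (hf : LocallyIntegrable f)
    (hg : LocallyIntegrable g) :
    mollify (molKer i) (fun z => f z - g z)
      = fun z => mollify (molKer i) f z - mollify (molKer i) g z := by
  ext x
  have h : ∀ {f : Cn n → ℂ}, LocallyIntegrable f → Integrable (fun y => f y * molKer i (x - y)) :=
    fun hf => integrable_mul_of_locallyIntegrable hf
      ((molKer_smooth i).continuous.comp (continuous_const.sub continuous_id))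
      ((molKer_hasCompactSupport i).comp_homeomorph (Homeomorph.subLeft x))
  simp only [mollify, sub_mul]
  rw [integral_sub (h hf) (h hg)]

theorem mollify_dist_le {i : ℕ} {g : Cn n → ℂ} {x : Cn n} {ε : ℝ}
    (hg : AEStronglyMeasurable g volume)
    (h : ∀ y ∈ Metric.ball x (1 / (i + 1)), dist (g y) (g x) ≤ ε) :
    dist (mollify (molKer i) g x) (g x) ≤ ε := by
  rw [mollify_molKer_eq]
  exact (bumpSeq (n := n) i).dist_normed_convolution_le hg h

theorem mollify_eq_zero {i : ℕ} {g : Cn n → ℂ} {x : Cn n}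
    (hg : AEStronglyMeasurable g volume)
    (h : ∀ y ∈ Metric.ball x (1 / (i + 1) : ℝ), g y = 0) :
    mollify (molKer i) g x = 0 := by
  have hx : g x = 0 := h x (Metric.mem_ball_self (by positivity))
  have := mollify_dist_le (ε := 0) hg (fun y hy => by rw [h y hy, hx]; simp)
  simpa [hx] using this

theorem tendsto_one_div_add : Tendsto (fun i : ℕ => (1 / (i + 1) : ℝ)) atTop (𝓝 0) :=
  tendsto_one_div_add_atTop_nhds_zero_nat

theorem mollify_dist_le_of_continuous {g : Cn n → ℂ} (hg : Continuous g)
    (hc : HasCompactSupport g) {ε : ℝ} (hε : 0 < ε) :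
    ∀ᶠ i in atTop, ∀ x, dist (mollify (molKer i) g x) (g x) ≤ ε := by
  obtain ⟨δ, hδ, h⟩ := Metric.uniformContinuous_iff.1 (hc.uniformContinuous_of_continuous hg) ε hε
  filter_upwards [(tendsto_one_div_add).eventually (gt_mem_nhds hδ)] with i hi x
  refine mollify_dist_le hg.aestronglyMeasurable fun y hy => (h ?_).le
  exact (Metric.mem_ball.1 hy).trans hi

/-- The convergence is uniform, by uniform continuity, and takes place on one compact set: every
kernel is supported in the unit ball, so all supports lie in the closed 1-neighbourhood of the
support of `g`. -/
theorem tendsto_eLpNorm_mollify_of_continuous {g : Cn n → ℂ} (hg : Continuous g)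
    (hc : HasCompactSupport g) :
    Tendsto (fun i => eLpNorm (fun z => mollify (molKer i) g z - g z) 2 volume) atTop (𝓝 0) := by
  set K := Metric.cthickening 1 (tsupport g) with hK
  have hKc : IsCompact K := hc.cthickening
  have hKm : volume K ≠ ⊤ := hKc.measure_lt_top.ne
  have hout : ∀ (i : ℕ) x, x ∉ K → mollify (molKer i) g x - g x = 0 := by
    intro i x hx
    have h0 : ∀ y ∈ Metric.ball x (1 / (i + 1) : ℝ), g y = 0 := by
      intro y hy
      by_contra hne
      apply hx
      refine Metric.mem_cthickening_of_dist_le x y 1 _ (subset_tsupport g hne) ?_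
      rw [dist_comm]
      refine (Metric.mem_ball.1 hy).le.trans ?_
      rw [div_le_one (by positivity)]
      linarith [(Nat.cast_nonneg i : (0 : ℝ) ≤ i)]
    rw [mollify_eq_zero hg.aestronglyMeasurable h0, h0 x (Metric.mem_ball_self (by positivity)),
      sub_zero]
  rw [ENNReal.tendsto_atTop_zero]
  intro ε hε
  obtain ⟨δ, hδ, hle⟩ : ∃ δ : ℝ, 0 < δ ∧ ENNReal.ofReal δ * volume K ^ (1 / 2 : ℝ) ≤ ε := by
    have hfin : volume K ^ (1 / 2 : ℝ) ≠ ⊤ := ENNReal.rpow_ne_top_of_nonneg (by norm_num) hKm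
    have : Tendsto (fun δ : ℝ => ENNReal.ofReal δ * volume K ^ (1 / 2 : ℝ)) (𝓝[>] 0) (𝓝 0) := by
      have h1 : Tendsto (fun δ : ℝ => ENNReal.ofReal δ) (𝓝[>] 0) (𝓝 0) := by
        have := (ENNReal.continuous_ofReal.tendsto 0).mono_left (nhdsWithin_le_nhds (s := Set.Ioi 0))
        simpa using this
      simpa using ENNReal.Tendsto.mul_const h1 (Or.inr hfin)
    obtain ⟨δ, h1, h2⟩ := ((this.eventually (ge_mem_nhds hε)).and self_mem_nhdsWithin).exists
    exact ⟨δ, h2, h1⟩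
  obtain ⟨N, hN⟩ := eventually_atTop.1 (mollify_dist_le_of_continuous hg hc hδ)
  refine ⟨N, fun i hi => ?_⟩
  have hind : (fun z => mollify (molKer i) g z - g z)
      = K.indicator (fun z => mollify (molKer i) g z - g z) := by
    ext z
    by_cases hz : z ∈ K
    · simp [hz]
    · rw [Set.indicator_of_notMem hz, hout i z hz]
  rw [hind]
  refine le_trans ?_ hle
  rw [eLpNorm_indicator_eq_eLpNorm_restrict hKc.isClosed.measurableSet]
  refine (eLpNorm_le_of_ae_bound (C := δ) (ae_of_all _ fun z => ?_)).trans_eq ?_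
  · rw [← dist_eq_norm]; exact hN i hi z
  · rw [Measure.restrict_apply_univ, mul_comm]; norm_num

/-- An ε/3 argument: approximate `g` by a continuous compactly supported function and use that
mollification does not increase the L² norm. -/
theorem tendsto_eLpNorm_mollify {g : Cn n → ℂ} (hg : MemLp g 2 volume) :
    Tendsto (fun i => eLpNorm (fun z => mollify (molKer i) g z - g z) 2 volume) atTop (𝓝 0) := by
  rw [ENNReal.tendsto_atTop_zero]
  intro ε hε
  have hε3 : ε / 3 ≠ 0 := by simp [hε.ne']
  obtain ⟨c, hcc, hcε, hcont, hcm⟩ := hg.exists_hasCompactSupport_eLpNorm_sub_le (by norm_num) hε3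
  obtain ⟨N, hN⟩ := (ENNReal.tendsto_atTop_zero.1
    (tendsto_eLpNorm_mollify_of_continuous hcont hcc)) (ε / 3) (pos_iff_ne_zero.2 hε3)
  refine ⟨N, fun i hi => ?_⟩
  have hgl : LocallyIntegrable g := hg.locallyIntegrable (by norm_num)
  have hcl : LocallyIntegrable c := hcm.locallyIntegrable (by norm_num)
  have hmc : ∀ {f : Cn n → ℂ}, LocallyIntegrable f →
      AEStronglyMeasurable (mollify (molKer i) f) volume := fun hf =>
    (contDiff_mollify (molKer_smooth i) (molKer_hasCompactSupport i)
      hf).continuous.aestronglyMeasurable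
  have e : (fun z => mollify (molKer i) g z - g z) = (fun z => mollify (molKer i) (fun z => g z - c z) z)
      + ((fun z => mollify (molKer i) c z - c z) + fun z => c z - g z) := by
    ext z
    rw [mollify_sub hgl hcl]
    simp
  rw [e]
  have hsub : AEStronglyMeasurable (fun z => g z - c z) volume :=
    hg.aestronglyMeasurable.sub hcm.aestronglyMeasurable
  have m1 := hmc (hgl.sub hcl)
  have m2 : AEStronglyMeasurable (fun z => mollify (molKer i) c z - c z) volume :=
    (hmc hcl).sub hcm.aestronglyMeasurable
  have m3 : AEStronglyMeasurable (fun z => c z - g z) volume :=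
    hcm.aestronglyMeasurable.sub hg.aestronglyMeasurable
  have b1 : eLpNorm (mollify (molKer i) fun z => g z - c z) 2 volume ≤ ε / 3 :=
    (eLpNorm_mollify_le i hsub).trans hcε
  have b3 : eLpNorm (fun z => c z - g z) 2 volume ≤ ε / 3 := by
    refine le_trans (le_of_eq ?_) hcε
    rw [← eLpNorm_neg]
    congr 1; ext z; simp
  refine (eLpNorm_add_le m1 (m2.add m3) (by norm_num)).trans ?_
  refine (add_le_add b1 ((eLpNorm_add_le m2 m3 (by norm_num)).trans
    (add_le_add (hN i hi) b3))).trans_eq ?_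
  rw [← add_assoc, ENNReal.add_thirds]

end Mollification

/-! ### Pairings, weighted norms and convergence in L². -/

section LTwo

open Filter Topology
open scoped ENNReal

variable {α ι : Type*} [MeasurableSpace α] {μ : Measure α}

theorem memLp_bdd_mul {b f : α → ℂ} {C : ℝ} (hb : AEStronglyMeasurable b μ)
    (hC : ∀ x, ‖b x‖ ≤ C) (hf : MemLp f 2 μ) : MemLp (fun x => b x * f x) 2 μ :=
  MemLp.of_le_mul hf (hb.mul hf.aestronglyMeasurable) (c := C) (ae_of_all _ fun x => by
    rw [norm_mul]; gcongr; exact hC x)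

theorem memLp_star {f : α → ℂ} (hf : MemLp f 2 μ) : MemLp (fun x => star (f x)) 2 μ :=
  hf.star

theorem integrable_mul_star {f g : α → ℂ} (hf : MemLp f 2 μ) (hg : MemLp g 2 μ) :
    Integrable (fun x => f x * star (g x)) μ :=
  hf.integrable_mul (memLp_star hg)

theorem integrable_mul_of_memLp {f g : α → ℂ} (hf : MemLp f 2 μ) (hg : MemLp g 2 μ) :
    Integrable (fun x => f x * g x) μ :=
  hf.integrable_mul hg

theorem integrable_normSq {f : α → ℂ} (hf : MemLp f 2 μ) : Integrable (fun x => ‖f x‖ ^ 2) μ :=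
  hf.integrable_norm_pow two_ne_zero

theorem inner_toLp_eq {f g : α → ℂ} (hf : MemLp f 2 μ) (hg : MemLp g 2 μ) :
    inner ℂ (hg.toLp g) (hf.toLp f) = ∫ x, f x * star (g x) ∂μ := by
  rw [L2.inner_def]
  refine integral_congr_ae ?_
  filter_upwards [hf.coeFn_toLp, hg.coeFn_toLp] with x h1 h2
  rw [h1, h2]; rfl

theorem norm_toLp_sq {f : α → ℂ} (hf : MemLp f 2 μ) : ‖hf.toLp f‖ ^ 2 = ∫ x, ‖f x‖ ^ 2 ∂μ := by
  have h : ((‖hf.toLp f‖ ^ 2 : ℝ) : ℂ) = ((∫ x, ‖f x‖ ^ 2 ∂μ : ℝ) : ℂ) := by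
    rw [← integral_complex_ofReal]
    have := inner_self_eq_norm_sq_to_K (𝕜 := ℂ) (hf.toLp f)
    rw [inner_toLp_eq] at this
    push_cast
    refine this.symm.trans (integral_congr_ae (ae_of_all _ fun x => ?_))
    simp only [star_def, Complex.mul_conj, Complex.normSq_eq_norm_sq]
    push_cast; rfl
  exact_mod_cast h

theorem norm_integral_mul_star_sq_le {f g : α → ℂ} (hf : MemLp f 2 μ) (hg : MemLp g 2 μ) :
    ‖∫ x, f x * star (g x) ∂μ‖ ^ 2 ≤ (∫ x, ‖f x‖ ^ 2 ∂μ) * ∫ x, ‖g x‖ ^ 2 ∂μ := by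
  rw [← inner_toLp_eq hf hg, ← norm_toLp_sq hf, ← norm_toLp_sq hg, ← mul_pow, mul_comm ‖_‖]
  gcongr
  exact norm_inner_le_norm _ _

/-- Convergence in `L²(μ)`. -/
structure TendstoL2 (F : ι → α → ℂ) (l : Filter ι) (f : α → ℂ) (μ : Measure α) : Prop where
  memLp : ∀ i, MemLp (F i) 2 μ
  memLp_lim : MemLp f 2 μ
  tendsto : Tendsto (fun i => eLpNorm (fun z => F i z - f z) 2 μ) l (𝓝 0)

namespace TendstoL2

variable {l : Filter ι} {F G : ι → α → ℂ} {f g : α → ℂ}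

theorem const (hf : MemLp f 2 μ) : TendstoL2 (fun _ : ι => f) l f μ :=
  ⟨fun _ => hf, hf, by simpa using tendsto_const_nhds⟩

theorem add (hF : TendstoL2 F l f μ) (hG : TendstoL2 G l g μ) :
    TendstoL2 (fun i x => F i x + G i x) l (fun x => f x + g x) μ := by
  refine ⟨fun i => (hF.memLp i).add (hG.memLp i), hF.memLp_lim.add hG.memLp_lim, ?_⟩
  refine tendsto_of_tendsto_of_tendsto_of_le_of_le tendsto_const_nhds
    (by simpa using hF.tendsto.add hG.tendsto) (fun _ => zero_le) fun i => ?_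
  refine le_trans (le_of_eq ?_) (eLpNorm_add_le ((hF.memLp i).sub hF.memLp_lim).aestronglyMeasurable
    ((hG.memLp i).sub hG.memLp_lim).aestronglyMeasurable (by norm_num))
  congr 1; ext x; simp; ring

theorem bdd_mul {b : α → ℂ} {C : ℝ} (hb : AEStronglyMeasurable b μ) (hC : ∀ x, ‖b x‖ ≤ C)
    (hF : TendstoL2 F l f μ) :
    TendstoL2 (fun i x => b x * F i x) l (fun x => b x * f x) μ := by
  refine ⟨fun i => memLp_bdd_mul hb hC (hF.memLp i), memLp_bdd_mul hb hC hF.memLp_lim, ?_⟩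
  refine tendsto_of_tendsto_of_tendsto_of_le_of_le tendsto_const_nhds
    (by simpa using ENNReal.Tendsto.const_mul hF.tendsto (Or.inr (ENNReal.ofReal_ne_top (r := C))))
    (fun _ => zero_le) fun i => ?_
  refine eLpNorm_le_mul_eLpNorm_of_ae_le_mul (ae_of_all _ fun x => ?_) 2
  rw [← mul_sub, norm_mul]
  gcongr; exact hC x

theorem sum {κ : Type*} {s : Finset κ} {F : κ → ι → α → ℂ} {f : κ → α → ℂ}
    (h : ∀ a ∈ s, TendstoL2 (F a) l (f a) μ) :
    TendstoL2 (fun i x => ∑ a ∈ s, F a i x) l (fun x => ∑ a ∈ s, f a x) μ := by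
  classical
  induction s using Finset.induction_on with
  | empty => exact const (f := fun _ => (0 : ℂ)) MemLp.zero
  | insert a s ha ih =>
    simp only [Finset.sum_insert ha]
    exact (h a (by simp)).add (ih fun b hb => h b (by simp [hb]))

theorem integral_mul_star (hF : TendstoL2 F l f μ) (hG : TendstoL2 G l g μ) :
    Tendsto (fun i => ∫ x, F i x * star (G i x) ∂μ) l (𝓝 (∫ x, f x * star (g x) ∂μ)) := by
  have h : ∀ {F : ι → α → ℂ} {f : α → ℂ} (hF : TendstoL2 F l f μ),
      Tendsto (fun i => (hF.memLp i).toLp (F i)) l (𝓝 (hF.memLp_lim.toLp f)) := by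
    intro F f hF
    rw [Lp.tendsto_Lp_iff_tendsto_eLpNorm'']
    exact hF.tendsto
  have := (h hG).inner (𝕜 := ℂ) (h hF)
  simp only [inner_toLp_eq] at this
  exact this

theorem integral_normSq_mul {W : α → ℝ} {C : ℝ} (hW : AEStronglyMeasurable W μ)
    (hC : ∀ x, |W x| ≤ C) (hF : TendstoL2 F l f μ) :
    Tendsto (fun i => ∫ x, ‖F i x‖ ^ 2 * W x ∂μ) l (𝓝 (∫ x, ‖f x‖ ^ 2 * W x ∂μ)) := by
  have h := ((hF.bdd_mul (b := fun x => (W x : ℂ)) (C := C)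
    (Complex.continuous_ofReal.comp_aestronglyMeasurable hW)
    (fun x => by simpa using hC x)).integral_mul_star hF)
  have e : ∀ f : α → ℂ, ∫ x, (W x : ℂ) * f x * star (f x) ∂μ
      = ((∫ x, ‖f x‖ ^ 2 * W x ∂μ : ℝ) : ℂ) := by
    intro f
    rw [← integral_complex_ofReal]
    refine integral_congr_ae (ae_of_all _ fun x => ?_)
    simp only [mul_assoc, star_def, Complex.mul_conj, Complex.normSq_eq_norm_sq]
    push_cast; ring
  simp only [e] at h
  exact_mod_cast (Complex.continuous_re.tendsto _).comp h

end TendstoL2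

end LTwo

/-! ### The dual form of the bound on ∂u_j/∂z̄_k. -/

section WeakKohnMorrey

open Filter Topology

theorem bounded_of_hasCompactSupport {F : Type*} [NormedAddCommGroup F] {f : Cn n → F}
    (hf : Continuous f) (hc : HasCompactSupport f) : ∃ C, ∀ x, ‖f x‖ ≤ C :=
  hf.bounded_above_of_compact_support hc

theorem memLp_of_hasCompactSupport {f : Cn n → ℂ} (hf : Continuous f) (hc : HasCompactSupport f) :
    MemLp f 2 volume := hf.memLp_of_hasCompactSupport hc

/-- Integrate by parts to move the derivative from `T` to `u`, then apply Cauchy–Schwarz with the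
factors e^{-φ/2} and e^{φ/2}. The left side contains no derivative of `u`, so the inequality
survives limits in which only `u` itself converges. -/
theorem sum_integral_mul_dzbar_sq_le {φ : Cn n → ℝ} (hφ : Continuous φ)
    {u : Fin n → Cn n → ℂ} (hu : ∀ j, ContDiff ℝ ∞ (u j)) (hc : ∀ j, HasCompactSupport (u j))
    {T : Fin n → Fin n → Cn n → ℂ} (hT : ∀ j k, ContDiff ℝ ∞ (T j k))
    (hTc : ∀ j k, HasCompactSupport (T j k)) :
    ‖∑ j, ∑ k, ∫ z, u j z * dzbar k (T j k) z‖ ^ 2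
      ≤ (∑ j, ∑ k, ∫ z, ‖T j k z‖ ^ 2 * Real.exp (φ z))
        * ∫ z, (∑ j, ∑ k, ‖dzbar k (u j) z‖ ^ 2) * Real.exp (-φ z) := by
  have c1 : ∀ j k, Continuous (dzbar k (u j)) :=
    fun j k => ((hu j).dzbar (m := ∞) (by simp)).continuous
  have c2 : ∀ j k, Continuous (dzbar k (T j k)) :=
    fun j k => ((hT j k).dzbar (m := ∞) (by simp)).continuous
  have e1 : ∀ j k, ∫ z, u j z * dzbar k (T j k) z = -∫ z, dzbar k (u j) z * T j k z := by
    intro j k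
    have h0 := integral_dzbar_eq_zero (j := k) (f := fun z => u j z * T j k z)
      (((hu j).mul (hT j k)).of_le (by norm_cast)) (hc j).mul_right
    have hm : ∀ z, dzbar k (fun z => u j z * T j k z) z
        = dzbar k (u j) z * T j k z + u j z * dzbar k (T j k) z := fun z =>
      dzbar_mul ((hu j).differentiable (by simp) z) ((hT j k).differentiable (by simp) z)
    simp only [hm] at h0
    rw [integral_add] at h0
    · linear_combination h0
    · exact ((c1 j k).mul (hT j k).continuous).integrable_of_hasCompactSupport (hTc j k).mul_left
    · exact ((hu j).continuous.mul (c2 j k)).integrable_of_hasCompactSupport (hc j).mul_right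
  have hexp : ∀ z, Real.exp (-φ z / 2) * Real.exp (φ z / 2) = 1 := fun z => by
    rw [← Real.exp_add]; simp; ring
  have hE : ∀ t : ℝ, Real.exp (t / 2) ^ 2 = Real.exp t := fun t => by
    rw [← Real.exp_nat_mul]; congr 1; push_cast; ring
  have e2 : ∀ j k, ‖∫ z, dzbar k (u j) z * T j k z‖ ^ 2
      ≤ (∫ z, ‖dzbar k (u j) z‖ ^ 2 * Real.exp (-φ z)) * ∫ z, ‖T j k z‖ ^ 2 * Real.exp (φ z) := by
    intro j k
    have hf : MemLp (fun z => (Real.exp (-φ z / 2) : ℂ) * dzbar k (u j) z) 2 volume :=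
      memLp_of_hasCompactSupport (by fun_prop) ((hc j).dzbar.mul_left)
    have hg : MemLp (fun z => (Real.exp (φ z / 2) : ℂ) * star (T j k z)) 2 volume := by
      have := (hT j k).continuous
      exact memLp_of_hasCompactSupport (by fun_prop)
        (hasCompactSupport_of_zero (hTc j k) fun z hz => by simp [hz])
    have := norm_integral_mul_star_sq_le hf hg
    refine le_trans (le_of_eq ?_) (this.trans_eq ?_)
    · congr 2
      refine integral_congr_ae (ae_of_all _ fun z => ?_)
      have := congrArg (fun t : ℝ => (t : ℂ)) (hexp z)
      simp only [ofReal_mul, ofReal_one] at this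
      simp only [star_mul', star_star]
      simp only [star_def, conj_ofReal]
      linear_combination (-dzbar k (u j) z * T j k z) * this
    · congr 1
      · refine integral_congr_ae (ae_of_all _ fun z => ?_)
        simp only [norm_mul, mul_pow, norm_real, Real.norm_of_nonneg (Real.exp_pos _).le, hE]
        ring
      · refine integral_congr_ae (ae_of_all _ fun z => ?_)
        simp only [norm_mul, mul_pow, norm_real, Real.norm_of_nonneg (Real.exp_pos _).le, hE,
          norm_star]
        ring
  have e3 : ∫ z, (∑ j, ∑ k, ‖dzbar k (u j) z‖ ^ 2) * Real.exp (-φ z)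
      = ∑ j, ∑ k, ∫ z, ‖dzbar k (u j) z‖ ^ 2 * Real.exp (-φ z) := by
    have hi : ∀ j k, Integrable (fun z => ‖dzbar k (u j) z‖ ^ 2 * Real.exp (-φ z)) := by
      intro j k
      refine Continuous.integrable_of_hasCompactSupport (by fun_prop)
        (hasCompactSupport_of_zero ((hc j).dzbar (j := k)) (g := fun z => ‖dzbar k (u j) z‖ ^ 2
          * Real.exp (-φ z)) fun z hz => by simp [hz])
    simp only [Finset.sum_mul]
    rw [integral_finsetSum _ fun j _ => integrable_finsetSum _ fun k _ => hi j k]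
    exact Finset.sum_congr rfl fun j _ => integral_finsetSum _ fun k _ => hi j k
  rw [e3]
  simp only [e1, Finset.sum_neg_distrib, norm_neg]
  simp only [← Finset.sum_product', Finset.univ_product_univ]
  have nn1 : ∀ p : Fin n × Fin n, 0 ≤ ∫ z, ‖T p.1 p.2 z‖ ^ 2 * Real.exp (φ z) := fun p =>
    integral_nonneg fun z => by positivity
  have nn2 : ∀ p : Fin n × Fin n, 0 ≤ ∫ z, ‖dzbar p.2 (u p.1) z‖ ^ 2 * Real.exp (-φ z) := fun p =>
    integral_nonneg fun z => by positivity
  calc ‖∑ p : Fin n × Fin n, ∫ z, dzbar p.2 (u p.1) z * T p.1 p.2 z‖ ^ 2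
      ≤ (∑ p : Fin n × Fin n, √(∫ z, ‖T p.1 p.2 z‖ ^ 2 * Real.exp (φ z))
          * √(∫ z, ‖dzbar p.2 (u p.1) z‖ ^ 2 * Real.exp (-φ z))) ^ 2 := by
        gcongr
        refine (norm_sum_le _ _).trans (Finset.sum_le_sum fun p _ => ?_)
        rw [← Real.sqrt_mul (nn1 p), mul_comm]
        exact Real.le_sqrt_of_sq_le (e2 p.1 p.2)
    _ ≤ (∑ p : Fin n × Fin n, √(∫ z, ‖T p.1 p.2 z‖ ^ 2 * Real.exp (φ z)) ^ 2)
        * ∑ p : Fin n × Fin n, √(∫ z, ‖dzbar p.2 (u p.1) z‖ ^ 2 * Real.exp (-φ z)) ^ 2 :=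
        Finset.sum_mul_sq_le_sq_mul_sq _ _ _
    _ = _ := by
        simp only [Real.sq_sqrt (nn1 _), Real.sq_sqrt (nn2 _)]

theorem tendstoL2_mollify {g : Cn n → ℂ} (hg : MemLp g 2 volume) (hc : HasCompactSupport g) :
    TendstoL2 (fun i => mollify (molKer i) g) atTop g volume :=
  ⟨fun i => memLp_of_hasCompactSupport (contDiff_mollify (molKer_smooth i)
      (molKer_hasCompactSupport i) (hg.locallyIntegrable (by norm_num))).continuous
      (hasCompactSupport_mollify (molKer_hasCompactSupport i) hc),
    hg, tendsto_eLpNorm_mollify hg⟩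

end WeakKohnMorrey

/-! ### The identity for forms that are only weakly differentiable. -/

section WeakKohnMorrey

open Filter Topology

/-- Mollification commutes with a constant-coefficient operator. Only the whole divergence is
assumed to exist weakly, not its individual summands. -/
theorem sum_dz_mollify {v : Fin n → Cn n → ℂ} (hv : ∀ j, LocallyIntegrable (v j))
    {p : Cn n → ℂ}
    (hpw : ∀ θ : Cn n → ℂ, ContDiff ℝ ∞ θ → HasCompactSupport θ →
      ∑ j, ∫ z, v j z * dz j θ z = -∫ z, p z * θ z) (i : ℕ) (x : Cn n) :
    ∑ j, dz j (mollify (molKer i) (v j)) x = mollify (molKer i) p x := by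
  have := hpw (fun y => molKer i (x - y)) ((molKer_smooth i).comp (contDiff_const.sub contDiff_id))
    ((molKer_hasCompactSupport i).comp_homeomorph (Homeomorph.subLeft x))
  simp only [dz_mollify (molKer_smooth i) (molKer_hasCompactSupport i) (hv _),
    Finset.sum_neg_distrib, this, neg_neg, mollify]

theorem dzbar_mollify_sub {v : Fin n → Cn n → ℂ} (hv : ∀ j, LocallyIntegrable (v j))
    {g : Cn n → ℂ} {j k : Fin n}
    (hgw : ∀ θ : Cn n → ℂ, ContDiff ℝ ∞ θ → HasCompactSupport θ →
      ∫ z, (v k z * dzbar j θ z - v j z * dzbar k θ z) = -∫ z, g z * θ z) (i : ℕ) (x : Cn n) :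
    dzbar j (mollify (molKer i) (v k)) x - dzbar k (mollify (molKer i) (v j)) x
      = mollify (molKer i) g x := by
  have h1 : ContDiff ℝ ∞ (fun y => molKer i (x - y)) :=
    (molKer_smooth i).comp (contDiff_const.sub contDiff_id)
  have h2 : HasCompactSupport (fun y => molKer i (x - y)) :=
    (molKer_hasCompactSupport i).comp_homeomorph (Homeomorph.subLeft x)
  have := hgw (fun y => molKer i (x - y)) h1 h2
  have hi : ∀ j k, Integrable (fun z => v k z * dzbar j (fun y => molKer i (x - y)) z) :=
    fun j k => integrable_mul_of_locallyIntegrable (hv k)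
      (h1.dzbar (m := ∞) (by simp)).continuous h2.dzbar
  rw [integral_sub (hi j k) (hi k j)] at this
  rw [dzbar_mollify (molKer_smooth i) (molKer_hasCompactSupport i) (hv _),
    dzbar_mollify (molKer_smooth i) (molKer_hasCompactSupport i) (hv _), mollify]
  linear_combination -this

/-- The Kohn–Morrey–Hörmander estimate, in dual form, for compactly supported forms whose
derivatives `∂̄v` and `∑ ∂v_j/∂z_j` are square integrable in the sense of distributions. -/
theorem kohn_morrey_weak {φ : Cn n → ℝ} (hφ : ContDiff ℝ ∞ φ) (hφc : HasCompactSupport φ)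
    {v : Fin n → Cn n → ℂ} (hv : ∀ j, MemLp (v j) 2 volume) (hvc : ∀ j, HasCompactSupport (v j))
    {p : Cn n → ℂ} (hp : MemLp p 2 volume) (hpc : HasCompactSupport p)
    (hpw : ∀ θ : Cn n → ℂ, ContDiff ℝ ∞ θ → HasCompactSupport θ →
      ∑ j, ∫ z, v j z * dz j θ z = -∫ z, p z * θ z)
    {G : Fin n → Fin n → Cn n → ℂ} (hG : ∀ j k, MemLp (G j k) 2 volume)
    (hGc : ∀ j k, HasCompactSupport (G j k))
    (hGw : ∀ j k, ∀ θ : Cn n → ℂ, ContDiff ℝ ∞ θ → HasCompactSupport θ →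
      ∫ z, (v k z * dzbar j θ z - v j z * dzbar k θ z) = -∫ z, G j k z * θ z)
    {R : ℝ} (hR : (∫ z, ‖p z - ∑ j, dz j (fun z => (φ z : ℂ)) z * v j z‖ ^ 2 * Real.exp (-φ z))
          + 1 / 2 * (∑ j, ∑ k, ∫ z, ‖G j k z‖ ^ 2 * Real.exp (-φ z))
          - ∫ z, leviForm φ z (WithLp.toLp 2 fun j => v j z) * Real.exp (-φ z) = R) :
    Integrable (fun z => leviForm φ z (WithLp.toLp 2 fun j => v j z) * Real.exp (-φ z)) ∧ 0 ≤ R ∧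
    ∀ T : Fin n → Fin n → Cn n → ℂ, (∀ j k, ContDiff ℝ ∞ (T j k)) →
      (∀ j k, HasCompactSupport (T j k)) →
      ‖∑ j, ∑ k, ∫ z, v j z * dzbar k (T j k) z‖ ^ 2
        ≤ (∑ j, ∑ k, ∫ z, ‖T j k z‖ ^ 2 * Real.exp (φ z)) * R := by
  have hφs : ContDiff ℝ ∞ (fun z => (φ z : ℂ)) := contDiff_ofReal hφ
  have hφsc : HasCompactSupport (fun z => (φ z : ℂ)) :=
    hasCompactSupport_of_zero hφc fun z hz => by simp [hz]
  have hvl : ∀ j, LocallyIntegrable (v j) := fun j => (hv j).locallyIntegrable (by norm_num)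
  have c3 : ∀ j, Continuous (dz j (fun z => (φ z : ℂ))) :=
    fun j => (hφs.dz (m := ∞) (by simp)).continuous
  have c4 : ∀ j k, Continuous (dz j (dzbar k (fun z => (φ z : ℂ)))) :=
    fun j k => ((hφs.dzbar (m := ∞) (by simp)).dz (m := ∞) (by simp)).continuous
  have b3 := fun j => bounded_of_hasCompactSupport (c3 j) hφsc.dz
  have b4 := fun j k => bounded_of_hasCompactSupport (c4 j k) (hφsc.dzbar.dz)
  choose C3 hC3 using b3
  choose C4 hC4 using b4
  have hWc : Continuous fun z => Real.exp (-φ z) := Real.continuous_exp.comp hφ.continuous.neg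
  obtain ⟨C, hC⟩ := bounded_of_hasCompactSupport hφ.continuous hφc
  have hWb : ∀ z, |Real.exp (-φ z)| ≤ Real.exp C := fun z => by
    rw [abs_of_pos (Real.exp_pos _)]
    exact Real.exp_le_exp.2 ((neg_le_abs _).trans (hC z))
  have tv : ∀ j, TendstoL2 (fun i => mollify (molKer i) (v j)) atTop (v j) volume :=
    fun j => tendstoL2_mollify (hv j) (hvc j)
  have tp := tendstoL2_mollify hp hpc
  have tG := fun j k => tendstoL2_mollify (hG j k) (hGc j k)
  have vs : ∀ i j, ContDiff ℝ ∞ (mollify (molKer i) (v j)) := fun i j =>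
    contDiff_mollify (molKer_smooth i) (molKer_hasCompactSupport i) (hvl j)
  have vc : ∀ i j, HasCompactSupport (mollify (molKer i) (v j)) := fun i j =>
    hasCompactSupport_mollify (molKer_hasCompactSupport i) (hvc j)
  have tq : Tendsto (fun i => ∫ z, ‖mollify (molKer i) p z
      - ∑ j, dz j (fun z => (φ z : ℂ)) z * mollify (molKer i) (v j) z‖ ^ 2 * Real.exp (-φ z)) atTop
      (𝓝 (∫ z, ‖p z - ∑ j, dz j (fun z => (φ z : ℂ)) z * v j z‖ ^ 2 * Real.exp (-φ z))) := by
    have h1 : TendstoL2 (fun i z => mollify (molKer i) p z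
        + ∑ j, (-dz j (fun z => (φ z : ℂ)) z) * mollify (molKer i) (v j) z) atTop
        (fun z => p z + ∑ j, (-dz j (fun z => (φ z : ℂ)) z) * v j z) volume :=
      tp.add (TendstoL2.sum fun j _ => (tv j).bdd_mul (c3 j).neg.aestronglyMeasurable
        fun z => by rw [norm_neg]; exact hC3 j z)
    have := h1.integral_normSq_mul hWc.aestronglyMeasurable hWb
    simpa only [neg_mul, Finset.sum_neg_distrib, ← sub_eq_add_neg] using this
  have tG' : Tendsto (fun i => 1 / 2 * (∑ j, ∑ k, ∫ z, ‖mollify (molKer i) (G j k) z‖ ^ 2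
      * Real.exp (-φ z))) atTop
      (𝓝 (1 / 2 * (∑ j, ∑ k, ∫ z, ‖G j k z‖ ^ 2 * Real.exp (-φ z)))) :=
    (tendsto_finsetSum _ fun j _ => tendsto_finsetSum _ fun k _ =>
      (tG j k).integral_normSq_mul hWc.aestronglyMeasurable hWb).const_mul _
  have hHm : ∀ j k, AEStronglyMeasurable (fun z => dz j (dzbar k (fun z => (φ z : ℂ))) z
      * (Real.exp (-φ z) : ℝ)) volume := fun j k =>
    ((c4 j k).mul (Complex.continuous_ofReal.comp hWc)).aestronglyMeasurable
  have hHb : ∀ j k z, ‖dz j (dzbar k (fun z => (φ z : ℂ))) z * (Real.exp (-φ z) : ℝ)‖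
      ≤ C4 j k * Real.exp C := fun j k z => by
    rw [norm_mul, norm_real]
    exact mul_le_mul (hC4 j k z) (hWb z) (norm_nonneg _) ((norm_nonneg _).trans (hC4 j k z))
  -- On L² forms the weighted Levi integral is a finite sum of inner products with bounded
  -- coefficients, hence continuous under L² convergence.
  have hlev : ∀ w : Fin n → Cn n → ℂ, (∀ j, MemLp (w j) 2 volume) →
      Integrable (fun z => leviForm φ z (WithLp.toLp 2 fun j => w j z) * Real.exp (-φ z)) ∧
      ∫ z, leviForm φ z (WithLp.toLp 2 fun j => w j z) * Real.exp (-φ z)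
        = (∑ j, ∑ k, ∫ z, (dz j (dzbar k (fun z => (φ z : ℂ))) z * (Real.exp (-φ z) : ℝ)) * w j z
          * star (w k z)).re := by
    intro w hw
    have hi : ∀ j k, Integrable (fun z => (dz j (dzbar k (fun z => (φ z : ℂ))) z
        * (Real.exp (-φ z) : ℝ)) * w j z * star (w k z)) := fun j k =>
      integrable_mul_star (memLp_bdd_mul (hHm j k) (hHb j k) (hw j)) (hw k)
    have h2 : ∑ j, ∑ k, ∫ z, (dz j (dzbar k (fun z => (φ z : ℂ))) z * (Real.exp (-φ z) : ℝ))
        * w j z * star (w k z) = ∫ z, ∑ j, ∑ k, (dz j (dzbar k (fun z => (φ z : ℂ))) z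
          * (Real.exp (-φ z) : ℝ)) * w j z * star (w k z) := by
      rw [integral_finsetSum _ fun j _ => integrable_finsetSum _ fun k _ => hi j k]
      exact Finset.sum_congr rfl fun j _ => (integral_finsetSum _ fun k _ => hi j k).symm
    have hs := integrable_finsetSum Finset.univ fun j _ => integrable_finsetSum Finset.univ
        fun k _ => hi j k
    have h3 := Complex.reCLM.integral_comp_comm (μ := (volume : Measure (Cn n))) hs
    have h4 : ∀ z, leviForm φ z (WithLp.toLp 2 fun j => w j z) * Real.exp (-φ z)
        = Complex.reCLM (∑ j, ∑ k, (dz j (dzbar k (fun z => (φ z : ℂ))) z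
          * (Real.exp (-φ z) : ℝ)) * w j z * star (w k z)) := by
      intro z
      simp only [leviForm_toLp, Complex.reCLM_apply]
      rw [← Complex.re_mul_ofReal]
      simp only [Finset.sum_mul]
      congr 1
      refine Finset.sum_congr rfl fun j _ => Finset.sum_congr rfl fun k _ => ?_
      ring
    simp only [h4]
    refine ⟨Complex.reCLM.integrable_comp hs, ?_⟩
    rw [h2]
    exact h3
  have tl : Tendsto (fun i => ∫ z, leviForm φ z (WithLp.toLp 2 fun j =>
      mollify (molKer i) (v j) z) * Real.exp (-φ z)) atTop
      (𝓝 (∫ z, leviForm φ z (WithLp.toLp 2 fun j => v j z) * Real.exp (-φ z))) := by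
    rw [(hlev v hv).2]
    have : ∀ i, ∫ z, leviForm φ z (WithLp.toLp 2 fun j =>
      mollify (molKer i) (v j) z) * Real.exp (-φ z) = _ := fun i =>
      (hlev _ fun j => (tv j).memLp i).2
    simp only [this]
    refine (Complex.continuous_re.tendsto _).comp
      (tendsto_finsetSum _ fun j _ => tendsto_finsetSum _ fun k _ => ?_)
    exact ((tv j).bdd_mul (hHm j k) (hHb j k)).integral_mul_star (tv k)
  -- Every term on this side involves only `v`, `p` and `G`, whose mollifications converge in L².
  -- The single derivatives of `v` need not be square integrable a priori, which is why the
  -- conclusion is stated against test functions `T`.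
  have tR := hR ▸ (tq.add tG').sub tl
  have key : ∀ i, ∫ z, (∑ j, ∑ k, ‖dzbar k (mollify (molKer i) (v j)) z‖ ^ 2) * Real.exp (-φ z)
      = (∫ z, ‖mollify (molKer i) p z - ∑ j, dz j (fun z => (φ z : ℂ)) z
          * mollify (molKer i) (v j) z‖ ^ 2 * Real.exp (-φ z))
        + 1 / 2 * (∑ j, ∑ k, ∫ z, ‖mollify (molKer i) (G j k) z‖ ^ 2 * Real.exp (-φ z))
        - ∫ z, leviForm φ z (WithLp.toLp 2 fun j => mollify (molKer i) (v j) z)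
          * Real.exp (-φ z) := by
    intro i
    have hGs : ∀ j k, Continuous (mollify (molKer i) (G j k)) := fun j k =>
      (contDiff_mollify (molKer_smooth i) (molKer_hasCompactSupport i)
        ((hG j k).locallyIntegrable (by norm_num))).continuous
    have hGi : ∀ j k, Integrable (fun z => ‖mollify (molKer i) (G j k) z‖ ^ 2 * Real.exp (-φ z)) := by
      intro j k
      have := hGs j k
      refine Continuous.integrable_of_hasCompactSupport (by fun_prop)
        (hasCompactSupport_of_zero (hasCompactSupport_mollify (molKer_hasCompactSupport i) (hGc j k))
          fun z hz => by simp [hz])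
    rw [kohn_morrey hφ (vs i) (vc i)]
    congr 2
    · refine integral_congr_ae (ae_of_all _ fun z => ?_)
      simp only [Finset.sum_sub_distrib, sum_dz_mollify hvl hpw i z]
    · simp only [dzbar_mollify_sub hvl (hGw _ _) i, mul_assoc, Finset.sum_mul]
      rw [integral_const_mul, integral_finsetSum _ fun j _ => integrable_finsetSum _ fun k _ =>
        hGi j k]
      congr 1
      exact Finset.sum_congr rfl fun j _ => integral_finsetSum _ fun k _ => hGi j k
  refine ⟨(hlev v hv).1, ge_of_tendsto' tR fun i => ?_, fun T hT hTc => ?_⟩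
  · rw [← key i]
    exact integral_nonneg fun z => by positivity
  · have tL : Tendsto (fun i => ‖∑ j, ∑ k, ∫ z, mollify (molKer i) (v j) z * dzbar k (T j k) z‖ ^ 2)
        atTop (𝓝 (‖∑ j, ∑ k, ∫ z, v j z * dzbar k (T j k) z‖ ^ 2)) := by
      refine ((tendsto_finsetSum _ fun j _ => tendsto_finsetSum _ fun k _ => ?_).norm).pow 2
      have hm : MemLp (fun z => star (dzbar k (T j k) z)) 2 volume :=
        memLp_star (memLp_of_hasCompactSupport ((hT j k).dzbar (m := ∞) (by simp)).continuous
          (hTc j k).dzbar)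
      have := (tv j).integral_mul_star (TendstoL2.const hm)
      simpa only [star_star] using this
    refine le_of_tendsto_of_tendsto' tL (tR.const_mul _) fun i => ?_
    rw [← key i]
    exact sum_integral_mul_dzbar_sq_le hφ.continuous (vs i) (vc i) hT hTc

end WeakKohnMorrey

/-! ### Weighted L² spaces, cutoffs and test functions. -/

section Weighted

open Filter Topology

theorem contDiff_cutoff_mul {F : Type*} [NormedAddCommGroup F] [NormedSpace ℝ F]
    {Ω : Set (Cn n)} (hΩ : IsOpen Ω) {l : WithTop ℕ∞}
    {θ : Cn n → ℝ} {b : Cn n → F} (hθ : ContDiff ℝ l θ) (hs : tsupport θ ⊆ Ω)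
    (hb : ContDiffOn ℝ l b Ω) : ContDiff ℝ l (fun z => θ z • b z) := by
  refine contDiff_iff_contDiffAt.2 fun z => ?_
  by_cases hz : z ∈ tsupport θ
  · exact hθ.contDiffAt.smul (hb.contDiffAt (hΩ.mem_nhds (hs hz)))
  · refine (contDiffAt_const (c := (0 : F))).congr_of_eventuallyEq ?_
    filter_upwards [notMem_tsupport_iff_eventuallyEq.1 hz] with x hx
    simp [hx]

/-- `g ∈ L²(Ω, e^{-κ})`. -/
def MemL2W (Ω : Set (Cn n)) (κ : Cn n → ℝ) (g : Cn n → ℂ) : Prop :=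
  AEStronglyMeasurable g (volume.restrict Ω) ∧
    IntegrableOn (fun z => ‖g z‖ ^ 2 * Real.exp (-κ z)) Ω

/-- The squared norm of `L²(Ω, e^{-κ})`. -/
def normSqW (Ω : Set (Cn n)) (κ : Cn n → ℝ) (g : Cn n → ℂ) : ℝ :=
  ∫ z in Ω, ‖g z‖ ^ 2 * Real.exp (-κ z)

theorem normSqW_nonneg (Ω : Set (Cn n)) (κ : Cn n → ℝ) (g : Cn n → ℂ) : 0 ≤ normSqW Ω κ g :=
  integral_nonneg fun z => by positivity

/-- A continuous weight is bounded on the compact support of `b`, so after cutting off all weights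
give the same space, whatever they do at the boundary of Ω. -/
theorem MemL2W.cutoff_mul {Ω : Set (Cn n)} (hΩ : IsOpen Ω) {κ : Cn n → ℝ} {g : Cn n → ℂ}
    (hκ : ContinuousOn κ Ω) (hg : MemL2W Ω κ g) {b : Cn n → ℂ} (hb : Continuous b)
    (hc : HasCompactSupport b) (hs : tsupport b ⊆ Ω) :
    MemLp (fun z => b z * g z) 2 volume := by
  have hz : ∀ z, z ∉ Ω → b z = 0 := fun z hz =>
    image_eq_zero_of_notMem_tsupport fun h => hz (hs h)
  have hind : (fun z => b z * g z) = Ω.indicator (fun z => b z * g z) := by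
    ext z
    by_cases h : z ∈ Ω
    · simp [h]
    · simp [h, hz z h]
  rw [hind, memLp_indicator_iff_restrict hΩ.measurableSet]
  have hm : AEStronglyMeasurable (fun z => b z * g z) (volume.restrict Ω) :=
    hb.aestronglyMeasurable.mul hg.1
  rw [memLp_two_iff_integrable_sq_norm hm]
  obtain ⟨C, hC⟩ : ∃ C, ∀ z ∈ tsupport b, ‖b z‖ ^ 2 * Real.exp (κ z) ≤ C := by
    have hcont : ContinuousOn (fun z => ‖b z‖ ^ 2 * Real.exp (κ z)) (tsupport b) :=
      (hb.norm.pow 2).continuousOn.mul (Real.continuous_exp.comp_continuousOn (hκ.mono hs))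
    obtain ⟨C, hC⟩ := (IsCompact.image_of_continuousOn hc hcont).bddAbove
    exact ⟨C, fun z hz => hC ⟨z, hz, rfl⟩⟩
  refine (hg.2.const_mul |C|).mono' (hm.norm.pow 2) ?_
  refine ae_of_all _ fun z => ?_
  rw [Real.norm_of_nonneg (by positivity), norm_mul, mul_pow]
  by_cases h : z ∈ tsupport b
  · calc ‖b z‖ ^ 2 * ‖g z‖ ^ 2
        = (‖b z‖ ^ 2 * Real.exp (κ z)) * (‖g z‖ ^ 2 * Real.exp (-κ z)) := by
          rw [Real.exp_neg]; field_simp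
      _ ≤ |C| * (‖g z‖ ^ 2 * Real.exp (-κ z)) := by
          gcongr
          exact (hC z h).trans (le_abs_self C)
  · rw [image_eq_zero_of_notMem_tsupport h]
    simp only [norm_zero, ne_eq, OfNat.ofNat_ne_zero, not_false_eq_true, zero_pow, zero_mul]
    positivity

/-- A sequence of cutoff functions exhausting `Ω`. -/
structure IsCutoffSeq (Ω : Set (Cn n)) (θ : ℕ → Cn n → ℝ) : Prop where
  smooth : ∀ ν, ContDiff ℝ ∞ (θ ν)
  hasCompactSupport : ∀ ν, HasCompactSupport (θ ν)
  tsupport_subset : ∀ ν, tsupport (θ ν) ⊆ Ω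
  nonneg : ∀ ν z, 0 ≤ θ ν z
  le_one : ∀ ν z, θ ν z ≤ 1
  eventually_one : ∀ K, IsCompact K → K ⊆ Ω → ∀ᶠ ν in atTop, ∀ z ∈ K, θ ν =ᶠ[𝓝 z] fun _ => 1

theorem IsTestFunction.dz {Ω : Set (Cn n)} {φ : Cn n → ℂ} (h : IsTestFunction Ω φ) (j : Fin n) :
    IsTestFunction Ω (DbarNeumann.dz j φ) :=
  ⟨h.smooth.dz (by simp), h.hasCompactSupport.dz, tsupport_dz_subset.trans h.tsupport_subset⟩

theorem IsTestFunction.dzbar {Ω : Set (Cn n)} {φ : Cn n → ℂ} (h : IsTestFunction Ω φ)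
    (j : Fin n) : IsTestFunction Ω (DbarNeumann.dzbar j φ) :=
  ⟨h.smooth.dzbar (by simp), h.hasCompactSupport.dzbar,
    tsupport_dzbar_subset.trans h.tsupport_subset⟩

theorem tsupport_mul_subset {f g : Cn n → ℂ} : tsupport (fun z => f z * g z) ⊆ tsupport f :=
  closure_mono fun z hz => by
    simp only [Function.mem_support] at hz ⊢
    exact left_ne_zero_of_mul hz

theorem tsupport_ofReal_subset {f : Cn n → ℝ} : tsupport (fun z => (f z : ℂ)) ⊆ tsupport f :=
  closure_mono fun z hz => by
    simpa [Function.mem_support] using hz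

theorem tsupport_star_subset {f : Cn n → ℂ} : tsupport (fun z => star (f z)) ⊆ tsupport f :=
  closure_mono fun z hz => by
    simpa [Function.mem_support] using hz

theorem IsTestFunction.mul_left {Ω : Set (Cn n)} {φ f : Cn n → ℂ} (h : IsTestFunction Ω φ)
    (hf : ContDiff ℝ ∞ f) : IsTestFunction Ω (fun z => φ z * f z) :=
  ⟨h.smooth.mul hf, h.hasCompactSupport.mul_right, tsupport_mul_subset.trans h.tsupport_subset⟩

theorem IsTestFunction.star {Ω : Set (Cn n)} {φ : Cn n → ℂ} (h : IsTestFunction Ω φ) :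
    IsTestFunction Ω (fun z => star (φ z)) :=
  ⟨contDiff_star h.smooth, hasCompactSupport_of_zero h.hasCompactSupport fun z hz => by simp [hz],
    tsupport_star_subset.trans h.tsupport_subset⟩

theorem IsCutoffSeq.isTestFunction {Ω : Set (Cn n)} {θ : ℕ → Cn n → ℝ} (h : IsCutoffSeq Ω θ)
    (ν : ℕ) : IsTestFunction Ω (fun z => (θ ν z : ℂ)) :=
  ⟨contDiff_ofReal (h.smooth ν), hasCompactSupport_of_zero (h.hasCompactSupport ν)
    fun z hz => by simp [hz], tsupport_ofReal_subset.trans (h.tsupport_subset ν)⟩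

theorem IsTestFunction.mul_contDiffOn {Ω : Set (Cn n)} (hΩ : IsOpen Ω) {φ f : Cn n → ℂ}
    (h : IsTestFunction Ω φ) (hf : ContDiffOn ℝ ∞ f Ω) : IsTestFunction Ω (fun z => φ z * f z) := by
  refine ⟨contDiff_iff_contDiffAt.2 fun z => ?_, h.hasCompactSupport.mul_right,
    tsupport_mul_subset.trans h.tsupport_subset⟩
  by_cases hz : z ∈ tsupport φ
  · exact h.smooth.contDiffAt.mul (hf.contDiffAt (hΩ.mem_nhds (h.tsupport_subset hz)))
  · refine (contDiffAt_const (c := (0 : ℂ))).congr_of_eventuallyEq ?_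
    filter_upwards [notMem_tsupport_iff_eventuallyEq.1 hz] with x hx
    simp [hx]

theorem setIntegral_eq_integral_of_tsupport {F : Type*} [NormedAddCommGroup F] [NormedSpace ℝ F]
    {Ω : Set (Cn n)} {f : Cn n → F} (h : ∀ z, z ∉ Ω → f z = 0) : ∫ z in Ω, f z = ∫ z, f z :=
  setIntegral_eq_integral_of_forall_compl_eq_zero h

theorem norm_sum_mul_sq_le (a b : Fin n → ℂ) :
    ‖∑ j, a j * b j‖ ^ 2 ≤ (∑ j, ‖a j‖ ^ 2) * ∑ j, ‖b j‖ ^ 2 := by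
  calc ‖∑ j, a j * b j‖ ^ 2 ≤ (∑ j, ‖a j‖ * ‖b j‖) ^ 2 := by
        gcongr
        exact (norm_sum_le _ _).trans_eq (Finset.sum_congr rfl fun j _ => norm_mul _ _)
    _ ≤ _ := Finset.sum_mul_sq_le_sq_mul_sq _ _ _

theorem norm_add_sq_le_two {E : Type*} [SeminormedAddCommGroup E] (a b : E) :
    ‖a + b‖ ^ 2 ≤ 2 * ‖a‖ ^ 2 + 2 * ‖b‖ ^ 2 := by
  have := norm_add_le a b
  nlinarith [norm_nonneg (a + b), norm_nonneg a, norm_nonneg b, sq_nonneg (‖a‖ - ‖b‖)]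

end Weighted

/-! ### Distributional equations satisfied by cut-off forms. -/

section Weighted

open Filter Topology

/-- `∂̄v = G` on `Ω` in the sense of distributions. -/
def WeakDbar (Ω : Set (Cn n)) (v : Fin n → Cn n → ℂ) (G : Fin n → Fin n → Cn n → ℂ) : Prop :=
  ∀ j k, ∀ φ, IsTestFunction Ω φ →
    ∫ z in Ω, (v k z * dzbar j φ z - v j z * dzbar k φ z) = -∫ z in Ω, G j k z * φ z

/-- `h` is the formal adjoint of `∂̄`, with respect to the weights `e^{-κ₁}` on functions and
`e^{-κ₂}` on forms, applied to `v` in the sense of distributions. -/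
def WeakAdjoint (Ω : Set (Cn n)) (κ₁ κ₂ : Cn n → ℝ) (v : Fin n → Cn n → ℂ) (h : Cn n → ℂ) : Prop :=
  ∀ g, IsTestFunction Ω g →
    ∑ j, ∫ z in Ω, v j z * star (dzbar j g z) * (Real.exp (-κ₂ z) : ℝ)
      = ∫ z in Ω, h z * star (g z) * (Real.exp (-κ₁ z) : ℝ)

variable {Ω : Set (Cn n)} {φ η θ χ : Cn n → ℝ} {v : Fin n → Cn n → ℂ} {h : Cn n → ℂ}
  {G : Fin n → Fin n → Cn n → ℂ}

/-- Use θτ as test function; Leibniz moves the derivatives of θ into the right-hand side. The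
identity then holds on all of ℂⁿ, where mollification is available. -/
theorem weakDbar_cutoff (hΩ : IsOpen Ω) {κ₂ κ₃ : Cn n → ℝ} (hκ₂ : ContinuousOn κ₂ Ω)
    (hκ₃ : ContinuousOn κ₃ Ω) (hv : ∀ j, MemL2W Ω κ₂ (v j)) (hG : ∀ j k, MemL2W Ω κ₃ (G j k))
    (hGw : WeakDbar Ω v G) {θ : Cn n → ℂ} (hθ : IsTestFunction Ω θ) (j k : Fin n) {τ : Cn n → ℂ}
    (hτ : ContDiff ℝ ∞ τ) (hτc : HasCompactSupport τ) :
    ∫ z, (θ z * v k z * dzbar j τ z - θ z * v j z * dzbar k τ z)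
      = -∫ z, (θ z * G j k z + dzbar j θ z * v k z - dzbar k θ z * v j z) * τ z := by
  have h0 := hGw j k _ (hθ.mul_left hτ)
  have hz : ∀ z, z ∉ Ω → θ z = 0 := fun z hz =>
    image_eq_zero_of_notMem_tsupport fun h => hz (hθ.tsupport_subset h)
  have hzd : ∀ j z, z ∉ Ω → dzbar j θ z = 0 := fun j z hz =>
    dzbar_eq_zero_of_notMem_tsupport fun h => hz (hθ.tsupport_subset h)
  have hm : ∀ j z, dzbar j (fun z => θ z * τ z) z = dzbar j θ z * τ z + θ z * dzbar j τ z :=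
    fun j z => dzbar_mul (hθ.smooth.differentiable (by simp) z) (hτ.differentiable (by simp) z)
  simp only [hm] at h0
  rw [setIntegral_eq_integral_of_tsupport (fun z hz' => by simp [hz z hz', hzd _ z hz']),
    setIntegral_eq_integral_of_tsupport (fun z hz' => by simp [hz z hz'])] at h0
  have i1 : ∀ j k, Integrable (fun z => (dzbar j θ z * v k z) * τ z) := fun j k =>
    integrable_mul_of_memLp ((hv k).cutoff_mul hΩ hκ₂ (hθ.dzbar j).smooth.continuous
      (hθ.dzbar j).hasCompactSupport (hθ.dzbar j).tsupport_subset)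
      (memLp_of_hasCompactSupport hτ.continuous hτc)
  have i2 : ∀ j k, Integrable (fun z => (θ z * v k z) * dzbar j τ z) := fun j k =>
    integrable_mul_of_memLp ((hv k).cutoff_mul hΩ hκ₂ hθ.smooth.continuous
      hθ.hasCompactSupport hθ.tsupport_subset)
      (memLp_of_hasCompactSupport (hτ.dzbar (m := ∞) (by simp)).continuous hτc.dzbar)
  have i3 : Integrable (fun z => (θ z * G j k z) * τ z) :=
    integrable_mul_of_memLp ((hG j k).cutoff_mul hΩ hκ₃ hθ.smooth.continuous
      hθ.hasCompactSupport hθ.tsupport_subset) (memLp_of_hasCompactSupport hτ.continuous hτc)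
  have i4 : Integrable (fun z => dzbar j θ z * v k z * τ z - dzbar k θ z * v j z * τ z) :=
    (i1 j k).sub (i1 k j)
  have i5 : Integrable (fun z => θ z * v k z * dzbar j τ z - θ z * v j z * dzbar k τ z) :=
    (i2 j k).sub (i2 k j)
  have e1 : ∫ z, (v k z * (dzbar j θ z * τ z + θ z * dzbar j τ z)
        - v j z * (dzbar k θ z * τ z + θ z * dzbar k τ z))
      = (∫ z, (θ z * v k z * dzbar j τ z - θ z * v j z * dzbar k τ z))
        + ∫ z, (dzbar j θ z * v k z * τ z - dzbar k θ z * v j z * τ z) := by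
    rw [← integral_add i5 i4]
    refine integral_congr_ae (ae_of_all _ fun z => ?_)
    ring
  have e2 : ∫ z, (θ z * G j k z + dzbar j θ z * v k z - dzbar k θ z * v j z) * τ z
      = (∫ z, G j k z * (θ z * τ z))
        + ∫ z, (dzbar j θ z * v k z * τ z - dzbar k θ z * v j z * τ z) := by
    have i3' : Integrable (fun z => G j k z * (θ z * τ z)) := by
      refine i3.congr (ae_of_all _ fun z => ?_)
      simp only; ring
    rw [← integral_add i3' i4]
    refine integral_congr_ae (ae_of_all _ fun z => ?_)
    ring
  rw [e1] at h0
  rw [e2]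
  linear_combination h0

/-- The test function is the conjugate of θτe^{φ−η}. Its exponential cancels the weight e^{-(φ−η)}
on the form side, leaves e^η on the function side because e^{φ−η}e^{-(φ−2η)} = e^η, and contributes
the term with ∂(φ − η) when it is differentiated. -/
theorem weakAdjoint_cutoff (hΩ : IsOpen Ω) (hφ : ContDiffOn ℝ ∞ φ Ω) (hη : ContDiffOn ℝ ∞ η Ω)
    (hv : ∀ j, MemL2W Ω (fun z => φ z - η z) (v j)) (hh : MemL2W Ω (fun z => φ z - 2 * η z) h)
    (hhw : WeakAdjoint Ω (fun z => φ z - 2 * η z) (fun z => φ z - η z) v h)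
    {θ : Cn n → ℂ} (hθ : IsTestFunction Ω θ) {τ : Cn n → ℂ}
    (hτ : ContDiff ℝ ∞ τ) (hτc : HasCompactSupport τ) :
    ∑ j, ∫ z, θ z * v j z * dz j τ z
      = -∫ z, (-(θ z * (Real.exp (η z) : ℝ) * h z) + ∑ j, dz j θ z * v j z
        + ∑ j, θ z * dz j (fun z => ((φ z - η z : ℝ) : ℂ)) z * v j z) * τ z := by
  have hκ : ContDiffOn ℝ ∞ (fun z => φ z - η z) Ω := hφ.sub hη
  have hE : ContDiffOn ℝ ∞ (fun z => ((Real.exp (φ z - η z) : ℝ) : ℂ)) Ω :=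
    Complex.ofRealCLM.contDiff.comp_contDiffOn (Real.contDiff_exp.comp_contDiffOn hκ)
  have hθτ := hθ.mul_left hτ
  have h0 := hhw _ (hθτ.mul_contDiffOn hΩ hE).star
  have hz : ∀ z, z ∉ Ω → θ z = 0 := fun z hz =>
    image_eq_zero_of_notMem_tsupport fun h => hz (hθ.tsupport_subset h)
  have hzd : ∀ j z, z ∉ Ω → dz j θ z = 0 := fun j z hz =>
    dz_eq_zero_of_notMem_tsupport fun h => hz (hθ.tsupport_subset h)
  have hexp : ∀ t : ℝ, ((Real.exp t : ℝ) : ℂ) * ((Real.exp (-t) : ℝ) : ℂ) = 1 := fun t => by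
    rw [← ofReal_mul, ← Real.exp_add]; simp
  have hm : ∀ j, ∀ z ∈ Ω, star (dzbar j (fun z => star (θ z * τ z
        * ((Real.exp (φ z - η z) : ℝ) : ℂ))) z)
      = (dz j θ z * τ z + θ z * dz j τ z + θ z * τ z * dz j (fun z => ((φ z - η z : ℝ) : ℂ)) z)
        * ((Real.exp (φ z - η z) : ℝ) : ℂ) := by
    intro j z hzΩ
    have hd : DifferentiableAt ℝ (fun z => φ z - η z) z :=
      (hκ.contDiffAt (hΩ.mem_nhds hzΩ)).differentiableAt (by simp)
    have hdE := (hE.contDiffAt (hΩ.mem_nhds hzΩ)).differentiableAt (by simp)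
    rw [dzbar_star, star_star, dz_mul (hθτ.smooth.differentiable (by simp) z) hdE,
      dz_mul (hθ.smooth.differentiable (by simp) z) (hτ.differentiable (by simp) z),
      dz_comp (F := Real.exp) (ψ := fun z => φ z - η z) Real.differentiableAt_exp hd,
      Real.deriv_exp]
    ring
  have e1 : ∀ j, ∫ z in Ω, v j z * star (dzbar j (fun z => star (θ z * τ z
        * ((Real.exp (φ z - η z) : ℝ) : ℂ))) z) * ((Real.exp (-(φ z - η z)) : ℝ) : ℂ)
      = ∫ z, (θ z * v j z * dz j τ z + (dz j θ z * v j z * τ z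
        + θ z * dz j (fun z => ((φ z - η z : ℝ) : ℂ)) z * v j z * τ z)) := by
    intro j
    rw [← setIntegral_eq_integral_of_tsupport (Ω := Ω)
      (fun z hz' => by simp [hz z hz', hzd _ z hz'])]
    refine setIntegral_congr_fun hΩ.measurableSet fun z hzΩ => ?_
    rw [hm j z hzΩ]
    linear_combination (v j z * (dz j θ z * τ z + θ z * dz j τ z
      + θ z * τ z * dz j (fun z => ((φ z - η z : ℝ) : ℂ)) z)) * hexp (φ z - η z)
  have e2 : ∫ z in Ω, h z * star (star (θ z * τ z * ((Real.exp (φ z - η z) : ℝ) : ℂ)))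
        * ((Real.exp (-(φ z - 2 * η z)) : ℝ) : ℂ)
      = ∫ z, θ z * (Real.exp (η z) : ℝ) * h z * τ z := by
    rw [← setIntegral_eq_integral_of_tsupport (Ω := Ω) (fun z hz' => by simp [hz z hz'])]
    refine setIntegral_congr_fun hΩ.measurableSet fun z hzΩ => ?_
    simp only [star_star]
    have : ((Real.exp (φ z - η z) : ℝ) : ℂ) * ((Real.exp (-(φ z - 2 * η z)) : ℝ) : ℂ)
        = (Real.exp (η z) : ℝ) := by
      rw [← ofReal_mul, ← Real.exp_add]; congr 2; ring
    linear_combination h z * θ z * τ z * this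
  simp only [e1, e2] at h0
  have hκc := hκ.continuousOn
  have mτ := memLp_of_hasCompactSupport hτ.continuous hτc
  have i1 : ∀ j, Integrable (fun z => θ z * v j z * dz j τ z) := fun j =>
    integrable_mul_of_memLp ((hv j).cutoff_mul hΩ hκc hθ.smooth.continuous
      hθ.hasCompactSupport hθ.tsupport_subset)
      (memLp_of_hasCompactSupport (hτ.dz (m := ∞) (by simp)).continuous hτc.dz)
  have i2 : ∀ j, Integrable (fun z => dz j θ z * v j z * τ z) := fun j =>
    integrable_mul_of_memLp ((hv j).cutoff_mul hΩ hκc (hθ.dz j).smooth.continuous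
      (hθ.dz j).hasCompactSupport (hθ.dz j).tsupport_subset) mτ
  have i3 : ∀ j, Integrable (fun z => θ z * dz j (fun z => ((φ z - η z : ℝ) : ℂ)) z * v j z
      * τ z) := by
    intro j
    have hcd : ContDiffOn ℝ ∞ (dz j (fun z => ((φ z - η z : ℝ) : ℂ))) Ω := fun z hzΩ =>
      (((Complex.ofRealCLM.contDiff.comp_contDiffOn hκ).contDiffAt
        (hΩ.mem_nhds hzΩ)).dz (by simp)).contDiffWithinAt
    have ht := hθ.mul_contDiffOn hΩ hcd
    exact integrable_mul_of_memLp ((hv j).cutoff_mul hΩ hκc ht.smooth.continuous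
      ht.hasCompactSupport ht.tsupport_subset) mτ
  have i4 : Integrable (fun z => θ z * (Real.exp (η z) : ℝ) * h z * τ z) := by
    have ht := hθ.mul_contDiffOn (f := fun z => ((Real.exp (η z) : ℝ) : ℂ)) hΩ
      (Complex.ofRealCLM.contDiff.comp_contDiffOn (Real.contDiff_exp.comp_contDiffOn hη))
    exact integrable_mul_of_memLp (hh.cutoff_mul hΩ (hφ.continuousOn.sub
      (continuousOn_const.mul hη.continuousOn)) ht.smooth.continuous
      ht.hasCompactSupport ht.tsupport_subset) mτ
  have e3 : ∀ j, ∫ z, (θ z * v j z * dz j τ z + (dz j θ z * v j z * τ z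
        + θ z * dz j (fun z => ((φ z - η z : ℝ) : ℂ)) z * v j z * τ z))
      = (∫ z, θ z * v j z * dz j τ z) + ((∫ z, dz j θ z * v j z * τ z)
        + ∫ z, θ z * dz j (fun z => ((φ z - η z : ℝ) : ℂ)) z * v j z * τ z) := by
    intro j
    rw [← integral_add (i2 j) (i3 j)]
    exact integral_add (i1 j) ((i2 j).add (i3 j))
  have e4 : ∫ z, (-(θ z * (Real.exp (η z) : ℝ) * h z) + ∑ j, dz j θ z * v j z
        + ∑ j, θ z * dz j (fun z => ((φ z - η z : ℝ) : ℂ)) z * v j z) * τ z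
      = -(∫ z, θ z * (Real.exp (η z) : ℝ) * h z * τ z) + (∑ j, ∫ z, dz j θ z * v j z * τ z)
        + ∑ j, ∫ z, θ z * dz j (fun z => ((φ z - η z : ℝ) : ℂ)) z * v j z * τ z := by
    rw [← integral_finsetSum _ fun j _ => i2 j, ← integral_finsetSum _ fun j _ => i3 j,
      ← integral_neg]
    have hs2 := integrable_finsetSum Finset.univ fun j _ => i2 j
    have hs3 := integrable_finsetSum Finset.univ fun j _ => i3 j
    have a1 := integral_add i4.neg hs2
    have a2 := integral_add (i4.neg.add hs2) hs3
    simp only [Pi.neg_apply, Pi.add_apply] at a1 a2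
    rw [← a1, ← a2]
    refine integral_congr_ae (ae_of_all _ fun z => ?_)
    simp only [add_mul, neg_mul, Finset.sum_mul]
  simp only [e3, Finset.sum_add_distrib] at h0
  rw [e4]
  linear_combination h0

end Weighted

/-! ### The three-weight estimate for a cut-off form. -/

section Weighted

open Filter Topology

theorem integrable_normSq_mul {α : Type*} [MeasurableSpace α] {μ : Measure α} {f : α → ℂ}
    {W : α → ℝ} {C : ℝ} (hW : AEStronglyMeasurable W μ) (hC : ∀ x, |W x| ≤ C) (hf : MemLp f 2 μ) :
    Integrable (fun x => ‖f x‖ ^ 2 * W x) μ := by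
  refine ((integrable_normSq hf).const_mul C).mono'
    ((integrable_normSq hf).aestronglyMeasurable.mul hW) (ae_of_all _ fun x => ?_)
  rw [norm_mul, Real.norm_of_nonneg (by positivity : 0 ≤ ‖f x‖ ^ 2), mul_comm]
  gcongr
  exact hC x

theorem normSq_toLp (w : Fin n → ℂ) : ‖(WithLp.toLp 2 w : Cn n)‖ ^ 2 = ∑ j, ‖w j‖ ^ 2 := by
  rw [EuclideanSpace.norm_sq_eq]

variable {Ω : Set (Cn n)} {φ η θ χ : Cn n → ℝ} {v : Fin n → Cn n → ℂ} {h : Cn n → ℂ}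
  {G : Fin n → Fin n → Cn n → ℂ} {τ : ℝ}

theorem leviForm_congr {φ ψ : Cn n → ℝ} {z : Cn n} (h : φ =ᶠ[𝓝 z] ψ) (w : Cn n) :
    leviForm φ z w = leviForm ψ z w := by
  have h1 : ∀ᶠ x in 𝓝 z, φ =ᶠ[𝓝 x] ψ := eventually_eventually_nhds.2 h
  have h2 : ∀ j k, dz j (dzbar k (fun z => (φ z : ℂ))) z = dz j (dzbar k (fun z => (ψ z : ℂ))) z :=
    fun j k => dz_congr (by
      filter_upwards [h1] with x hx
      exact dzbar_congr (hx.fun_comp ((↑) : ℝ → ℂ)))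
  simp only [leviForm, h2]

/-- The part of the formal adjoint of a cut-off form not involving the weight. -/
def cutoffAdjoint (η θ : Cn n → ℝ) (v : Fin n → Cn n → ℂ) (h : Cn n → ℂ) (z : Cn n) : ℂ :=
  -((θ z : ℂ) * (Real.exp (η z) : ℝ) * h z) + ∑ j, dz j (fun z => (θ z : ℂ)) z * v j z

/-- `∂̄(θ v)` in terms of `G = ∂̄v`. -/
def cutoffDbar (θ : Cn n → ℝ) (v : Fin n → Cn n → ℂ) (G : Fin n → Fin n → Cn n → ℂ)
    (j k : Fin n) (z : Cn n) : ℂ :=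
  (θ z : ℂ) * G j k z + dzbar j (fun z => (θ z : ℂ)) z * v k z
    - dzbar k (fun z => (θ z : ℂ)) z * v j z

/-- Kohn–Morrey–Hörmander for θv with weight φ calls for the adjoint relative to φ, whereas the
equation for `v` provides the one relative to φ − η; they differ by ∑ (∂η/∂z_j) θv_j. Squaring costs
2|∂η|²|θv|², which the Levi form of φ absorbs by hypothesis. What remains of the Levi form is
τe^η|θv|²e^{-φ}, the density of the norm with weight φ − η. -/
theorem cutoff_estimate (hΩ : IsOpen Ω) (hφ : ContDiffOn ℝ ∞ φ Ω) (hη : ContDiffOn ℝ ∞ η Ω)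
    (hτ : 0 ≤ τ)
    (hess : ∀ z ∈ Ω, ∀ w, (2 * ∑ j, ‖dz j (fun z => (η z : ℂ)) z‖ ^ 2 + τ * Real.exp (η z))
      * ‖w‖ ^ 2 ≤ leviForm φ z w)
    (hv : ∀ j, MemL2W Ω (fun z => φ z - η z) (v j)) (hh : MemL2W Ω (fun z => φ z - 2 * η z) h)
    (hG : ∀ j k, MemL2W Ω φ (G j k))
    (hhw : WeakAdjoint Ω (fun z => φ z - 2 * η z) (fun z => φ z - η z) v h)
    (hGw : WeakDbar Ω v G)
    (hθ : IsTestFunction Ω (fun z => (θ z : ℂ)))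
    (hχ : ContDiff ℝ ∞ χ) (hχc : HasCompactSupport χ) (hχs : tsupport χ ⊆ Ω)
    (hχθ : ∀ z ∈ tsupport (fun z => (θ z : ℂ)), χ =ᶠ[𝓝 z] fun _ => 1) :
    τ * ∑ j, normSqW Ω (fun z => φ z - η z) (fun z => θ z * v j z)
      ≤ 2 * normSqW Ω φ (cutoffAdjoint η θ v h)
        + 1 / 2 * ∑ j, ∑ k, normSqW Ω φ (cutoffDbar θ v G j k) ∧
    ∀ T : Fin n → Fin n → Cn n → ℂ, (∀ j k, ContDiff ℝ ∞ (T j k)) →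
      (∀ j k, HasCompactSupport (T j k)) →
      ‖∑ j, ∑ k, ∫ z, θ z * v j z * dzbar k (T j k) z‖ ^ 2
        ≤ (∑ j, ∑ k, ∫ z, ‖T j k z‖ ^ 2 * Real.exp (χ z * φ z))
          * (2 * normSqW Ω φ (cutoffAdjoint η θ v h)
            + 1 / 2 * ∑ j, ∑ k, normSqW Ω φ (cutoffDbar θ v G j k)) := by
  -- `φ` is smooth only on Ω and may blow up at the boundary. The product χφ is smooth with compact
  -- support on ℂⁿ and coincides with φ near the support of θ, where alone the weight matters.
  have hφ' : ContDiff ℝ ∞ (fun z => χ z * φ z) := contDiff_cutoff_mul hΩ hχ hχs hφ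
  have hφ'c : HasCompactSupport (fun z => χ z * φ z) := hχc.mul_right
  have hκ : ContDiffOn ℝ ∞ (fun z => φ z - η z) Ω := hφ.sub hη
  have hκ1 : ContDiffOn ℝ ∞ (fun z => φ z - 2 * η z) Ω := hφ.sub (contDiffOn_const.mul hη)
  have hκc := hκ.continuousOn
  set θc : Cn n → ℂ := fun z => (θ z : ℂ) with hθc
  have cut : ∀ {b g : Cn n → ℂ} {κ : Cn n → ℝ}, ContDiffOn ℝ ∞ κ Ω → MemL2W Ω κ g →
      IsTestFunction Ω b → MemLp (fun z => b z * g z) 2 volume := fun hκ hg hb =>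
    hg.cutoff_mul hΩ hκ.continuousOn hb.smooth.continuous hb.hasCompactSupport hb.tsupport_subset
  -- supports
  have s0 : ∀ z, z ∉ tsupport θc → θc z = 0 := fun z hz => image_eq_zero_of_notMem_tsupport hz
  have s1 : ∀ z, z ∉ tsupport θc → ∀ j, dz j θc z = 0 := fun z hz j =>
    dz_eq_zero_of_notMem_tsupport hz
  have s2 : ∀ z, z ∉ tsupport θc → ∀ j, dzbar j θc z = 0 := fun z hz j =>
    dzbar_eq_zero_of_notMem_tsupport hz
  have hcs : ∀ g : Cn n → ℂ, (∀ z, z ∉ tsupport θc → g z = 0) → HasCompactSupport g :=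
    fun g hg => HasCompactSupport.intro hθ.hasCompactSupport hg
  have hφeq : ∀ z ∈ tsupport θc, (fun z => χ z * φ z) =ᶠ[𝓝 z] φ := fun z hz => by
    filter_upwards [hχθ z hz] with x hx
    rw [hx, one_mul]
  -- membership
  have mv : ∀ j, MemLp (fun z => θc z * v j z) 2 volume := fun j => cut hκ (hv j) hθ
  have mx1 : MemLp (fun z => θc z * (Real.exp (η z) : ℝ) * h z) 2 volume :=
    cut hκ1 hh (hθ.mul_contDiffOn hΩ
      (Complex.ofRealCLM.contDiff.comp_contDiffOn (Real.contDiff_exp.comp_contDiffOn hη)))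
  have mdv : ∀ j, MemLp (fun z => dz j θc z * v j z) 2 volume := fun j => cut hκ (hv j) (hθ.dz j)
  have mx : MemLp (cutoffAdjoint η θ v h) 2 volume :=
    mx1.neg.add (memLp_finsetSum _ fun j _ => mdv j)
  have hcd : ∀ {κ : Cn n → ℝ}, ContDiffOn ℝ ∞ κ Ω → ∀ j,
      ContDiffOn ℝ ∞ (dz j (fun z => (κ z : ℂ))) Ω := fun hκ j z hzΩ =>
      (((Complex.ofRealCLM.contDiff.comp_contDiffOn hκ).contDiffAt
        (hΩ.mem_nhds hzΩ)).dz (by simp)).contDiffWithinAt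
  have mκ : ∀ {κ : Cn n → ℝ}, ContDiffOn ℝ ∞ κ Ω → ∀ j,
      MemLp (fun z => θc z * dz j (fun z => (κ z : ℂ)) z * v j z) 2 volume := fun h j =>
    cut hκ (hv j) (hθ.mul_contDiffOn hΩ (hcd h j))
  set p : Cn n → ℂ := fun z => -(θc z * (Real.exp (η z) : ℝ) * h z) + ∑ j, dz j θc z * v j z
        + ∑ j, θc z * dz j (fun z => ((φ z - η z : ℝ) : ℂ)) z * v j z with hp
  have mp : MemLp p 2 volume := mx.add (memLp_finsetSum _ fun j _ => mκ hκ j)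
  have pc : HasCompactSupport p := hcs _ fun z hz => by simp [hp, s0 z hz, s1 z hz]
  have mG : ∀ j k, MemLp (cutoffDbar θ v G j k) 2 volume := fun j k =>
    ((cut hφ (hG j k) hθ).add (cut hκ (hv k) (hθ.dzbar j))).sub (cut hκ (hv j) (hθ.dzbar k))
  have hx0 : ∀ z, z ∉ tsupport θc → cutoffAdjoint η θ v h z = 0 := fun z hz => by
    have a := s0 z hz; have b := s1 z hz
    simp only [hθc] at a b
    simp [cutoffAdjoint, a, b]
  have hG0 : ∀ j k z, z ∉ tsupport θc → cutoffDbar θ v G j k z = 0 := fun j k z hz => by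
    have a := s0 z hz; have b := s2 z hz
    simp only [hθc] at a b
    simp [cutoffDbar, a, b]
  have hT := kohn_morrey_weak hφ' hφ'c mv (fun j => hcs _ fun z hz => by simp [s0 z hz]) mp pc
    (fun τ hτ hτc => weakAdjoint_cutoff hΩ hφ hη hv hh hhw hθ hτ hτc) mG
    (fun j k => hcs _ (hG0 j k))
    (fun j k τ hτ hτc => weakDbar_cutoff hΩ hκ.continuousOn hφ.continuousOn hv hG hGw hθ j k hτ hτc)
    rfl
  obtain ⟨il, hR, hT⟩ := hT
  set q : Cn n → ℂ := fun z => p z - ∑ j, dz j (fun z => ((χ z * φ z : ℝ) : ℂ)) z * (θc z * v j z)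
    with hq
  have q0 : ∀ z, z ∉ tsupport θc → q z = 0 := fun z hz => by simp [hq, hp, s0 z hz, s1 z hz]
  -- The φ-derivatives in `p` cancel against those subtracted in `q`, leaving only the derivatives
  -- of η.
  have hqeq : ∀ z, q z = cutoffAdjoint η θ v h z
      + -∑ j, dz j (fun z => (η z : ℂ)) z * (θc z * v j z) := by
    intro z
    by_cases hz : z ∈ tsupport θc
    · have hzΩ := hΩ.mem_nhds (hθ.tsupport_subset hz)
      have d1 : ContDiffAt ℝ ∞ (fun z => (φ z : ℂ)) z :=
        (Complex.ofRealCLM.contDiff.comp_contDiffOn hφ).contDiffAt hzΩ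
      have d2 : ContDiffAt ℝ ∞ (fun z => (η z : ℂ)) z :=
        (Complex.ofRealCLM.contDiff.comp_contDiffOn hη).contDiffAt hzΩ
      have e1 : ∀ j, dz j (fun z => ((χ z * φ z : ℝ) : ℂ)) z = dz j (fun z => (φ z : ℂ)) z :=
        fun j => dz_congr ((hφeq z hz).fun_comp ((↑) : ℝ → ℂ))
      have e2 : ∀ j, dz j (fun z => ((φ z - η z : ℝ) : ℂ)) z
          = dz j (fun z => (φ z : ℂ)) z - dz j (fun z => (η z : ℂ)) z := fun j => by
        simp only [ofReal_sub]
        exact dz_sub (d1.differentiableAt (by simp)) (d2.differentiableAt (by simp))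
      simp only [hq, hp, e1, e2, cutoffAdjoint, hθc]
      rw [add_sub_assoc, ← Finset.sum_sub_distrib, ← Finset.sum_neg_distrib]
      congr 1
      refine Finset.sum_congr rfl fun j _ => ?_
      ring
    · rw [q0 z hz, hx0 z hz, zero_add]
      simp [s0 z hz]
  have hWc : Continuous fun z => Real.exp (-(χ z * φ z)) :=
    Real.continuous_exp.comp hφ'.continuous.neg
  obtain ⟨C, hC⟩ := bounded_of_hasCompactSupport hφ'.continuous hφ'c
  have hWb : ∀ z, |Real.exp (-(χ z * φ z))| ≤ Real.exp C := fun z => by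
    rw [abs_of_pos (Real.exp_pos _)]
    exact Real.exp_le_exp.2 ((neg_le_abs _).trans (hC z))
  have mq : MemLp q 2 volume := by
    have : q = fun z => cutoffAdjoint η θ v h z
      + -∑ j, θc z * dz j (fun z => (η z : ℂ)) z * v j z := by
      ext z; rw [hqeq]; congr 2
      exact Finset.sum_congr rfl fun j _ => by ring
    rw [this]
    exact mx.add (memLp_finsetSum _ fun j _ => mκ hη j).neg
  have iq := integrable_normSq_mul hWc.aestronglyMeasurable hWb mq
  have ix := integrable_normSq_mul hWc.aestronglyMeasurable hWb mx
  have iv : ∀ j, Integrable (fun z => ‖θc z * v j z‖ ^ 2 * Real.exp (-(φ z - η z))) := by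
    intro j
    have hE : ContDiffOn ℝ ∞ (fun z => ((Real.exp (-(φ z - η z) / 2) : ℝ) : ℂ)) Ω :=
      Complex.ofRealCLM.contDiff.comp_contDiffOn
        (Real.contDiff_exp.comp_contDiffOn (hκ.neg.div_const 2))
    refine (integrable_normSq (cut hκ (hv j) (hθ.mul_contDiffOn hΩ hE))).congr
      (ae_of_all _ fun z => ?_)
    have hexp : Real.exp (-(φ z - η z) / 2) ^ 2 = Real.exp (-(φ z - η z)) := by
      rw [← Real.exp_nat_mul]; congr 1; push_cast; ring
    simp only [norm_mul, mul_pow, norm_real, Real.norm_of_nonneg (Real.exp_pos _).le, hexp]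
    ring
  -- Pointwise absorption of 2|∂η|²|θv|² into the Levi form; off the support of θ every term
  -- vanishes.
  have hpt : ∀ z, ‖q z‖ ^ 2 * Real.exp (-(χ z * φ z))
      - leviForm (fun z => χ z * φ z) z (WithLp.toLp 2 fun j => θc z * v j z)
        * Real.exp (-(χ z * φ z))
      ≤ 2 * (‖cutoffAdjoint η θ v h z‖ ^ 2 * Real.exp (-(χ z * φ z)))
        - τ * ∑ j, ‖θc z * v j z‖ ^ 2 * Real.exp (-(φ z - η z)) := by
    intro z
    by_cases hz : z ∈ tsupport θc
    · have hzΩ := hθ.tsupport_subset hz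
      have a1 := hess z hzΩ (WithLp.toLp 2 fun j => θc z * v j z)
      have a2 : ‖q z‖ ^ 2 ≤ 2 * ‖cutoffAdjoint η θ v h z‖ ^ 2
          + 2 * ((∑ j, ‖dz j (fun z => (η z : ℂ)) z‖ ^ 2) * ∑ j, ‖θc z * v j z‖ ^ 2) := by
        rw [hqeq]
        refine (norm_add_sq_le_two _ _).trans ?_
        rw [norm_neg]
        gcongr
        exact norm_sum_mul_sq_le _ _
      rw [leviForm_congr (hφeq z hz), ← Finset.sum_mul]
      rw [normSq_toLp] at a1
      have e : χ z * φ z = φ z := (hφeq z hz).eq_of_nhds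
      rw [e]
      have e3 : Real.exp (-(φ z - η z)) = Real.exp (-φ z) * Real.exp (η z) := by
        rw [← Real.exp_add]; congr 1; ring
      rw [e3]
      have := mul_le_mul_of_nonneg_right (sub_le_sub a2 a1) (Real.exp_pos (-φ z)).le
      nlinarith [this]
    · have : leviForm (fun z => χ z * φ z) z (WithLp.toLp 2 fun j => θc z * v j z) = 0 := by
        simp [leviForm_toLp, s0 z hz]
      rw [this, q0 z hz, hx0 z hz]
      simp [s0 z hz]
  have hRle : (∫ z, ‖q z‖ ^ 2 * Real.exp (-(χ z * φ z)))
      - ∫ z, leviForm (fun z => χ z * φ z) z (WithLp.toLp 2 fun j => θc z * v j z)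
        * Real.exp (-(χ z * φ z))
      ≤ 2 * (∫ z, ‖cutoffAdjoint η θ v h z‖ ^ 2 * Real.exp (-(χ z * φ z)))
        - τ * ∑ j, ∫ z, ‖θc z * v j z‖ ^ 2 * Real.exp (-(φ z - η z)) := by
    have isv := integrable_finsetSum Finset.univ fun j _ => iv j
    rw [← integral_sub iq il, ← integral_finsetSum _ fun j _ => iv j, ← integral_const_mul,
      ← integral_const_mul, ← integral_sub (ix.const_mul 2) (isv.const_mul τ)]
    exact integral_mono (iq.sub il) ((ix.const_mul 2).sub (isv.const_mul τ)) hpt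
  have hW : ∀ g : Cn n → ℂ, (∀ z, z ∉ tsupport θc → g z = 0) →
      ∫ z, ‖g z‖ ^ 2 * Real.exp (-(χ z * φ z)) = normSqW Ω φ g := by
    intro g hg
    rw [normSqW, setIntegral_eq_integral_of_tsupport fun z hz => by
      rw [hg z fun h => hz (hθ.tsupport_subset h)]; simp]
    refine integral_congr_ae (ae_of_all _ fun z => ?_)
    by_cases hz : z ∈ tsupport θc
    · simp only
      rw [(hφeq z hz).eq_of_nhds]
    · simp [hg z hz]
  have hV : ∀ j, ∫ z, ‖θc z * v j z‖ ^ 2 * Real.exp (-(φ z - η z))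
      = normSqW Ω (fun z => φ z - η z) (fun z => θ z * v j z) := by
    intro j
    rw [normSqW, setIntegral_eq_integral_of_tsupport fun z hz => by
      rw [show (θ z : ℂ) = 0 from s0 z fun h => hz (hθ.tsupport_subset h)]; simp]
  simp only [hW _ hx0, hV] at hRle
  simp only [hW _ (hG0 _ _)] at hR hT
  -- The quantity R of `kohn_morrey_weak` is bounded by the right-hand side minus this term. Its
  -- nonnegativity 0 ≤ R gives the norm estimate, while discarding this term bounds R in the dual
  -- estimate.
  have hA : 0 ≤ τ * ∑ j, normSqW Ω (fun z => φ z - η z) (fun z => θ z * v j z) :=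
    mul_nonneg hτ (Finset.sum_nonneg fun j _ => normSqW_nonneg _ _ _)
  refine ⟨by linarith, fun T hTs hTc => (hT T hTs hTc).trans ?_⟩
  refine mul_le_mul_of_nonneg_left (by linarith) ?_
  exact Finset.sum_nonneg fun j _ => Finset.sum_nonneg fun k _ =>
    integral_nonneg fun z => by positivity

end Weighted

/-! ### Removal of the cutoffs. -/

section Weighted

open Filter Topology

variable {Ω : Set (Cn n)} {φ η χ : Cn n → ℝ} {v : Fin n → Cn n → ℂ} {h : Cn n → ℂ}
  {G : Fin n → Fin n → Cn n → ℂ} {τ Λ : ℝ} {θ : ℕ → Cn n → ℝ}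

theorem tendsto_normSqW_of_dominated (hΩ : IsOpen Ω) {κ : Cn n → ℝ} (hκ : ContinuousOn κ Ω)
    {F : ℕ → Cn n → ℂ} {bound f : Cn n → ℝ}
    (hF : ∀ ν, AEStronglyMeasurable (F ν) (volume.restrict Ω))
    (hb : IntegrableOn bound Ω)
    (hle : ∀ ν, ∀ z ∈ Ω, ‖F ν z‖ ^ 2 * Real.exp (-κ z) ≤ bound z)
    (hlim : ∀ z ∈ Ω, ∀ᶠ ν in atTop, ‖F ν z‖ ^ 2 * Real.exp (-κ z) = f z) :
    Tendsto (fun ν => normSqW Ω κ (F ν)) atTop (𝓝 (∫ z in Ω, f z)) := by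
  refine tendsto_integral_of_dominated_convergence bound (fun ν => ?_) hb (fun ν => ?_) ?_
  · exact ((hF ν).norm.pow 2).mul ((Real.continuous_exp.comp_continuousOn
      hκ.neg).aestronglyMeasurable hΩ.measurableSet)
  · refine ae_restrict_of_forall_mem hΩ.measurableSet fun z hz => ?_
    rw [Real.norm_of_nonneg (by positivity)]
    exact hle ν z hz
  · exact ae_restrict_of_forall_mem hΩ.measurableSet fun z hz =>
      tendsto_const_nhds.congr' ((hlim z hz).mono fun ν h => h.symm)

theorem IsCutoffSeq.eventually_eq (hθ : IsCutoffSeq Ω θ) {z : Cn n} (hz : z ∈ Ω) :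
    ∀ᶠ ν in atTop, θ ν z = 1 ∧ (∀ j, dz j (fun z => (θ ν z : ℂ)) z = 0)
      ∧ ∀ j, dzbar j (fun z => (θ ν z : ℂ)) z = 0 := by
  filter_upwards [hθ.eventually_one {z} isCompact_singleton (by simpa using hz)] with ν hν
  have h1 := hν z rfl
  have h2 : (fun z => (θ ν z : ℂ)) =ᶠ[𝓝 z] fun _ => 1 := by
    filter_upwards [h1] with x hx
    rw [hx]; simp
  exact ⟨h1.eq_of_nhds, fun j => by rw [dz_congr h2, dz_const],
    fun j => by rw [dzbar_congr h2, dzbar_const]⟩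

/-- Let θ_ν tend to 1. Since |∂θ_ν|² ≤ Λe^η, the commutator terms are dominated, |∂θ_ν|²|v|²e^{-φ} ≤
Λ|v|²e^{-(φ−η)}, and at each point they are eventually zero, so they disappear by dominated
convergence and Λ leaves no trace. This is the reason for three weights that differ successively by
η. -/
theorem weighted_estimate (hΩ : IsOpen Ω) (hφ : ContDiffOn ℝ ∞ φ Ω) (hη : ContDiffOn ℝ ∞ η Ω)
    (hτ : 0 ≤ τ)
    (hess : ∀ z ∈ Ω, ∀ w, (2 * ∑ j, ‖dz j (fun z => (η z : ℂ)) z‖ ^ 2 + τ * Real.exp (η z))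
      * ‖w‖ ^ 2 ≤ leviForm φ z w)
    (hθ : IsCutoffSeq Ω θ)
    (hgrad : ∀ ν, ∀ z ∈ Ω, ∑ j, ‖dz j (fun z => (θ ν z : ℂ)) z‖ ^ 2 ≤ Λ * Real.exp (η z))
    (hv : ∀ j, MemL2W Ω (fun z => φ z - η z) (v j)) (hh : MemL2W Ω (fun z => φ z - 2 * η z) h)
    (hG : ∀ j k, MemL2W Ω φ (G j k))
    (hhw : WeakAdjoint Ω (fun z => φ z - 2 * η z) (fun z => φ z - η z) v h)
    (hGw : WeakDbar Ω v G) :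
    τ * ∑ j, normSqW Ω (fun z => φ z - η z) (v j)
      ≤ 2 * normSqW Ω (fun z => φ z - 2 * η z) h + 1 / 2 * ∑ j, ∑ k, normSqW Ω φ (G j k) ∧
    ∀ T : Fin n → Fin n → Cn n → ℂ, (∀ j k, IsTestFunction Ω (T j k)) →
      ‖∑ j, ∑ k, ∫ z in Ω, v j z * dzbar k (T j k) z‖ ^ 2
        ≤ (∑ j, ∑ k, ∫ z in Ω, ‖T j k z‖ ^ 2 * Real.exp (φ z))
          * (2 * normSqW Ω (fun z => φ z - 2 * η z) h
            + 1 / 2 * ∑ j, ∑ k, normSqW Ω φ (G j k)) := by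
  have hκ : ContDiffOn ℝ ∞ (fun z => φ z - η z) Ω := hφ.sub hη
  have hex : ∀ z, Real.exp (-(φ z - 2 * η z)) = Real.exp (η z) ^ 2 * Real.exp (-φ z) := fun z => by
    rw [← Real.exp_nat_mul, ← Real.exp_add]; congr 1; push_cast; ring
  have hex1 : ∀ z, Real.exp (-(φ z - η z)) = Real.exp (η z) * Real.exp (-φ z) := fun z => by
    rw [← Real.exp_add]; congr 1; ring
  have mθ : ∀ ν, AEStronglyMeasurable (fun z => (θ ν z : ℂ)) (volume.restrict Ω) := fun ν =>
    (hθ.isTestFunction ν).smooth.continuous.aestronglyMeasurable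
  have mdθ : ∀ ν j, AEStronglyMeasurable (dz j (fun z => (θ ν z : ℂ))) (volume.restrict Ω) :=
    fun ν j => ((hθ.isTestFunction ν).dz j).smooth.continuous.aestronglyMeasurable
  have mbθ : ∀ ν j, AEStronglyMeasurable (dzbar j (fun z => (θ ν z : ℂ))) (volume.restrict Ω) :=
    fun ν j => ((hθ.isTestFunction ν).dzbar j).smooth.continuous.aestronglyMeasurable
  have mη : AEStronglyMeasurable (fun z => ((Real.exp (η z) : ℝ) : ℂ)) (volume.restrict Ω) :=
    (Complex.continuous_ofReal.comp_continuousOn (Real.continuous_exp.comp_continuousOn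
      hη.continuousOn)).aestronglyMeasurable hΩ.measurableSet
  have hθ1 : ∀ ν z, ‖(θ ν z : ℂ)‖ ^ 2 ≤ 1 := fun ν z => by
    rw [norm_real, Real.norm_of_nonneg (hθ.nonneg ν z)]
    exact pow_le_one₀ (hθ.nonneg ν z) (hθ.le_one ν z)
  have hgj : ∀ ν, ∀ z ∈ Ω, ∀ j, ‖dz j (fun z => (θ ν z : ℂ)) z‖ ^ 2 ≤ Λ * Real.exp (η z) :=
    fun ν z hz j => (Finset.single_le_sum (f := fun j => ‖dz j (fun z => (θ ν z : ℂ)) z‖ ^ 2)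
      (fun i _ => by positivity) (Finset.mem_univ j)).trans (hgrad ν z hz)
  have hv2 : ∀ j, Integrable (fun z => ‖v j z‖ ^ 2 * Real.exp (-(φ z - η z)))
    (volume.restrict Ω) := fun j => (hv j).2
  have hh2 : Integrable (fun z => ‖h z‖ ^ 2 * Real.exp (-(φ z - 2 * η z)))
    (volume.restrict Ω) := hh.2
  have hG2 : ∀ j k, Integrable (fun z => ‖G j k z‖ ^ 2 * Real.exp (-φ z))
    (volume.restrict Ω) := fun j k => (hG j k).2
  have ib1 : IntegrableOn (fun z => 2 * (‖h z‖ ^ 2 * Real.exp (-(φ z - 2 * η z)))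
        + 2 * Λ * ∑ j, ‖v j z‖ ^ 2 * Real.exp (-(φ z - η z))) Ω :=
    (hh2.const_mul 2).add
      ((integrable_finsetSum Finset.univ fun j _ => hv2 j).const_mul (2 * Λ))
  have ib2 : ∀ j k, IntegrableOn (fun z => 4 * (‖G j k z‖ ^ 2 * Real.exp (-φ z))
        + (4 * Λ * (‖v k z‖ ^ 2 * Real.exp (-(φ z - η z)))
          + 2 * Λ * (‖v j z‖ ^ 2 * Real.exp (-(φ z - η z))))) Ω := fun j k =>
    ((hG2 j k).const_mul 4).add (((hv2 k).const_mul (4 * Λ)).add ((hv2 j).const_mul (2 * Λ)))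
  have L3 : ∀ j, Tendsto (fun ν => normSqW Ω (fun z => φ z - η z) (fun z => θ ν z * v j z)) atTop
      (𝓝 (normSqW Ω (fun z => φ z - η z) (v j))) := by
    intro j
    refine tendsto_normSqW_of_dominated hΩ hκ.continuousOn (fun ν => (mθ ν).mul (hv j).1) (hv j).2
      (fun ν z hz => ?_) fun z hz => ?_
    · rw [norm_mul, mul_pow]
      gcongr
      exact mul_le_of_le_one_left (by positivity) (hθ1 ν z)
    · filter_upwards [hθ.eventually_eq hz] with ν hν
      rw [hν.1]; simp
  have L1 : Tendsto (fun ν => normSqW Ω φ (cutoffAdjoint η (θ ν) v h)) atTop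
      (𝓝 (normSqW Ω (fun z => φ z - 2 * η z) h)) := by
    refine tendsto_normSqW_of_dominated hΩ hφ.continuousOn
      (bound := fun z => 2 * (‖h z‖ ^ 2 * Real.exp (-(φ z - 2 * η z)))
        + 2 * Λ * ∑ j, ‖v j z‖ ^ 2 * Real.exp (-(φ z - η z)))
      (fun ν => (((mθ ν).mul mη).mul hh.1).neg.add
        (Finset.aestronglyMeasurable_fun_sum _ fun j _ => (mdθ ν j).mul (hv j).1))
      ib1
      (fun ν z hz => ?_) fun z hz => ?_
    · rw [hex, hex1]
      have a1 : ‖cutoffAdjoint η (θ ν) v h z‖ ^ 2 ≤ 2 * (‖h z‖ ^ 2 * Real.exp (η z) ^ 2)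
          + 2 * ((Λ * Real.exp (η z)) * ∑ j, ‖v j z‖ ^ 2) := by
        refine (norm_add_sq_le_two _ _).trans ?_
        gcongr
        · rw [norm_neg, norm_mul, norm_mul, mul_pow, mul_pow, norm_real (Real.exp _),
            Real.norm_of_nonneg (Real.exp_pos _).le]
          calc _ ≤ 1 * Real.exp (η z) ^ 2 * ‖h z‖ ^ 2 := by gcongr; exact hθ1 ν z
            _ = _ := by ring
        · refine (norm_sum_mul_sq_le _ _).trans ?_
          gcongr
          exact hgrad ν z hz
      refine (mul_le_mul_of_nonneg_right a1 (Real.exp_pos (-φ z)).le).trans_eq ?_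
      rw [← Finset.sum_mul]
      ring
    · filter_upwards [hθ.eventually_eq hz] with ν hν
      simp only [cutoffAdjoint, hν.1, hν.2.1, hex]
      simp only [ofReal_one, one_mul, zero_mul, Finset.sum_const_zero, add_zero, norm_neg, norm_mul,
        norm_real, Real.norm_of_nonneg (Real.exp_pos _).le]
      ring
  have L2 : ∀ j k, Tendsto (fun ν => normSqW Ω φ (cutoffDbar (θ ν) v G j k)) atTop
      (𝓝 (normSqW Ω φ (G j k))) := by
    intro j k
    refine tendsto_normSqW_of_dominated hΩ hφ.continuousOn
      (bound := fun z => 4 * (‖G j k z‖ ^ 2 * Real.exp (-φ z))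
        + (4 * Λ * (‖v k z‖ ^ 2 * Real.exp (-(φ z - η z)))
          + 2 * Λ * (‖v j z‖ ^ 2 * Real.exp (-(φ z - η z)))))
      (fun ν => (((mθ ν).mul (hG j k).1).add ((mbθ ν j).mul (hv k).1)).sub
        ((mbθ ν k).mul (hv j).1))
      (ib2 j k)
      (fun ν z hz => ?_) fun z hz => ?_
    · have hb : ∀ j, ‖dzbar j (fun z => (θ ν z : ℂ)) z‖ ^ 2 ≤ Λ * Real.exp (η z) := fun j => by
        rw [dzbar_ofReal, norm_star]; exact hgj ν z hz j
      have a1 : ‖cutoffDbar (θ ν) v G j k z‖ ^ 2 ≤ 2 * (2 * (1 * ‖G j k z‖ ^ 2)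
          + 2 * ((Λ * Real.exp (η z)) * ‖v k z‖ ^ 2))
          + 2 * ((Λ * Real.exp (η z)) * ‖v j z‖ ^ 2) := by
        rw [cutoffDbar, sub_eq_add_neg]
        refine (norm_add_sq_le_two _ _).trans ?_
        rw [norm_neg, norm_mul (dzbar k _ _), mul_pow]
        gcongr
        · refine (norm_add_sq_le_two _ _).trans ?_
          rw [norm_mul, norm_mul, mul_pow, mul_pow]
          gcongr
          · exact hθ1 ν z
          · exact hb j
        · exact hb k
      rw [hex1]
      refine (mul_le_mul_of_nonneg_right a1 (Real.exp_pos (-φ z)).le).trans_eq ?_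
      ring
    · filter_upwards [hθ.eventually_eq hz] with ν hν
      simp only [cutoffDbar, hν.1, hν.2.2]
      simp
  have LB : Tendsto (fun ν => 2 * normSqW Ω φ (cutoffAdjoint η (θ ν) v h)
        + 1 / 2 * ∑ j, ∑ k, normSqW Ω φ (cutoffDbar (θ ν) v G j k)) atTop
      (𝓝 (2 * normSqW Ω (fun z => φ z - 2 * η z) h
            + 1 / 2 * ∑ j, ∑ k, normSqW Ω φ (G j k))) :=
    (L1.const_mul 2).add ((tendsto_finsetSum _ fun j _ => tendsto_finsetSum _ fun k _ =>
      L2 j k).const_mul _)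
  have hsupp : ∀ ν, tsupport (fun z => (θ ν z : ℂ)) ⊆ tsupport (θ ν) := fun ν =>
    tsupport_ofReal_subset
  -- A later cutoff θ_μ, equal to one near the support of θ_ν, plays the role of χ.
  have main : ∀ ν, ∃ μ, (∀ z ∈ tsupport (θ ν), θ μ z = 1) ∧ _ := fun ν => by
    obtain ⟨μ, hμ⟩ := (hθ.eventually_one (tsupport (θ ν)) (hθ.hasCompactSupport ν)
      (hθ.tsupport_subset ν)).exists
    exact ⟨μ, fun z hz => (hμ z hz).eq_of_nhds,
      cutoff_estimate hΩ hφ hη hτ hess hv hh hG hhw hGw (hθ.isTestFunction ν)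
      (hθ.smooth μ) (hθ.hasCompactSupport μ) (hθ.tsupport_subset μ)
      fun z hz => hμ z (hsupp ν hz)⟩
  choose μ hμ using main
  refine ⟨le_of_tendsto_of_tendsto' ((tendsto_finsetSum _ fun j _ => L3 j).const_mul τ) LB
    fun ν => (hμ ν).2.1, fun T hT => ?_⟩
  refine ge_of_tendsto (LB.const_mul _) ?_
  -- Once θ_ν equals one on the supports of all `T j k`, no cutoff is visible in either pairing, so
  -- only the bound still has to pass to the limit.
  have hK : IsCompact (⋃ p : Fin n × Fin n, tsupport (T p.1 p.2)) :=
    isCompact_iUnion fun p => (hT p.1 p.2).hasCompactSupport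
  filter_upwards [hθ.eventually_one _ hK (Set.iUnion_subset fun p =>
    (hT p.1 p.2).tsupport_subset)] with ν hν
  have hν' : ∀ j k, ∀ z ∈ tsupport (T j k), θ ν z = 1 := fun j k z hz =>
    (hν z (Set.mem_iUnion.2 ⟨(j, k), hz⟩)).eq_of_nhds
  have key := (hμ ν).2.2 T (fun j k => (hT j k).smooth) fun j k => (hT j k).hasCompactSupport
  have e1 : ∀ j k, ∫ z in Ω, v j z * dzbar k (T j k) z
      = ∫ z, θ ν z * v j z * dzbar k (T j k) z := by
    intro j k
    rw [setIntegral_eq_integral_of_tsupport fun z hz => by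
      rw [dzbar_eq_zero_of_notMem_tsupport fun h' => hz ((hT j k).tsupport_subset h'), mul_zero]]
    refine integral_congr_ae (ae_of_all _ fun z => ?_)
    by_cases hz : z ∈ tsupport (T j k)
    · simp [hν' j k z hz]
    · simp [dzbar_eq_zero_of_notMem_tsupport hz]
  have e2 : ∀ j k, ∫ z in Ω, ‖T j k z‖ ^ 2 * Real.exp (φ z)
      = ∫ z, ‖T j k z‖ ^ 2 * Real.exp (θ (μ ν) z * φ z) := by
    intro j k
    rw [setIntegral_eq_integral_of_tsupport fun z hz => by
      rw [image_eq_zero_of_notMem_tsupport fun h' => hz ((hT j k).tsupport_subset h')]; simp]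
    refine integral_congr_ae (ae_of_all _ fun z => ?_)
    by_cases hz : z ∈ tsupport (T j k)
    · have : θ (μ ν) z = 1 := (hμ ν).1 z (subset_tsupport _ (by
        simp [hν' j k z hz]))
      simp [this]
    · simp [image_eq_zero_of_notMem_tsupport hz]
  simp only [e1, e2]
  exact key

end Weighted

/-! ### Abstract solvability and weak limits in Hilbert spaces. -/

section Hilbert

open Filter Topology

variable {E F : Type*} [NormedAddCommGroup E] [InnerProductSpace ℂ E] [CompleteSpace E]
  [NormedAddCommGroup F] [InnerProductSpace ℂ F] [CompleteSpace F]

-- Applied with first component 0, the bound shows that ⟨x, v⟩ depends only on `h` for pairs (h, v)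
-- in `S`. It is therefore a bounded functional on the projection of `S`, which Hahn–Banach extends
-- and Riesz represents. No closedness or density of `S` is needed.
omit [CompleteSpace F] in
theorem exists_inner_eq_of_norm_inner_le (S : Submodule ℂ (E × F)) (x : F) {C : ℝ} (hC : 0 ≤ C)
    (hS : ∀ h v, (h, v) ∈ S → ‖inner ℂ x v‖ ≤ C * ‖h‖) :
    ∃ g : E, ‖g‖ ≤ C ∧ ∀ h v, (h, v) ∈ S → inner ℂ g h = inner ℂ x v := by
  have huniq : ∀ h v v', (h, v) ∈ S → (h, v') ∈ S → inner ℂ x v = inner ℂ x v' := by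
    intro h v v' h1 h2
    have h3 := hS 0 (v - v') (by simpa using S.sub_mem h1 h2)
    rw [norm_zero, mul_zero, norm_le_zero_iff, inner_sub_right, sub_eq_zero] at h3
    exact h3
  have hex : ∀ h : S.map (LinearMap.fst ℂ E F), ∃ v, ((h : E), v) ∈ S := by
    rintro ⟨h, hh⟩
    obtain ⟨⟨h', v⟩, hp, rfl⟩ := hh
    exact ⟨v, hp⟩
  choose V hV using hex
  let f : S.map (LinearMap.fst ℂ E F) →ₗ[ℂ] ℂ :=
    { toFun := fun h => inner ℂ x (V h)
      map_add' := fun h h' => by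
        rw [← inner_add_right]
        exact huniq _ _ _ (hV _) (by simpa using S.add_mem (hV h) (hV h'))
      map_smul' := fun c h => by
        rw [RingHom.id_apply, smul_eq_mul, ← inner_smul_right]
        exact huniq _ _ _ (hV _) (by simpa using S.smul_mem c (hV h)) }
  let f' := f.mkContinuous C fun h => hS _ _ (hV h)
  obtain ⟨L, hL, hLn⟩ := exists_extension_norm_eq _ f'
  refine ⟨(InnerProductSpace.toDual ℂ E).symm L, ?_, fun h v hv => ?_⟩
  · rw [LinearIsometryEquiv.norm_map, hLn]
    exact LinearMap.mkContinuous_norm_le _ hC _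
  · rw [InnerProductSpace.toDual_symm_apply]
    exact (hL ⟨h, ⟨(h, v), hv, rfl⟩⟩).trans (huniq _ _ _ (hV _) hv)

/-- A bounded family in a Hilbert space converges weakly along every ultrafilter. -/
theorem exists_weak_limit {ι : Type*} (U : Ultrafilter ι) {x : ι → E} {C : ℝ}
    (hx : ∀ i, ‖x i‖ ≤ C) :
    ∃ y : E, ∀ z, Tendsto (fun i => inner ℂ z (x i)) U (𝓝 (inner ℂ z y)) := by
  have hex : ∀ z : E, ∃ a : ℂ, Tendsto (fun i => inner ℂ (x i) z) U (𝓝 a) := by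
    intro z
    obtain ⟨a, -, ha⟩ := (isCompact_closedBall (0 : ℂ) (C * ‖z‖)).ultrafilter_le_nhds
      (U.map fun i => inner ℂ (x i) z) (by
        rw [le_principal_iff]
        change ∀ᶠ i in (U : Filter ι), _
        exact Filter.Eventually.of_forall fun i => by
          simpa using (norm_inner_le_norm (𝕜 := ℂ) (x i) z).trans
            (mul_le_mul_of_nonneg_right (hx i) (norm_nonneg z)))
    exact ⟨a, ha⟩
  choose ℓ hℓ using hex
  let L : E →ₗ[ℂ] ℂ :=
    { toFun := ℓ
      map_add' := fun z w => tendsto_nhds_unique (hℓ _) (by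
        simpa only [inner_add_right] using (hℓ z).add (hℓ w))
      map_smul' := fun c z => tendsto_nhds_unique (hℓ _) (by
        simpa only [inner_smul_right, RingHom.id_apply, smul_eq_mul] using (hℓ z).const_mul c) }
  let L' := L.mkContinuous C fun z => le_of_tendsto (hℓ z).norm (Eventually.of_forall fun i =>
    (norm_inner_le_norm (𝕜 := ℂ) (x i) z).trans
      (mul_le_mul_of_nonneg_right (hx i) (norm_nonneg z)))
  refine ⟨(InnerProductSpace.toDual ℂ E).symm L', fun z => ?_⟩
  have h := (Complex.continuous_conj.tendsto _).comp (hℓ z)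
  have e : inner ℂ z ((InnerProductSpace.toDual ℂ E).symm L') = star (ℓ z) := by
    rw [← inner_conj_symm, InnerProductSpace.toDual_symm_apply]; rfl
  rw [e]
  exact h.congr fun i => inner_conj_symm _ _

omit [CompleteSpace E] in
/-- If `x i → y` weakly and `z i → w` in norm then the inner products converge. -/
theorem tendsto_inner_of_weak {ι : Type*} {l : Filter ι} {x z : ι → E} {y w : E} {C : ℝ}
    (hx : ∀ i, ‖x i‖ ≤ C) (hw : ∀ z, Tendsto (fun i => inner ℂ z (x i)) l (𝓝 (inner ℂ z y)))
    (hz : Tendsto z l (𝓝 w)) :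
    Tendsto (fun i => inner ℂ (z i) (x i)) l (𝓝 (inner ℂ w y)) := by
  have h1 : Tendsto (fun i => inner ℂ (z i - w) (x i)) l (𝓝 (0 : ℂ)) := by
    have h2 : Tendsto (fun i => ‖z i - w‖ * C) l (𝓝 0) := by
      simpa using (tendsto_iff_norm_sub_tendsto_zero.1 hz).mul_const C
    refine squeeze_zero_norm (fun i => ?_) h2
    exact (norm_inner_le_norm _ _).trans (mul_le_mul_of_nonneg_left (hx i) (norm_nonneg _))
  have := h1.add (hw w)
  simp only [zero_add] at this
  refine this.congr fun i => ?_
  rw [inner_sub_left]; ring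

-- Weak lower semicontinuity of the norm, obtained by testing the weak convergence with the limit
-- itself.
omit [CompleteSpace E] in
theorem norm_sq_le_of_weak {ι : Type*} {l : Filter ι} [l.NeBot] {x : ι → E} {y : E} {c : ℝ}
    (hx : ∀ i, ‖x i‖ ^ 2 ≤ c) (hw : ∀ z, Tendsto (fun i => inner ℂ z (x i)) l (𝓝 (inner ℂ z y))) :
    ‖y‖ ^ 2 ≤ c := by
  have h0 : 0 ≤ c := by
    obtain ⟨i⟩ := l.nonempty_of_neBot
    exact (sq_nonneg _).trans (hx i)
  have h1 : ‖inner ℂ y y‖ ≤ ‖y‖ * √c := by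
    refine le_of_tendsto (hw y).norm (Eventually.of_forall fun i => ?_)
    exact (norm_inner_le_norm _ _).trans (mul_le_mul_of_nonneg_left
      (Real.le_sqrt_of_sq_le (hx i)) (norm_nonneg _))
  rw [inner_self_eq_norm_sq_to_K] at h1
  norm_num at h1
  have h2 : ‖y‖ ≤ √c := by
    rcases (norm_nonneg y).eq_or_lt with h | h
    · rw [← h]; exact Real.sqrt_nonneg _
    · exact le_of_mul_le_mul_left (by rwa [← sq]) h
  calc ‖y‖ ^ 2 ≤ √c ^ 2 := by gcongr
    _ = c := Real.sq_sqrt h0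

/-- The relation orthogonal to a set of pairs: an abstract maximal operator or adjoint. -/
def pairing (A : Set (F × E)) : Submodule ℂ (E × F) where
  carrier := {p | ∀ q ∈ A, inner ℂ q.1 p.2 = inner ℂ q.2 p.1}
  zero_mem' := by simp
  add_mem' h h' q hq := by
    simp only [Prod.snd_add, Prod.fst_add, inner_add_right, h q hq, h' q hq]
  smul_mem' c p h q hq := by
    simp only [Prod.smul_snd, Prod.smul_fst, inner_smul_right, h q hq]

variable {A : Set (F × E)} {Γ : Set (E × F)} {K : Submodule ℂ F} {c : ℝ}

/-- Solvability of the abstract `∂̄`-equation from an a priori estimate. -/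
theorem exists_solution_of_estimate (hK : IsClosed (K : Set F)) (hc : 0 ≤ c)
    (hA : ∀ q ∈ A, q ∈ pairing Γ) (hΓ : ∀ p ∈ Γ, p.2 ∈ K)
    (hest : ∀ v h, (v, h) ∈ pairing Γ → v ∈ K → ‖v‖ ≤ c * ‖h‖) {x : F} (hx : x ∈ K) :
    ∃ g : E, ‖g‖ ≤ c * ‖x‖ ∧ (g, x) ∈ pairing A := by
  have : CompleteSpace K := hK.completeSpace_coe
  obtain ⟨g, hg, hgS⟩ := exists_inner_eq_of_norm_inner_le
    ((pairing Γ).map (LinearEquiv.prodComm ℂ F E).toLinearMap) x (C := c * ‖x‖) (by positivity) (by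
      rintro h v ⟨⟨v', h'⟩, hp, he⟩
      obtain ⟨rfl, rfl⟩ : h' = h ∧ v' = v := Prod.ext_iff.1 he
      -- The a priori estimate is available only on `K`, so `v'` is replaced by its projection. This
      -- changes neither the pairing with x ∈ K nor membership in `pairing Γ`, since the second
      -- components of Γ lie in `K`.
      have e : inner ℂ x v' = inner ℂ x (K.starProjection v') := by
        rw [← sub_eq_zero, ← inner_sub_right]
        exact K.inner_right_of_mem_orthogonal hx (K.sub_starProjection_mem_orthogonal v')
      have hm : (K.starProjection v', h') ∈ pairing Γ := fun q hq => by
        refine (hp q hq).trans ?_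
        rw [← sub_eq_zero, ← inner_sub_right]
        have := K.inner_right_of_mem_orthogonal (hΓ q hq)
          (K.sub_starProjection_mem_orthogonal v')
        exact this
      have hb := hest _ _ hm (K.starProjection_apply_mem v')
      rw [e]
      calc _ ≤ ‖x‖ * ‖K.starProjection v'‖ := norm_inner_le_norm _ _
        _ ≤ ‖x‖ * (c * ‖h'‖) := by gcongr
        _ = _ := by ring)
  refine ⟨g, hg, fun q hq => ?_⟩
  have := hgS q.2 q.1 ⟨q, hA q hq, rfl⟩
  rw [← inner_conj_symm, ← this, inner_conj_symm]

/-- Solvability of the abstract adjoint equation, up to the kernel. -/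
theorem exists_adjoint_solution_of_estimate (hK : IsClosed (K : Set F)) (hc : 0 ≤ c)
    (hA : ∀ q ∈ A, q ∈ pairing Γ) (hΓ : ∀ p ∈ Γ, p.2 ∈ K)
    (hAK : ∀ g x, (g, x) ∈ pairing A → x ∈ K)
    (hest : ∀ v h, (v, h) ∈ pairing Γ → v ∈ K → ‖v‖ ≤ c * ‖h‖) (b : E) :
    ∃ B r, ‖B‖ ≤ ‖b‖ ∧ (b - B, 0) ∈ pairing A ∧ r ∈ K ∧
      ∀ g x, (g, x) ∈ pairing A → inner ℂ x r = inner ℂ g B := by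
  have : CompleteSpace K := hK.completeSpace_coe
  -- `N` is the kernel of the maximal operator. Only the part of `b` orthogonal to this kernel can
  -- be an adjoint image, and that part will be `B`.
  let N : Submodule ℂ E := (pairing A).comap (LinearMap.inl ℂ E F)
  have hN : IsClosed (N : Set E) := by
    have : (N : Set E) = ⋂ q ∈ A, {g | inner ℂ q.1 (0 : F) = inner ℂ q.2 g} := by
      ext g
      simp only [Set.mem_iInter]
      exact Iff.rfl
    rw [this]
    exact isClosed_biInter fun q _ => isClosed_eq continuous_const (by fun_prop)
  have : CompleteSpace N := hN.completeSpace_coe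
  set k := N.starProjection b with hk
  have hkN : k ∈ N := N.starProjection_apply_mem b
  have hB : b - k ∈ Nᗮ := N.sub_starProjection_mem_orthogonal b
  obtain ⟨r, -, hr⟩ := exists_inner_eq_of_norm_inner_le
    ((pairing A).map (LinearEquiv.prodComm ℂ E F).toLinearMap) (b - k) (C := ‖b - k‖ * c)
    (by positivity) (by
      rintro x g ⟨⟨g', x'⟩, hp, he⟩
      obtain ⟨rfl, rfl⟩ : x' = x ∧ g' = g := Prod.ext_iff.1 he
      -- Exchange `g'` for the solution `g` of controlled norm. They differ by an element of the
      -- kernel, to which b − k is orthogonal, so the functional is bounded by the size of `x'`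
      -- alone.
      obtain ⟨g, hg, hgx⟩ := exists_solution_of_estimate hK hc hA hΓ hest (hAK _ _ hp)
      have hs : g' - g ∈ N := by
        change (g' - g, (0 : F)) ∈ pairing A
        simpa using (pairing A).sub_mem hp hgx
      have e : inner ℂ (b - k) g' = inner ℂ (b - k) g := by
        rw [← sub_eq_zero, ← inner_sub_right]
        exact N.inner_left_of_mem_orthogonal hs hB
      rw [e]
      calc _ ≤ ‖b - k‖ * ‖g‖ := norm_inner_le_norm _ _
        _ ≤ ‖b - k‖ * (c * ‖x'‖) := by gcongr
        _ = _ := by ring)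
  refine ⟨b - k, K.starProjection r, ?_, by rw [sub_sub_cancel]; exact hkN, K.starProjection_apply_mem r,
    fun g x hp => ?_⟩
  · have h := N.norm_sq_eq_add_norm_sq_starProjection b
    have h2 : Nᗮ.starProjection b = b - k := by
      rw [Submodule.starProjection_orthogonal_val]
    rw [h2] at h
    nlinarith [norm_nonneg (b - k), norm_nonneg b, sq_nonneg ‖N.starProjection b‖]
  · have e : inner ℂ x (K.starProjection r) = inner ℂ x r := by
      rw [← sub_eq_zero, ← inner_sub_right, ← neg_sub, inner_neg_right,
        K.inner_right_of_mem_orthogonal (hAK _ _ hp) (K.sub_starProjection_mem_orthogonal r),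
        neg_zero]
    rw [e, ← inner_conj_symm, hr x g ⟨(g, x), hp, by simp⟩, inner_conj_symm]

end Hilbert

/-! ### A fixed triple of weights, realised in the unweighted L² spaces. -/

section Level

open Filter Topology

/-- The Hilbert space `L²(Ω)`. -/
abbrev L2Fun (Ω : Set (Cn n)) : Type := Lp ℂ 2 (volume.restrict Ω)

/-- The Hilbert space `L²_{(0,1)}(Ω)`. -/
abbrev L2Form (Ω : Set (Cn n)) : Type := PiLp 2 fun _ : Fin n => L2Fun Ω

open Classical in
/-- The element of `L²(Ω)` represented by `e^{-κ/2} f`. -/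
def toL2 (Ω : Set (Cn n)) (κ : Cn n → ℝ) (f : Cn n → ℂ) : L2Fun Ω :=
  if h : MemL2 Ω (fun z => (Real.exp (-κ z / 2) : ℝ) * f z) then h.toLp _ else 0

/-- The function `e^{κ/2} x` for `x ∈ L²(Ω)`. -/
def unweight {Ω : Set (Cn n)} (κ : Cn n → ℝ) (x : L2Fun Ω) (z : Cn n) : ℂ :=
  (Real.exp (κ z / 2) : ℝ) * x z

variable {Ω : Set (Cn n)} {κ κ₁ κ₂ κ₃ : Cn n → ℝ} {f g φ : Cn n → ℂ}

theorem inner_toL2 (hf : MemL2 Ω (fun z => (Real.exp (-κ z / 2) : ℝ) * f z)) (x : L2Fun Ω) :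
    inner ℂ (toL2 Ω κ f) x = ∫ z in Ω, x z * star ((Real.exp (-κ z / 2) : ℝ) * f z) := by
  rw [toL2, dif_pos hf]
  conv_lhs => rw [← Lp.toLp_coeFn x (Lp.memLp x)]
  exact inner_toLp_eq _ _

theorem norm_toL2_sq (hf : MemL2 Ω (fun z => (Real.exp (-κ z / 2) : ℝ) * f z)) :
    ‖toL2 Ω κ f‖ ^ 2 = normSqW Ω κ f := by
  rw [toL2, dif_pos hf]
  refine (norm_toLp_sq hf).trans (integral_congr_ae (ae_of_all _ fun z => ?_))
  simp only [norm_mul, norm_real, Real.norm_eq_abs, Real.abs_exp, mul_pow]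
  rw [← Real.exp_nat_mul, mul_comm]
  congr 2; push_cast; ring

theorem coeFn_toL2 (hf : MemL2 Ω (fun z => (Real.exp (-κ z / 2) : ℝ) * f z)) :
    toL2 Ω κ f =ᵐ[volume.restrict Ω] fun z => (Real.exp (-κ z / 2) : ℝ) * f z := by
  rw [toL2, dif_pos hf]
  exact hf.coeFn_toLp

theorem aestronglyMeasurable_exp (hΩ : IsOpen Ω) (hκ : ContinuousOn κ Ω) :
    AEStronglyMeasurable (fun z => ((Real.exp (κ z) : ℝ) : ℂ)) (volume.restrict Ω) :=
  (Complex.continuous_ofReal.comp_continuousOn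
    (Real.continuous_exp.comp_continuousOn hκ)).aestronglyMeasurable hΩ.measurableSet

theorem memL2_exp_mul_test (hΩ : IsOpen Ω) (hκ : ContinuousOn κ Ω) (hφ : IsTestFunction Ω φ) :
    MemL2 Ω (fun z => (Real.exp (-κ z / 2) : ℝ) * φ z) := by
  have h1 : Continuous (fun z => (Real.exp (-κ z / 2) : ℝ) * φ z) := by
    refine continuous_of_tsupport fun z hz => ?_
    have hz' : z ∈ Ω := hφ.tsupport_subset (closure_mono (fun w hw => by
      simp only [Function.mem_support] at hw ⊢; exact right_ne_zero_of_mul hw) hz)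
    have h2 : ContinuousAt κ z := hκ.continuousAt (hΩ.mem_nhds hz')
    have h3 : ContinuousAt (fun z => Real.exp (-κ z / 2)) z := by fun_prop
    exact (Complex.continuous_ofReal.continuousAt.comp h3).mul
      hφ.smooth.continuous.continuousAt
  exact (memLp_of_hasCompactSupport h1 (hasCompactSupport_of_zero hφ.hasCompactSupport
    fun z hz => by simp [hz])).restrict _

theorem memL2_exp_neg_mul (hΩ : IsOpen Ω) (hκ : ContinuousOn κ Ω) (h0 : ∀ z ∈ Ω, 0 ≤ κ z)
    (hf : MemL2 Ω f) : MemL2 Ω (fun z => (Real.exp (-κ z / 2) : ℝ) * f z) := by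
  have hm := aestronglyMeasurable_exp hΩ (κ := fun z => -κ z / 2) (hκ.neg.div_const 2)
  refine MemLp.of_le_mul hf (hm.mul hf.aestronglyMeasurable) (c := 1)
    (ae_restrict_of_forall_mem hΩ.measurableSet fun z hz => ?_)
  rw [norm_mul, norm_real, Real.norm_eq_abs, Real.abs_exp]
  gcongr
  have := h0 z hz
  exact Real.exp_le_one_iff.2 (by linarith)

theorem inner_toL2_toL2 (hf : MemL2 Ω (fun z => (Real.exp (-κ₁ z / 2) : ℝ) * f z))
    (hg : MemL2 Ω (fun z => (Real.exp (-κ₂ z / 2) : ℝ) * g z)) :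
    inner ℂ (toL2 Ω κ₁ f) (toL2 Ω κ₂ g)
      = ∫ z in Ω, g z * star (f z) * (Real.exp (-(κ₁ z + κ₂ z) / 2) : ℝ) := by
  rw [inner_toL2 hf]
  refine integral_congr_ae ?_
  filter_upwards [coeFn_toL2 hg] with z hz
  rw [hz, neg_add, add_div, Real.exp_add, star_mul']
  simp only [star_def, conj_ofReal]
  push_cast; ring

/-- Opposite weights cancel, which is why distributional equations, free of any weight, are written
with test functions carrying the weight −κ. With this convention all weights live in one Hilbert
space, as weak limits along varying weights require. -/
theorem inner_toL2_neg (hf : MemL2 Ω (fun z => (Real.exp (-(-κ z) / 2) : ℝ) * f z))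
    (hg : MemL2 Ω (fun z => (Real.exp (-κ z / 2) : ℝ) * g z)) :
    inner ℂ (toL2 Ω (fun z => -κ z) f) (toL2 Ω κ g) = ∫ z in Ω, g z * star (f z) := by
  rw [inner_toL2_toL2 hf hg]
  simp

theorem inner_toL2_neg_eq_unweight (hf : MemL2 Ω (fun z => (Real.exp (-(-κ z) / 2) : ℝ) * f z))
    (x : L2Fun Ω) :
    inner ℂ (toL2 Ω (fun z => -κ z) f) x = ∫ z in Ω, unweight κ x z * star (f z) := by
  rw [inner_toL2 hf]
  refine integral_congr_ae (ae_of_all _ fun z => ?_)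
  simp only [unweight, star_mul', star_def, conj_ofReal, neg_neg]
  ring

theorem inner_toL2_eq_unweight (hf : MemL2 Ω (fun z => (Real.exp (-κ z / 2) : ℝ) * f z))
    (x : L2Fun Ω) :
    inner ℂ (toL2 Ω κ f) x
      = ∫ z in Ω, unweight κ x z * star (f z) * (Real.exp (-κ z) : ℝ) := by
  rw [inner_toL2 hf]
  refine integral_congr_ae (ae_of_all _ fun z => ?_)
  have : ((Real.exp (-κ z / 2) : ℝ) : ℂ) = (Real.exp (κ z / 2) : ℝ) * (Real.exp (-κ z) : ℝ) := by
    rw [← ofReal_mul, ← Real.exp_add]; congr 2; ring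
  simp only [unweight, star_mul', star_def, conj_ofReal, this]
  ring

theorem exp_half_sq_mul_exp_neg (t : ℝ) : Real.exp (t / 2) ^ 2 * Real.exp (-t) = 1 := by
  rw [← Real.exp_nat_mul, ← Real.exp_add, Real.exp_eq_one_iff]
  push_cast; ring

theorem normSq_unweight_mul (x : L2Fun Ω) (z : Cn n) :
    ‖unweight κ x z‖ ^ 2 * Real.exp (-κ z) = ‖x z‖ ^ 2 := by
  have := exp_half_sq_mul_exp_neg (κ z)
  simp only [unweight, norm_mul, norm_real, Real.norm_eq_abs, Real.abs_exp, mul_pow]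
  linear_combination ‖x z‖ ^ 2 * this

theorem aestronglyMeasurable_unweight (hΩ : IsOpen Ω) (hκ : ContinuousOn κ Ω) (x : L2Fun Ω) :
    AEStronglyMeasurable (unweight κ x) (volume.restrict Ω) :=
  (aestronglyMeasurable_exp hΩ (κ := fun z => κ z / 2) (hκ.div_const 2)).mul
    (Lp.aestronglyMeasurable x)

theorem memL2W_unweight (hΩ : IsOpen Ω) (hκ : ContinuousOn κ Ω) (x : L2Fun Ω) :
    MemL2W Ω κ (unweight κ x) := by
  refine ⟨aestronglyMeasurable_unweight hΩ hκ x, ?_⟩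
  simp only [normSq_unweight_mul]
  exact integrable_normSq (Lp.memLp x)

theorem integrable_unweight_mul (hΩ : IsOpen Ω) (hκ : ContinuousOn κ Ω) (x : L2Fun Ω)
    (hφ : IsTestFunction Ω φ) :
    Integrable (fun z => unweight κ x z * φ z) (volume.restrict Ω) := by
  refine (integrable_mul_of_memLp (Lp.memLp x) (memL2_exp_mul_test (κ := fun z => -κ z) hΩ hκ.neg
    hφ)).congr (ae_of_all _ fun z => ?_)
  simp only [unweight, neg_neg]
  ring

theorem normSqW_unweight (x : L2Fun Ω) : normSqW Ω κ (unweight κ x) = ‖x‖ ^ 2 := by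
  simp only [normSqW, normSq_unweight_mul]
  rw [← norm_toLp_sq (Lp.memLp x), Lp.toLp_coeFn]

theorem memL2_unweight (hΩ : IsOpen Ω) (hκ : ContinuousOn κ Ω) {M : ℝ} (hM : ∀ z ∈ Ω, κ z ≤ M)
    (x : L2Fun Ω) : MemL2 Ω (unweight κ x) := by
  refine MemLp.of_le_mul (Lp.memLp x) (aestronglyMeasurable_unweight hΩ hκ x)
    (c := Real.exp (M / 2)) (ae_restrict_of_forall_mem hΩ.measurableSet fun z hz => ?_)
  rw [unweight, norm_mul, norm_real, Real.norm_eq_abs, Real.abs_exp]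
  gcongr
  exact hM z hz

theorem exp_neg_mul_unweight (x : L2Fun Ω) :
    (fun z => ((Real.exp (-κ z / 2) : ℝ) : ℂ) * unweight κ x z) = x := by
  ext z
  rw [unweight, ← mul_assoc, ← ofReal_mul, ← Real.exp_add]
  rw [show -κ z / 2 + κ z / 2 = 0 by ring]
  simp

theorem toL2_unweight (x : L2Fun Ω) : toL2 Ω κ (unweight κ x) = x := by
  have h : MemL2 Ω (fun z => (Real.exp (-κ z / 2) : ℝ) * unweight κ x z) := by
    rw [exp_neg_mul_unweight]; exact Lp.memLp x
  rw [toL2, dif_pos h]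
  refine Lp.ext ?_
  filter_upwards [h.coeFn_toLp] with z hz
  rw [hz]
  exact congrFun (exp_neg_mul_unweight x) z

/-- `∂̄` on test functions, in weighted form. -/
def testGraph (Ω : Set (Cn n)) (κ₁ κ₂ : Cn n → ℝ) : Set (L2Fun Ω × L2Form Ω) :=
  {p | ∃ g, IsTestFunction Ω g ∧
    p = (toL2 Ω κ₁ g, WithLp.toLp 2 fun j => toL2 Ω κ₂ (dzbar j g))}

/-- The formal adjoint of `∂̄` on test forms with a single component, in weighted form. -/
def testAdjoint (Ω : Set (Cn n)) (κ₁ κ₂ : Cn n → ℝ) : Set (L2Form Ω × L2Fun Ω) :=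
  {q | ∃ j φ, IsTestFunction Ω φ ∧
    q = (WithLp.toLp 2 (Pi.single j (toL2 Ω (fun z => -κ₂ z) φ)),
      -toL2 Ω (fun z => -κ₁ z) (dz j φ))}

/-- `∂̄v = a` in the sense of distributions, in weighted form. -/
def DbarEq (κ₂ κ₃ : Cn n → ℝ) (v : L2Form Ω) (a : Fin n → Fin n → L2Fun Ω) : Prop :=
  ∀ j k φ, IsTestFunction Ω φ →
    inner ℂ (toL2 Ω (fun z => -κ₂ z) (dz j φ)) (v k)
      - inner ℂ (toL2 Ω (fun z => -κ₂ z) (dz k φ)) (v j)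
      = -inner ℂ (toL2 Ω (fun z => -κ₃ z) φ) (a j k)

/-- The `∂̄`-closed forms, in weighted form. -/
def closedForms (Ω : Set (Cn n)) (κ₂ : Cn n → ℝ) : Submodule ℂ (L2Form Ω) where
  carrier := {v | ∀ j k φ, IsTestFunction Ω φ →
    inner ℂ (toL2 Ω (fun z => -κ₂ z) (dz j φ)) (v k)
      = inner ℂ (toL2 Ω (fun z => -κ₂ z) (dz k φ)) (v j)}
  zero_mem' := by simp
  add_mem' h h' j k φ hφ := by
    simp only [PiLp.add_apply, inner_add_right, h j k φ hφ, h' j k φ hφ]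
  smul_mem' c v h j k φ hφ := by
    simp only [PiLp.smul_apply, inner_smul_right, h j k φ hφ]

theorem isClosed_closedForms : IsClosed (closedForms Ω κ₂ : Set (L2Form Ω)) := by
  have : (closedForms Ω κ₂ : Set (L2Form Ω)) = ⋂ (j : Fin n) (k : Fin n) (φ : Cn n → ℂ)
      (_ : IsTestFunction Ω φ), {v | inner ℂ (toL2 Ω (fun z => -κ₂ z) (dz j φ)) (v k)
      = inner ℂ (toL2 Ω (fun z => -κ₂ z) (dz k φ)) (v j)} := by
    ext v
    simp only [Set.mem_iInter]
    exact Iff.rfl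
  rw [this]
  exact isClosed_iInter fun j => isClosed_iInter fun k => isClosed_iInter fun φ =>
    isClosed_iInter fun _ => isClosed_eq (by fun_prop) (by fun_prop)

theorem inner_toLp_single (j : Fin n) (y : L2Fun Ω) (x : L2Form Ω) :
    inner ℂ (WithLp.toLp 2 (Pi.single j y) : L2Form Ω) x = inner ℂ y (x j) := by
  rw [PiLp.inner_apply, Finset.sum_eq_single j]
  · simp
  · intro k _ hk
    simp [Pi.single_eq_of_ne hk]
  · simp

theorem mem_pairing_testAdjoint {g : L2Fun Ω} {x : L2Form Ω} :
    (g, x) ∈ pairing (testAdjoint Ω κ₁ κ₂) ↔ ∀ j φ, IsTestFunction Ω φ →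
      inner ℂ (toL2 Ω (fun z => -κ₂ z) φ) (x j)
        = -inner ℂ (toL2 Ω (fun z => -κ₁ z) (dz j φ)) g := by
  refine ⟨fun h j φ hφ => ?_, ?_⟩
  · have := h _ ⟨j, φ, hφ, rfl⟩
    rw [inner_toLp_single] at this
    rw [this, inner_neg_left]
  · rintro h _ ⟨j, φ, hφ, rfl⟩
    rw [inner_toLp_single, inner_neg_left]
    exact h j φ hφ

theorem mem_pairing_testGraph {v : L2Form Ω} {h : L2Fun Ω} :
    (v, h) ∈ pairing (testGraph Ω κ₁ κ₂) ↔ ∀ g, IsTestFunction Ω g →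
      ∑ j, inner ℂ (toL2 Ω κ₂ (dzbar j g)) (v j) = inner ℂ (toL2 Ω κ₁ g) h := by
  refine ⟨fun hp g hg => ?_, ?_⟩
  · have := hp _ ⟨g, hg, rfl⟩
    simp only [PiLp.inner_apply] at this
    exact this.symm
  · rintro hp _ ⟨g, hg, rfl⟩
    simp only [PiLp.inner_apply]
    exact (hp g hg).symm

theorem dz_dz_comm {j k : Fin n} {z : Cn n} (hf : ContDiffAt ℝ 2 f z) :
    dz j (dz k f) z = dz k (dz j f) z := by
  have e : ∀ k, dz k f = fun z => star (dzbar k (fun x => star (f x)) z) := fun k => by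
    ext z; rw [dzbar_star, star_star]
  rw [e k, e j, dz_star, dz_star, dzbar_dzbar_comm]
  exact (starL' ℝ : ℂ ≃L[ℝ] ℂ).contDiff.contDiffAt.comp z hf

theorem setIntegral_mul_star_dz (hφ : IsTestFunction Ω φ) (hg : IsTestFunction Ω g) (j : Fin n) :
    ∫ z in Ω, g z * star (dz j φ z) = -∫ z in Ω, dzbar j g z * star (φ z) := by
  have hz : ∀ z, z ∉ Ω → g z = 0 := fun z hz =>
    image_eq_zero_of_notMem_tsupport fun h => hz (hg.tsupport_subset h)
  have hz' : ∀ z, z ∉ Ω → dzbar j g z = 0 := fun z hz =>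
    image_eq_zero_of_notMem_tsupport fun h => hz ((hg.dzbar j).tsupport_subset h)
  rw [setIntegral_eq_integral_of_tsupport (fun z h => by simp [hz z h]),
    setIntegral_eq_integral_of_tsupport (fun z h => by simp [hz' z h]), eq_neg_iff_add_eq_zero]
  have i1 : Integrable (fun z => g z * star (dz j φ z)) := integrable_mul_star
    (memLp_of_hasCompactSupport hg.smooth.continuous hg.hasCompactSupport)
    (memLp_of_hasCompactSupport (hφ.dz j).smooth.continuous (hφ.dz j).hasCompactSupport)
  have i2 : Integrable (fun z => dzbar j g z * star (φ z)) := integrable_mul_star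
    (memLp_of_hasCompactSupport (hg.dzbar j).smooth.continuous (hg.dzbar j).hasCompactSupport)
    (memLp_of_hasCompactSupport hφ.smooth.continuous hφ.hasCompactSupport)
  rw [← integral_add i1 i2, ← integral_dzbar_eq_zero (j := j) (f := fun z => g z * star (φ z))
    ((hg.smooth.mul hφ.star.smooth).of_le (by norm_cast)) hg.hasCompactSupport.mul_right]
  refine integral_congr_ae (ae_of_all _ fun z => ?_)
  simp only
  rw [dzbar_mul (hg.smooth.differentiable (by simp) z)
    (hφ.star.smooth.differentiable (by simp) z), dzbar_star]
  ring

section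

variable (hΩ : IsOpen Ω) (h₁ : ContinuousOn κ₁ Ω) (h₂ : ContinuousOn κ₂ Ω)
include hΩ h₁ h₂

theorem testGraph_mem_pairing (hg : IsTestFunction Ω g) :
    (toL2 Ω κ₁ g, WithLp.toLp 2 fun j => toL2 Ω κ₂ (dzbar j g))
      ∈ pairing (testAdjoint Ω κ₁ κ₂) := by
  refine mem_pairing_testAdjoint.2 fun j φ hφ => ?_
  rw [inner_toL2_neg (memL2_exp_mul_test hΩ h₂.neg hφ) (memL2_exp_mul_test hΩ h₂ (hg.dzbar j)),
    inner_toL2_neg (memL2_exp_mul_test hΩ h₁.neg (hφ.dz j)) (memL2_exp_mul_test hΩ h₁ hg),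
    setIntegral_mul_star_dz hφ hg, neg_neg]

theorem testAdjoint_subset_pairing :
    ∀ q ∈ testAdjoint Ω κ₁ κ₂, q ∈ pairing (testGraph Ω κ₁ κ₂) := by
  rintro q hq p ⟨g, hg, rfl⟩
  have := testGraph_mem_pairing hΩ h₁ h₂ hg q hq
  rw [← inner_conj_symm, ← this, inner_conj_symm]

end

theorem testGraph_subset_closedForms (hΩ : IsOpen Ω) (h₂ : ContinuousOn κ₂ Ω) :
    ∀ p ∈ testGraph Ω κ₁ κ₂, p.2 ∈ closedForms Ω κ₂ := by
  rintro p ⟨g, hg, rfl⟩ j k φ hφ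
  change inner ℂ _ (toL2 Ω κ₂ (dzbar k g)) = inner ℂ _ (toL2 Ω κ₂ (dzbar j g))
  rw [inner_toL2_neg (memL2_exp_mul_test hΩ h₂.neg (hφ.dz j))
    (memL2_exp_mul_test hΩ h₂ (hg.dzbar k)),
    inner_toL2_neg (memL2_exp_mul_test hΩ h₂.neg (hφ.dz k))
    (memL2_exp_mul_test hΩ h₂ (hg.dzbar j)),
    setIntegral_mul_star_dz hφ (hg.dzbar k), setIntegral_mul_star_dz hφ (hg.dzbar j)]
  simp only [dzbar_dzbar_comm (j := j) (k := k) (hg.smooth.contDiffAt.of_le (by norm_cast))]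

/-- This is ∂̄² = 0 in the sense of distributions, read off from commuting derivatives of the test
function. -/
theorem mem_closedForms_of_mem_pairing {g : L2Fun Ω} {x : L2Form Ω}
    (h : (g, x) ∈ pairing (testAdjoint Ω κ₁ κ₂)) : x ∈ closedForms Ω κ₂ := by
  rw [mem_pairing_testAdjoint] at h
  intro j k φ hφ
  rw [h k _ (hφ.dz j), h j _ (hφ.dz k)]
  have : dz k (dz j φ) = dz j (dz k φ) := by
    ext z; exact dz_dz_comm (hφ.smooth.contDiffAt.of_le (by norm_cast))
  rw [this]

/-- The a priori estimate for the triple of weights `κ₁, κ₂, κ₃`, in weighted form. -/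
structure WeightedEstimate (Ω : Set (Cn n)) (κ₁ κ₂ κ₃ : Cn n → ℝ) (τ : ℝ) : Prop where
  norm_le : ∀ (v : L2Form Ω) h a, (v, h) ∈ pairing (testGraph Ω κ₁ κ₂) → DbarEq κ₂ κ₃ v a →
    τ * ‖v‖ ^ 2 ≤ 2 * ‖h‖ ^ 2 + 1 / 2 * ∑ j, ∑ k, ‖a j k‖ ^ 2
  dual_le : ∀ (v : L2Form Ω) h a, (v, h) ∈ pairing (testGraph Ω κ₁ κ₂) → DbarEq κ₂ κ₃ v a →
    ∀ T : Fin n → Fin n → Cn n → ℂ, (∀ j k, IsTestFunction Ω (T j k)) →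
      ‖∑ j, ∑ k, inner ℂ (toL2 Ω (fun z => -κ₂ z) (dz k (T j k))) (v j)‖ ^ 2
        ≤ (∑ j, ∑ k, ‖toL2 Ω (fun z => -κ₃ z) (T j k)‖ ^ 2)
          * (2 * ‖h‖ ^ 2 + 1 / 2 * ∑ j, ∑ k, ‖a j k‖ ^ 2)

theorem weightedEstimate_of_leviForm {η : Cn n → ℝ} {τ Λ : ℝ} {θ : ℕ → Cn n → ℝ}
    {φ : Cn n → ℝ} (hΩ : IsOpen Ω) (hφ : ContDiffOn ℝ ∞ φ Ω) (hη : ContDiffOn ℝ ∞ η Ω)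
    (hτ : 0 ≤ τ)
    (hess : ∀ z ∈ Ω, ∀ w, (2 * ∑ j, ‖dz j (fun z => (η z : ℂ)) z‖ ^ 2 + τ * Real.exp (η z))
      * ‖w‖ ^ 2 ≤ leviForm φ z w)
    (hθ : IsCutoffSeq Ω θ)
    (hgrad : ∀ ν, ∀ z ∈ Ω, ∑ j, ‖dz j (fun z => (θ ν z : ℂ)) z‖ ^ 2 ≤ Λ * Real.exp (η z)) :
    WeightedEstimate Ω (fun z => φ z - 2 * η z) (fun z => φ z - η z) φ τ := by
  have c3 : ContinuousOn φ Ω := hφ.continuousOn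
  have c2 : ContinuousOn (fun z => φ z - η z) Ω := c3.sub hη.continuousOn
  have c1 : ContinuousOn (fun z => φ z - 2 * η z) Ω := c3.sub (continuousOn_const.mul
    hη.continuousOn)
  have key : ∀ (v : L2Form Ω) h a, (v, h) ∈ pairing (testGraph Ω (fun z => φ z - 2 * η z)
      (fun z => φ z - η z)) → DbarEq (fun z => φ z - η z) φ v a → _ := fun v h a hp hd =>
    weighted_estimate (v := fun j => unweight (fun z => φ z - η z) (v j))
      (h := unweight (fun z => φ z - 2 * η z) h) (G := fun j k => unweight φ (a j k))
      hΩ hφ hη hτ hess hθ hgrad (fun j => memL2W_unweight hΩ c2 _) (memL2W_unweight hΩ c1 _)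
      (fun j k => memL2W_unweight hΩ c3 _)
      (by
        intro g hg
        rw [← inner_toL2_eq_unweight (memL2_exp_mul_test hΩ c1 hg),
          ← mem_pairing_testGraph.1 hp g hg]
        refine Finset.sum_congr rfl fun j _ => ?_
        rw [← inner_toL2_eq_unweight (memL2_exp_mul_test hΩ c2 (hg.dzbar j))])
      (by
        intro j k ψ hψ
        have := hd j k _ hψ.star
        have i : ∀ j k, Integrable (fun z => unweight (fun z => φ z - η z) (v k) z
            * dzbar j ψ z) (volume.restrict Ω) := fun j k =>
          integrable_unweight_mul hΩ c2 _ (hψ.dzbar j)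
        rw [inner_toL2_neg_eq_unweight (memL2_exp_mul_test hΩ c2.neg (hψ.star.dz j)),
          inner_toL2_neg_eq_unweight (memL2_exp_mul_test hΩ c2.neg (hψ.star.dz k)),
          inner_toL2_neg_eq_unweight (memL2_exp_mul_test hΩ c3.neg hψ.star)] at this
        simp only [dz_star, star_star] at this
        rw [integral_sub (i j k) (i k j), this])
  constructor
  · intro v h a hp hd
    have := (key v h a hp hd).1
    simp only [normSqW_unweight] at this
    rwa [PiLp.norm_sq_eq_of_L2]
  · intro v h a hp hd T hT
    have := (key v h a hp hd).2 (fun j k z => star (T j k z)) fun j k => (hT j k).star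
    simp only [normSqW_unweight] at this
    convert this using 2
    · refine congrArg (fun x : ℂ => ‖x‖) ?_
      refine Finset.sum_congr rfl fun j _ => Finset.sum_congr rfl fun k _ => ?_
      rw [inner_toL2_neg_eq_unweight (memL2_exp_mul_test hΩ c2.neg ((hT j k).dz k))]
      simp only [dzbar_star]
    · refine Finset.sum_congr rfl fun j _ => Finset.sum_congr rfl fun k _ => ?_
      refine (norm_toL2_sq (κ := fun z => -φ z) (memL2_exp_mul_test hΩ c3.neg (hT j k))).trans ?_
      simp [normSqW]

section

variable {τ : ℝ} (h : WeightedEstimate Ω κ₁ κ₂ κ₃ τ) (hτ : 0 < τ)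
include h hτ

theorem WeightedEstimate.norm_le_of_mem_closedForms (v : L2Form Ω) (k : L2Fun Ω)
    (hp : (v, k) ∈ pairing (testGraph Ω κ₁ κ₂)) (hv : v ∈ closedForms Ω κ₂) :
    ‖v‖ ≤ √(2 / τ) * ‖k‖ := by
  have := h.norm_le v k 0 hp fun i j φ hφ => by simp [hv i j φ hφ]
  simp at this
  refine (pow_le_pow_iff_left₀ (norm_nonneg _) (by positivity) two_ne_zero).1 ?_
  rw [mul_pow, Real.sq_sqrt (by positivity), div_mul_eq_mul_div, le_div_iff₀ hτ]
  linarith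

variable (hΩ : IsOpen Ω) (h₁ : ContinuousOn κ₁ Ω) (h₂ : ContinuousOn κ₂ Ω)
include hΩ h₁ h₂

theorem WeightedEstimate.exists_solution {x : L2Form Ω} (hx : x ∈ closedForms Ω κ₂) :
    ∃ g : L2Fun Ω, ‖g‖ ≤ √(2 / τ) * ‖x‖ ∧ (g, x) ∈ pairing (testAdjoint Ω κ₁ κ₂) :=
  exists_solution_of_estimate isClosed_closedForms (Real.sqrt_nonneg _)
    (testAdjoint_subset_pairing hΩ h₁ h₂) (testGraph_subset_closedForms hΩ h₂)
    (h.norm_le_of_mem_closedForms hτ) hx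

/-- Exchange the closed part k of `u` for the closed form r whose adjoint image is `B`. Written as u
+ (r − k), the result differs from `u` by a closed form and so keeps ∂̄u; written as r + (u − k), it
differs from r by something orthogonal to all closed forms, invisible to the adjoint. -/
theorem WeightedEstimate.exists_adjoint_solution {u : L2Form Ω} {a : Fin n → Fin n → L2Fun Ω}
    (hu : DbarEq κ₂ κ₃ u a) (b : L2Fun Ω) :
    ∃ (v : L2Form Ω) (B : L2Fun Ω), DbarEq κ₂ κ₃ v a ∧ ‖B‖ ≤ ‖b‖ ∧
      (b - B, 0) ∈ pairing (testAdjoint Ω κ₁ κ₂) ∧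
      ∀ g x, (g, x) ∈ pairing (testAdjoint Ω κ₁ κ₂) → inner ℂ x v = inner ℂ g B := by
  obtain ⟨B, r, hB, hbB, hr, hgx⟩ := exists_adjoint_solution_of_estimate isClosed_closedForms
    (Real.sqrt_nonneg _) (testAdjoint_subset_pairing hΩ h₁ h₂)
    (testGraph_subset_closedForms hΩ h₂) (fun _ _ => mem_closedForms_of_mem_pairing)
    (h.norm_le_of_mem_closedForms hτ) b
  have : CompleteSpace (closedForms Ω κ₂) := isClosed_closedForms.completeSpace_coe
  set k := (closedForms Ω κ₂).starProjection u
  have hk : r - k ∈ closedForms Ω κ₂ :=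
    Submodule.sub_mem _ hr (Submodule.starProjection_apply_mem _ u)
  refine ⟨u + (r - k), B, fun i j φ hφ => ?_, hB, hbB, fun g x hp => ?_⟩
  · rw [← hu i j φ hφ]
    simp only [PiLp.add_apply, inner_add_right, hk i j φ hφ]
    ring
  · rw [← hgx g x hp, show u + (r - k) = r + (u - k) by abel, inner_add_right,
      (closedForms Ω κ₂).inner_right_of_mem_orthogonal (mem_closedForms_of_mem_pairing hp)
        ((closedForms Ω κ₂).sub_starProjection_mem_orthogonal u), add_zero]

end

end Level

/-! ### Passage to the limit in the weights. -/

section Limit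

open Filter Topology

/-- Weights that dominate `κ₀` and agree with it eventually on every compact subset. -/
structure IsWeightSeq (Ω : Set (Cn n)) (κ₀ : Cn n → ℝ) (κ : ℕ → Cn n → ℝ) : Prop where
  continuousOn : ∀ m, ContinuousOn (κ m) Ω
  le : ∀ m, ∀ z ∈ Ω, κ₀ z ≤ κ m z
  eventually_eq : ∀ K, IsCompact K → K ⊆ Ω → ∀ᶠ m in atTop, ∀ z ∈ K, κ m z = κ₀ z

variable {Ω : Set (Cn n)} {κ₀ : Cn n → ℝ} {κ κ₁ κ₂ κ₃ : ℕ → Cn n → ℝ} {f g φ : Cn n → ℂ}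
  {U : Filter ℕ}

/-- Only the values of the weight on the compact support of `φ` matter, and these stabilise. Hence
weak convergence suffices to pass to the limit in distributional equations although the weights
vary. -/
theorem IsWeightSeq.eventually_toL2_eq (hκ : IsWeightSeq Ω κ₀ κ) (hφ : IsTestFunction Ω φ) :
    ∀ᶠ m in atTop, toL2 Ω (fun z => -κ m z) φ = toL2 Ω (fun z => -κ₀ z) φ := by
  filter_upwards [hκ.eventually_eq _ hφ.hasCompactSupport hφ.tsupport_subset] with m hm
  have : (fun z => ((Real.exp (-(-κ m z) / 2) : ℝ) : ℂ) * φ z)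
      = fun z => ((Real.exp (-(-κ₀ z) / 2) : ℝ) : ℂ) * φ z := by
    ext z
    by_cases hz : z ∈ tsupport φ
    · rw [hm z hz]
    · rw [image_eq_zero_of_notMem_tsupport hz, mul_zero, mul_zero]
  have key : ∀ F G : Cn n → ℂ, F = G → (open Classical in
      if h : MemL2 Ω F then MemLp.toLp F h else (0 : L2Fun Ω))
      = open Classical in if h : MemL2 Ω G then MemLp.toLp G h else 0 := by
    rintro F _ rfl; rfl
  exact key _ _ this

theorem IsWeightSeq.tendsto_inner_test (hκ : IsWeightSeq Ω κ₀ κ) (hφ : IsTestFunction Ω φ)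
    (hU : U ≤ atTop) {x : ℕ → L2Fun Ω} {y : L2Fun Ω}
    (hx : ∀ z, Tendsto (fun m => inner ℂ z (x m)) U (𝓝 (inner ℂ z y))) :
    Tendsto (fun m => inner ℂ (toL2 Ω (fun z => -κ m z) φ) (x m)) U
      (𝓝 (inner ℂ (toL2 Ω (fun z => -κ₀ z) φ) y)) := by
  refine (hx _).congr' ?_
  filter_upwards [hU (hκ.eventually_toL2_eq hφ)] with m hm
  rw [hm]

theorem tendsto_inner_apply {x : ℕ → L2Form Ω} {y : L2Form Ω}
    (hx : ∀ z, Tendsto (fun m => inner ℂ z (x m)) U (𝓝 (inner ℂ z y))) (j : Fin n)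
    (z : L2Fun Ω) : Tendsto (fun m => inner ℂ z (x m j)) U (𝓝 (inner ℂ z (y j))) := by
  have := hx (WithLp.toLp 2 (Pi.single j z))
  simpa only [inner_toLp_single] using this

section

variable (hΩ : IsOpen Ω) (h₀ : ∀ z ∈ Ω, 0 ≤ κ₀ z)
include hΩ h₀

theorem IsWeightSeq.memL2 (hκ : IsWeightSeq Ω κ₀ κ) (hf : MemL2 Ω f) (m : ℕ) :
    MemL2 Ω (fun z => (Real.exp (-κ m z / 2) : ℝ) * f z) :=
  memL2_exp_neg_mul hΩ (hκ.continuousOn m) (fun z hz => (h₀ z hz).trans (hκ.le m z hz)) hf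

theorem IsWeightSeq.norm_toL2_le (hκ : IsWeightSeq Ω κ₀ κ) (hc : ContinuousOn κ₀ Ω)
    (hf : MemL2 Ω f) (m : ℕ) :
    ‖toL2 Ω (κ m) f‖ ^ 2 ≤ ‖toL2 Ω κ₀ f‖ ^ 2 := by
  rw [norm_toL2_sq (hκ.memL2 hΩ h₀ hf m), norm_toL2_sq (memL2_exp_neg_mul hΩ hc h₀ hf)]
  have hi : ∀ κ : Cn n → ℝ, ContinuousOn κ Ω → (∀ z ∈ Ω, 0 ≤ κ z) →
      IntegrableOn (fun z => ‖f z‖ ^ 2 * Real.exp (-κ z)) Ω := fun κ h1 h2 => by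
    refine (integrable_normSq (memL2_exp_neg_mul hΩ h1 h2 hf)).congr (ae_of_all _ fun z => ?_)
    simp only [norm_mul, norm_real, Real.norm_eq_abs, Real.abs_exp, mul_pow]
    rw [← Real.exp_nat_mul, mul_comm]
    congr 2; push_cast; ring
  refine setIntegral_mono_on (hi _ (hκ.continuousOn m) fun z hz =>
    (h₀ z hz).trans (hκ.le m z hz)) (hi _ hc h₀) hΩ.measurableSet fun z hz => ?_
  gcongr
  exact hκ.le m z hz

/-- Dominated convergence: both weights are nonnegative, so the difference of the exponentials is at
most 1, and it is eventually zero at each point. -/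
theorem IsWeightSeq.tendsto_toL2 (hκ : IsWeightSeq Ω κ₀ κ) (hc : ContinuousOn κ₀ Ω)
    (hf : MemL2 Ω f) : Tendsto (fun m => toL2 Ω (κ m) f) atTop (𝓝 (toL2 Ω κ₀ f)) := by
  have m0 := memL2_exp_neg_mul hΩ hc h₀ hf
  have mm := hκ.memL2 hΩ h₀ hf
  rw [tendsto_iff_norm_sub_tendsto_zero]
  have e : ∀ m, ‖toL2 Ω (κ m) f - toL2 Ω κ₀ f‖ ^ 2
      = ∫ z in Ω, ‖((Real.exp (-κ m z / 2) : ℝ) : ℂ) * f z - (Real.exp (-κ₀ z / 2) : ℝ) * f z‖ ^ 2 := by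
    intro m
    rw [toL2, dif_pos (mm m), toL2, dif_pos m0]
    exact (congrArg (fun x => ‖x‖ ^ 2) (MemLp.toLp_sub (mm m) m0).symm).trans
      (norm_toLp_sq (MemLp.sub (mm m) m0))
  have hlim : Tendsto (fun m => ‖toL2 Ω (κ m) f - toL2 Ω κ₀ f‖ ^ 2) atTop (𝓝 (∫ z in Ω, 0)) := by
    simp only [e]
    refine tendsto_integral_of_dominated_convergence (fun z => ‖f z‖ ^ 2)
      (fun m => (MemLp.sub (mm m) m0).aestronglyMeasurable.norm.pow 2) (integrable_normSq hf)
      (fun m => ae_restrict_of_forall_mem hΩ.measurableSet fun z hz => ?_)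
      (ae_restrict_of_forall_mem hΩ.measurableSet fun z hz => ?_)
    · rw [Real.norm_of_nonneg (by positivity), ← sub_mul, norm_mul, mul_pow, ← ofReal_sub,
        norm_real]
      have h1 : |Real.exp (-κ m z / 2) - Real.exp (-κ₀ z / 2)| ≤ 1 := by
        have a1 : Real.exp (-κ m z / 2) ≤ 1 := Real.exp_le_one_iff.2
          (by linarith [h₀ z hz, hκ.le m z hz])
        have a2 : Real.exp (-κ₀ z / 2) ≤ 1 := Real.exp_le_one_iff.2 (by linarith [h₀ z hz])
        rw [abs_le]
        constructor <;> linarith [Real.exp_pos (-κ m z / 2), Real.exp_pos (-κ₀ z / 2)]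
      rw [Real.norm_eq_abs]
      have h2 := pow_le_one₀ (n := 2) (abs_nonneg _) h1
      nlinarith [sq_nonneg ‖f z‖]
    · refine tendsto_const_nhds.congr' ?_
      filter_upwards [hκ.eventually_eq {z} isCompact_singleton (by simpa using hz)] with m hm
      rw [hm z rfl]; simp
  rw [integral_zero] at hlim
  have := hlim.sqrt
  simpa only [Real.sqrt_sq (norm_nonneg _), Real.sqrt_zero] using this

end

theorem dbarEq_of_weak_limit (hU : U ≤ atTop) [U.NeBot] (hκ₂ : IsWeightSeq Ω κ₀ κ₂)
    (hκ₃ : IsWeightSeq Ω κ₀ κ₃) {v : ℕ → L2Form Ω} {w : L2Form Ω}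
    {a : ℕ → Fin n → Fin n → L2Fun Ω} {a₀ : Fin n → Fin n → L2Fun Ω}
    (hv : ∀ m, DbarEq (κ₂ m) (κ₃ m) (v m) (a m))
    (hw : ∀ z, Tendsto (fun m => inner ℂ z (v m)) U (𝓝 (inner ℂ z w)))
    (ha : ∀ j k z, Tendsto (fun m => inner ℂ z (a m j k)) U (𝓝 (inner ℂ z (a₀ j k)))) :
    DbarEq κ₀ κ₀ w a₀ := by
  intro j k φ hφ
  refine tendsto_nhds_unique ((hκ₂.tendsto_inner_test (hφ.dz j) hU (tendsto_inner_apply hw k)).sub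
    (hκ₂.tendsto_inner_test (hφ.dz k) hU (tendsto_inner_apply hw j))) ?_
  exact (hκ₃.tendsto_inner_test hφ hU (ha j k)).neg.congr fun m => (hv m j k φ hφ).symm

theorem mem_pairing_of_weak_limit (hU : U ≤ atTop) [U.NeBot] (hκ₁ : IsWeightSeq Ω κ₀ κ₁)
    (hκ₂ : IsWeightSeq Ω κ₀ κ₂) {g : ℕ → L2Fun Ω} {g₀ : L2Fun Ω} {x : ℕ → L2Form Ω}
    {x₀ : L2Form Ω} (h : ∀ m, (g m, x m) ∈ pairing (testAdjoint Ω (κ₁ m) (κ₂ m)))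
    (hg : ∀ z, Tendsto (fun m => inner ℂ z (g m)) U (𝓝 (inner ℂ z g₀)))
    (hx : ∀ z, Tendsto (fun m => inner ℂ z (x m)) U (𝓝 (inner ℂ z x₀))) :
    (g₀, x₀) ∈ pairing (testAdjoint Ω κ₀ κ₀) := by
  refine mem_pairing_testAdjoint.2 fun j φ hφ => ?_
  refine tendsto_nhds_unique (hκ₂.tendsto_inner_test hφ hU (tendsto_inner_apply hx j)) ?_
  exact (hκ₁.tendsto_inner_test (hφ.dz j) hU hg).neg.congr fun m =>
    (mem_pairing_testAdjoint.1 (h m) j φ hφ).symm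

theorem mem_pairing_of_isDbarFun {κ₁ κ₂ : Cn n → ℝ} (hΩ : IsOpen Ω) (h₁ : ContinuousOn κ₁ Ω)
    (h₂ : ContinuousOn κ₂ Ω) (h₁' : ∀ z ∈ Ω, 0 ≤ κ₁ z) (h₂' : ∀ z ∈ Ω, 0 ≤ κ₂ z)
    {w : Fin n → Cn n → ℂ} (h : IsDbarFun Ω g w) :
    (toL2 Ω κ₁ g, WithLp.toLp 2 fun j => toL2 Ω κ₂ (w j)) ∈ pairing (testAdjoint Ω κ₁ κ₂) := by
  refine mem_pairing_testAdjoint.2 fun j φ hφ => ?_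
  rw [inner_toL2_neg (memL2_exp_mul_test hΩ h₂.neg hφ)
    (memL2_exp_neg_mul hΩ h₂ h₂' (h.memL2_dbar j)),
    inner_toL2_neg (memL2_exp_mul_test hΩ h₁.neg (hφ.dz j))
    (memL2_exp_neg_mul hΩ h₁ h₁' h.memL2)]
  have := h.weak j _ hφ.star
  simp only [dzbar_star] at this
  rw [this, neg_neg]

theorem isDbarFun_of_mem_pairing {κ₁ κ₂ : Cn n → ℝ} (hΩ : IsOpen Ω) (h₁ : ContinuousOn κ₁ Ω)
    (h₂ : ContinuousOn κ₂ Ω) {M : ℝ} (h₁' : ∀ z ∈ Ω, κ₁ z ≤ M) (h₂' : ∀ z ∈ Ω, κ₂ z ≤ M)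
    {g : L2Fun Ω} {x : L2Form Ω} (h : (g, x) ∈ pairing (testAdjoint Ω κ₁ κ₂)) :
    IsDbarFun Ω (unweight κ₁ g) (fun j => unweight κ₂ (x j)) := by
  refine ⟨memL2_unweight hΩ h₁ h₁' g, fun j => memL2_unweight hΩ h₂ h₂' _, fun j φ hφ => ?_⟩
  have := mem_pairing_testAdjoint.1 h j _ hφ.star
  rw [inner_toL2_neg_eq_unweight (memL2_exp_mul_test hΩ h₁.neg (hφ.star.dz j)),
    inner_toL2_neg_eq_unweight (memL2_exp_mul_test hΩ h₂.neg hφ.star)] at this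
  simp only [dz_star, star_star] at this
  rw [this, neg_neg]

theorem dbarEq_of_weakDbar {κ₂ κ₃ : Cn n → ℝ} (hΩ : IsOpen Ω) (h₂ : ContinuousOn κ₂ Ω)
    (h₃ : ContinuousOn κ₃ Ω) (h₂' : ∀ z ∈ Ω, 0 ≤ κ₂ z) (h₃' : ∀ z ∈ Ω, 0 ≤ κ₃ z)
    {u : Fin n → Cn n → ℂ} {G : Fin n → Fin n → Cn n → ℂ} (hu : ∀ j, MemL2 Ω (u j))
    (hG : ∀ j k, MemL2 Ω (G j k)) (h : WeakDbar Ω u G) :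
    DbarEq κ₂ κ₃ (WithLp.toLp 2 fun j => toL2 Ω κ₂ (u j)) fun j k => toL2 Ω κ₃ (G j k) := by
  intro j k φ hφ
  have hm : ∀ j, MemL2 Ω (fun z => (Real.exp (-κ₂ z / 2) : ℝ) * u j z) := fun j =>
    memL2_exp_neg_mul hΩ h₂ h₂' (hu j)
  have ht : ∀ j, MemLp (fun z => dz j φ z) 2 (volume.restrict Ω) := fun j =>
    (memLp_of_hasCompactSupport (hφ.dz j).smooth.continuous (hφ.dz j).hasCompactSupport).restrict _
  have := h j k _ hφ.star
  simp only [dzbar_star] at this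
  rw [integral_sub (integrable_mul_star (hu k) (ht j)) (integrable_mul_star (hu j) (ht k))] at this
  rw [inner_toL2_neg (memL2_exp_mul_test hΩ h₃.neg hφ) (memL2_exp_neg_mul hΩ h₃ h₃' (hG j k)),
    ← this]
  congr 1
  · exact inner_toL2_neg (memL2_exp_mul_test hΩ h₂.neg (hφ.dz j)) (hm k)
  · exact inner_toL2_neg (memL2_exp_mul_test hΩ h₂.neg (hφ.dz k)) (hm j)

-- The estimate is not applied to `u`, which need not lie in the adjoint domain for the weights of
-- level m. At each level a form with the same ∂̄ and with adjoint `B m`, the admissible part of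
-- `b`, is constructed instead; it obeys the estimate with right-hand side at most S. A weak limit
-- inherits the bounds, and the proof then shows that this limit is `u`. The bound M on κ₀ ensures
-- that elements of the limiting weighted space are honest L² functions, to which the adjoint
-- relation of `u` applies.
set_option maxHeartbeats 400000 in
theorem limit_estimate {τ M : ℝ} (hτ : 0 < τ) (hΩ : IsOpen Ω) (hc : ContinuousOn κ₀ Ω)
    (h₀ : ∀ z ∈ Ω, 0 ≤ κ₀ z) (hM : ∀ z ∈ Ω, κ₀ z ≤ M) (hκ₁ : IsWeightSeq Ω κ₀ κ₁)
    (hκ₂ : IsWeightSeq Ω κ₀ κ₂) (hκ₃ : IsWeightSeq Ω κ₀ κ₃)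
    (hE : ∀ m, WeightedEstimate Ω (κ₁ m) (κ₂ m) (κ₃ m) τ)
    {u : Fin n → Cn n → ℂ} {G : Fin n → Fin n → Cn n → ℂ} {b : Cn n → ℂ}
    (hu : ∀ j, MemL2 Ω (u j)) (hG : ∀ j k, MemL2 Ω (G j k)) (hb : MemL2 Ω b)
    (hGw : WeakDbar Ω u G)
    (hadj : ∀ g w, IsDbarFun Ω g w → ∑ j, ∫ z in Ω, u j z * star (w j z) * (Real.exp (-κ₀ z) : ℝ)
      = ∫ z in Ω, b z * star (g z) * (Real.exp (-κ₀ z) : ℝ)) :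
    τ * ∑ j, normSqW Ω κ₀ (u j)
      ≤ 2 * normSqW Ω κ₀ b + 1 / 2 * ∑ j, ∑ k, normSqW Ω κ₀ (G j k) ∧
    ∀ T : Fin n → Fin n → Cn n → ℂ, (∀ j k, IsTestFunction Ω (T j k)) →
      ‖∑ j, ∑ k, ∫ z in Ω, u j z * star (dz k (T j k) z)‖ ^ 2
        ≤ (∑ j, ∑ k, normSqW Ω (fun z => -κ₀ z) (T j k))
          * (2 * normSqW Ω κ₀ b + 1 / 2 * ∑ j, ∑ k, normSqW Ω κ₀ (G j k)) := by
  have w0 : ∀ {κ : ℕ → Cn n → ℝ}, IsWeightSeq Ω κ₀ κ → ∀ m, ∀ z ∈ Ω, 0 ≤ κ m z :=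
    fun hκ m z hz => (h₀ z hz).trans (hκ.le m z hz)
  have mb := memL2_exp_neg_mul hΩ hc h₀ hb
  have mu := fun j => memL2_exp_neg_mul hΩ hc h₀ (hu j)
  have mG := fun j k => memL2_exp_neg_mul hΩ hc h₀ (hG j k)
  set b₀ : L2Fun Ω := toL2 Ω κ₀ b with hb₀
  set u₀ : L2Form Ω := WithLp.toLp 2 fun j => toL2 Ω κ₀ (u j) with hu₀
  set S : ℝ := 2 * ‖b₀‖ ^ 2 + 1 / 2 * ∑ j, ∑ k, ‖toL2 Ω κ₀ (G j k)‖ ^ 2 with hS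
  have hadj' : ∀ g w, IsDbarFun Ω g w →
      inner ℂ (WithLp.toLp 2 fun j => toL2 Ω κ₀ (w j) : L2Form Ω) u₀
        = inner ℂ (toL2 Ω κ₀ g) b₀ := by
    intro g w hgw
    have hg := memL2_exp_neg_mul hΩ hc h₀ hgw.memL2
    have hw := fun j => memL2_exp_neg_mul hΩ hc h₀ (hgw.memL2_dbar j)
    have e : ∀ f g : Cn n → ℂ, ∫ z in Ω, g z * star (f z) * (Real.exp (-(κ₀ z + κ₀ z) / 2) : ℝ)
        = ∫ z in Ω, g z * star (f z) * (Real.exp (-κ₀ z) : ℝ) := fun f g => by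
      congr 1; ext z; congr 3; ring
    rw [PiLp.inner_apply, hb₀, inner_toL2_toL2 hg mb, e, ← hadj g w hgw]
    refine Finset.sum_congr rfl fun j _ => ?_
    rw [hu₀, inner_toL2_toL2 (hw j) (mu j), e]
  have hsol : ∀ m, ∃ (v : L2Form Ω) (B : L2Fun Ω),
      DbarEq (κ₂ m) (κ₃ m) v (fun j k => toL2 Ω (κ₃ m) (G j k)) ∧ ‖B‖ ≤ ‖toL2 Ω (κ₁ m) b‖ ∧
      (toL2 Ω (κ₁ m) b - B, 0) ∈ pairing (testAdjoint Ω (κ₁ m) (κ₂ m)) ∧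
      ∀ g x, (g, x) ∈ pairing (testAdjoint Ω (κ₁ m) (κ₂ m)) → inner ℂ x v = inner ℂ g B :=
    fun m => (hE m).exists_adjoint_solution hτ hΩ (hκ₁.continuousOn m) (hκ₂.continuousOn m)
      (dbarEq_of_weakDbar hΩ (hκ₂.continuousOn m) (hκ₃.continuousOn m) (w0 hκ₂ m) (w0 hκ₃ m)
        hu hG hGw) _
  choose v B hv hB hbB hvB using hsol
  have hBb : ∀ m, ‖B m‖ ^ 2 ≤ ‖b₀‖ ^ 2 := fun m =>
    (pow_le_pow_left₀ (norm_nonneg _) (hB m) 2).trans (hκ₁.norm_toL2_le hΩ h₀ hc hb m)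
  have hpg : ∀ m, (v m, B m) ∈ pairing (testGraph Ω (κ₁ m) (κ₂ m)) := fun m =>
    mem_pairing_testGraph.2 fun g hg => by
      have := hvB m _ _ (testGraph_mem_pairing hΩ (hκ₁.continuousOn m) (hκ₂.continuousOn m) hg)
      rwa [PiLp.inner_apply] at this
  have hSm : ∀ m, 2 * ‖B m‖ ^ 2 + 1 / 2 * ∑ j, ∑ k, ‖toL2 Ω (κ₃ m) (G j k)‖ ^ 2 ≤ S := by
    intro m
    have := hBb m
    have h2 : ∑ j, ∑ k, ‖toL2 Ω (κ₃ m) (G j k)‖ ^ 2 ≤ ∑ j, ∑ k, ‖toL2 Ω κ₀ (G j k)‖ ^ 2 :=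
      Finset.sum_le_sum fun j _ => Finset.sum_le_sum fun k _ =>
        hκ₃.norm_toL2_le hΩ h₀ hc (hG j k) m
    rw [hS]; linarith
  have hvS : ∀ m, ‖v m‖ ^ 2 ≤ S / τ := fun m => by
    rw [le_div_iff₀ hτ, mul_comm]
    exact ((hE m).norm_le _ _ _ (hpg m) (hv m)).trans (hSm m)
  -- A free ultrafilter gives weak limits of all bounded sequences at once, without extracting
  -- subsequences.
  let U : Ultrafilter ℕ := hyperfilter ℕ
  have hU : (U : Filter ℕ) ≤ atTop := Nat.hyperfilter_le_atTop
  have bv : ∀ m, ‖v m‖ ≤ √(S / τ) := fun m => Real.le_sqrt_of_sq_le (hvS m)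
  have bB : ∀ m, ‖B m‖ ≤ ‖b₀‖ := fun m =>
    (pow_le_pow_iff_left₀ (norm_nonneg _) (norm_nonneg _) two_ne_zero).1 (hBb m)
  obtain ⟨v₀, hv₀⟩ := exists_weak_limit U bv
  obtain ⟨B₀, hB₀⟩ := exists_weak_limit U bB
  have strong : ∀ {κ : ℕ → Cn n → ℝ} {f : Cn n → ℂ}, IsWeightSeq Ω κ₀ κ → MemL2 Ω f →
      Tendsto (fun m => toL2 Ω (κ m) f) U (𝓝 (toL2 Ω κ₀ f)) := fun hκ hf =>
    (hκ.tendsto_toL2 hΩ h₀ hc hf).mono_left hU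
  have strongF : ∀ {κ : ℕ → Cn n → ℝ} {w : Fin n → Cn n → ℂ}, IsWeightSeq Ω κ₀ κ →
      (∀ j, MemL2 Ω (w j)) → Tendsto (fun m => (WithLp.toLp 2 fun j => toL2 Ω (κ m) (w j) :
        L2Form Ω)) U (𝓝 (WithLp.toLp 2 fun j => toL2 Ω κ₀ (w j))) := fun hκ hw =>
    ((PiLp.continuous_toLp 2 _).tendsto _).comp (tendsto_pi_nhds.2 fun j => strong hκ (hw j))
  have hlimE : DbarEq κ₀ κ₀ v₀ fun j k => toL2 Ω κ₀ (G j k) :=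
    dbarEq_of_weak_limit hU hκ₂ hκ₃ hv hv₀ fun j k z =>
      tendsto_const_nhds.inner (strong hκ₃ (hG j k))
  have hker : (b₀ - B₀, 0) ∈ pairing (testAdjoint Ω κ₀ κ₀) := by
    refine mem_pairing_of_weak_limit hU hκ₁ hκ₂ hbB (fun z => ?_) fun z => tendsto_const_nhds
    simp only [inner_sub_right]
    exact (tendsto_const_nhds.inner (strong hκ₁ hb)).sub (hB₀ z)
  have hvB₀ : ∀ g w, IsDbarFun Ω g w →
      inner ℂ (WithLp.toLp 2 fun j => toL2 Ω κ₀ (w j) : L2Form Ω) v₀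
        = inner ℂ (toL2 Ω κ₀ g) B₀ := by
    intro g w hgw
    refine tendsto_nhds_unique (tendsto_inner_of_weak bv hv₀ (strongF hκ₂ hgw.memL2_dbar)) ?_
    refine (tendsto_inner_of_weak bB hB₀ (strong hκ₁ hgw.memL2)).congr fun m => ?_
    exact (hvB m _ _ (mem_pairing_of_isDbarFun hΩ (hκ₁.continuousOn m) (hκ₂.continuousOn m)
      (w0 hκ₁ m) (w0 hκ₂ m) hgw)).symm
  -- The difference has ∂̄ equal to zero. Testing the adjoint relations of `u₀` and `v₀` against it
  -- shows that it is orthogonal both to `b₀` and to `B₀`, hence to itself.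
  have hBeq : b₀ - B₀ = 0 := by
    have h1 := isDbarFun_of_mem_pairing hΩ hc hc hM hM hker
    have h2 := hadj' _ _ h1
    have h3 := hvB₀ _ _ h1
    have h4 : (WithLp.toLp 2 fun j => toL2 Ω κ₀ (unweight κ₀ ((0 : L2Form Ω) j)) : L2Form Ω)
        = 0 := by
      ext1 j; simp [toL2_unweight]
    rw [h4, inner_zero_left, toL2_unweight] at h2 h3
    rw [← inner_self_eq_zero (𝕜 := ℂ), inner_sub_right, ← h2, ← h3, sub_zero]
  -- `y` is closed, and its adjoint is b₀ − B₀ = 0. Solving the ∂̄-equation for `y` at every level,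
  -- with uniform bounds, and passing to the weak limit gives y = ∂̄g₀, whence ⟨y, y⟩ = ⟨g₀, b₀ −
  -- B₀⟩ = 0.
  set y : L2Form Ω := u₀ - v₀ with hy
  have hyc : y ∈ closedForms Ω κ₀ := by
    intro j k φ hφ
    have h1 := dbarEq_of_weakDbar hΩ hc hc h₀ h₀ hu hG hGw j k φ hφ
    have h2 := hlimE j k φ hφ
    simp only [hy, PiLp.sub_apply, inner_sub_right]
    rw [← h2] at h1
    linear_combination h1
  have hyf : ∀ j, MemL2 Ω (unweight κ₀ (y j)) := fun j => memL2_unweight hΩ hc hM _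
  have hY0 : (WithLp.toLp 2 fun j => toL2 Ω κ₀ (unweight κ₀ (y j)) : L2Form Ω) = y := by
    ext1 j; simp [toL2_unweight]
  have hxm : ∀ m, (WithLp.toLp 2 fun j => toL2 Ω (κ₂ m) (unweight κ₀ (y j)) : L2Form Ω)
      ∈ closedForms Ω (κ₂ m) := by
    intro m j k φ hφ
    have h1 := hyc j k φ hφ
    rw [inner_toL2_neg_eq_unweight (memL2_exp_mul_test hΩ hc.neg (hφ.dz j)),
      inner_toL2_neg_eq_unweight (memL2_exp_mul_test hΩ hc.neg (hφ.dz k))] at h1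
    have hc2 := hκ₂.continuousOn m
    have e : ∀ j k, inner ℂ (toL2 Ω (fun z => -κ₂ m z) (dz j φ))
        (toL2 Ω (κ₂ m) (unweight κ₀ (y k))) = _ := fun j k =>
      inner_toL2_neg (memL2_exp_mul_test hΩ hc2.neg (hφ.dz j)) (hκ₂.memL2 hΩ h₀ (hyf k) m)
    exact (e j k).trans (h1.trans (e k j).symm)
  have hgm := fun m => (hE m).exists_solution hτ hΩ (hκ₁.continuousOn m) (hκ₂.continuousOn m)
    (hxm m)
  choose gm hgm hgmx using hgm
  have hgb : ∀ m, ‖gm m‖ ≤ √(2 / τ) * ‖y‖ := by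
    intro m
    refine (hgm m).trans (mul_le_mul_of_nonneg_left ?_ (Real.sqrt_nonneg _))
    refine (pow_le_pow_iff_left₀ (norm_nonneg _) (norm_nonneg _) two_ne_zero).1 ?_
    conv_rhs => rw [← hY0]
    rw [PiLp.norm_sq_eq_of_L2, PiLp.norm_sq_eq_of_L2]
    exact Finset.sum_le_sum fun j _ => hκ₂.norm_toL2_le hΩ h₀ hc (hyf j) m
  obtain ⟨g₀, hg₀⟩ := exists_weak_limit U hgb
  have hgy : (g₀, y) ∈ pairing (testAdjoint Ω κ₀ κ₀) :=
    mem_pairing_of_weak_limit hU hκ₁ hκ₂ hgmx hg₀ fun z => by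
      have h := strongF hκ₂ hyf
      rw [hY0] at h
      exact tendsto_const_nhds.inner h
  have hy0 : y = 0 := by
    have h1 := isDbarFun_of_mem_pairing hΩ hc hc hM hM hgy
    have h2 := hadj' _ _ h1
    have h3 := hvB₀ _ _ h1
    rw [hY0] at h2 h3
    rw [← inner_self_eq_zero (𝕜 := ℂ)]
    conv_lhs => rw [show inner ℂ y y = inner ℂ y (u₀ - v₀) from rfl]
    rw [inner_sub_right, h2, h3, ← inner_sub_right, hBeq, inner_zero_right]
  have huv : u₀ = v₀ := sub_eq_zero.1 hy0
  have hS' : S = 2 * normSqW Ω κ₀ b + 1 / 2 * ∑ j, ∑ k, normSqW Ω κ₀ (G j k) := by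
    rw [hS, hb₀, norm_toL2_sq mb]
    simp only [norm_toL2_sq (mG _ _)]
  rw [← hS']
  refine ⟨?_, fun T hT => ?_⟩
  · have h1 : ‖v₀‖ ^ 2 ≤ S / τ := norm_sq_le_of_weak hvS hv₀
    rw [← huv, hu₀, PiLp.norm_sq_eq_of_L2, le_div_iff₀ hτ, mul_comm] at h1
    simpa only [norm_toL2_sq (mu _)] using h1
  · have h1 : ∀ m, _ := fun m => ((hE m).dual_le _ _ _ (hpg m) (hv m) T hT).trans
      (mul_le_mul_of_nonneg_left (hSm m) (by positivity))
    have h2 : Tendsto (fun m => ‖∑ j, ∑ k, inner ℂ (toL2 Ω (fun z => -κ₂ m z) (dz k (T j k)))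
        (v m j)‖ ^ 2) U (𝓝 (‖∑ j, ∑ k, inner ℂ (toL2 Ω (fun z => -κ₀ z) (dz k (T j k)))
        (v₀ j)‖ ^ 2)) :=
      (tendsto_finsetSum _ fun j _ => tendsto_finsetSum _ fun k _ =>
        hκ₂.tendsto_inner_test ((hT j k).dz k) hU (tendsto_inner_apply hv₀ j)).norm.pow 2
    have h3 : Tendsto (fun m => (∑ j, ∑ k, ‖toL2 Ω (fun z => -κ₃ m z) (T j k)‖ ^ 2) * S) U
        (𝓝 ((∑ j, ∑ k, ‖toL2 Ω (fun z => -κ₀ z) (T j k)‖ ^ 2) * S)) := by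
      refine (tendsto_finsetSum _ fun j _ => tendsto_finsetSum _ fun k _ => ?_).mul_const S
      refine tendsto_const_nhds.congr' ?_
      filter_upwards [hU (hκ₃.eventually_toL2_eq (hT j k))] with m hm
      rw [hm]
    have h4 := le_of_tendsto_of_tendsto' h2 h3 h1
    rw [← huv, hu₀] at h4
    have e1 : ∀ j k, inner ℂ (toL2 Ω (fun z => -κ₀ z) (dz k (T j k))) (toL2 Ω κ₀ (u j))
        = ∫ z in Ω, u j z * star (dz k (T j k) z) := fun j k =>
      inner_toL2_neg (memL2_exp_mul_test hΩ hc.neg ((hT j k).dz k)) (mu j)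
    have e2 : ∀ j k, ‖toL2 Ω (fun z => -κ₀ z) (T j k)‖ ^ 2
        = normSqW Ω (fun z => -κ₀ z) (T j k) := fun j k =>
      norm_toL2_sq (memL2_exp_mul_test hΩ hc.neg (hT j k))
    simpa only [e1, e2] using h4

end Limit

/-! ### Calculus of the Levi form. -/

section Geometry

open Filter Topology

/-- The pairing `∑_j ∂ψ/∂z_j(z) w_j` of `∂ψ` with a vector. -/
def delPairing (ψ : Cn n → ℝ) (z w : Cn n) : ℂ :=
  ∑ j, dz j (fun z => (ψ z : ℂ)) z * w j

variable {ψ χ r : Cn n → ℝ} {Ω : Set (Cn n)} {z w p : Cn n}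

theorem contDiffAt_ofReal {l : WithTop ℕ∞} (h : ContDiffAt ℝ l ψ z) :
    ContDiffAt ℝ l (fun z => (ψ z : ℂ)) z :=
  Complex.ofRealCLM.contDiff.contDiffAt.comp z h

theorem leviForm_comp {F : ℝ → ℝ} (hF : ContDiffAt ℝ 2 F (ψ z)) (hψ : ContDiffAt ℝ 2 ψ z) :
    leviForm (fun z => F (ψ z)) z w
      = deriv F (ψ z) * leviForm ψ z w + deriv (deriv F) (ψ z) * ‖delPairing ψ z w‖ ^ 2 := by
  have hF' : ContDiffAt ℝ 1 (deriv F) (ψ z) := by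
    have := (hF.fderiv_right (m := 1) (by norm_num)).clm_apply (contDiffAt_const (c := (1 : ℝ)))
    simpa only [fderiv_apply_one_eq_deriv] using this
  have h1 : ∀ k, dzbar k (fun z => ((F (ψ z) : ℝ) : ℂ)) =ᶠ[𝓝 z]
      fun z => ((deriv F (ψ z) : ℝ) : ℂ) * dzbar k (fun z => (ψ z : ℂ)) z := by
    intro k
    have e1 : ∀ᶠ x in 𝓝 z, DifferentiableAt ℝ F (ψ x) := hψ.continuousAt.eventually
      ((hF.eventually (by simp)).mono fun x hx => hx.differentiableAt (by norm_num))
    have e2 : ∀ᶠ x in 𝓝 z, DifferentiableAt ℝ ψ x :=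
      (hψ.eventually (by simp)).mono fun x hx => hx.differentiableAt (by norm_num)
    filter_upwards [e1, e2] with x hx1 hx2
    exact dzbar_comp hx1 hx2
  have h2 : ∀ j k, dz j (dzbar k (fun z => ((F (ψ z) : ℝ) : ℂ))) z
      = ((deriv (deriv F) (ψ z) : ℝ) : ℂ) * dz j (fun z => (ψ z : ℂ)) z
          * star (dz k (fun z => (ψ z : ℂ)) z)
        + ((deriv F (ψ z) : ℝ) : ℂ) * dz j (dzbar k (fun z => (ψ z : ℂ))) z := by
    intro j k
    have d1 : DifferentiableAt ℝ (fun z => ((deriv F (ψ z) : ℝ) : ℂ)) z :=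
      (contDiffAt_ofReal (hF'.comp z (hψ.of_le (by norm_num)))).differentiableAt (by norm_num)
    have d2 : DifferentiableAt ℝ (dzbar k (fun z => (ψ z : ℂ))) z :=
      (ContDiffAt.dzbar (m := 1) (contDiffAt_ofReal hψ) (by norm_num)).differentiableAt
        (by norm_num)
    rw [dz_congr (h1 k), dz_mul d1 d2, dz_comp (hF'.differentiableAt (by norm_num))
      (hψ.differentiableAt (by norm_num)), dzbar_ofReal]
  have h3 : ∑ j, ∑ k, dz j (dzbar k (fun z => ((F (ψ z) : ℝ) : ℂ))) z * w j * star (w k)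
      = ((deriv F (ψ z) : ℝ) : ℂ) * (∑ j, ∑ k, dz j (dzbar k (fun z => (ψ z : ℂ))) z * w j * star (w k))
        + ((deriv (deriv F) (ψ z) : ℝ) : ℂ) * (delPairing ψ z w * star (delPairing ψ z w)) := by
    rw [delPairing, star_sum, Finset.sum_mul_sum]
    simp only [Finset.mul_sum, ← Finset.sum_add_distrib]
    refine Finset.sum_congr rfl fun j _ => Finset.sum_congr rfl fun k _ => ?_
    rw [h2, star_mul']
    ring
  simp only [leviForm]
  rw [h3, add_re, re_ofReal_mul, star_def, mul_conj, re_ofReal_mul, ofReal_re,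
    Complex.normSq_eq_norm_sq]

theorem leviForm_add (hψ : ContDiffAt ℝ 2 ψ z) (hχ : ContDiffAt ℝ 2 χ z) :
    leviForm (fun z => ψ z + χ z) z w = leviForm ψ z w + leviForm χ z w := by
  have h1 : ∀ k, dzbar k (fun z => ((ψ z + χ z : ℝ) : ℂ)) =ᶠ[𝓝 z]
      fun z => dzbar k (fun z => (ψ z : ℂ)) z + dzbar k (fun z => (χ z : ℂ)) z := by
    intro k
    filter_upwards [hψ.eventually (by simp), hχ.eventually (by simp)] with x hx1 hx2
    simp only [ofReal_add]
    exact dzbar_add ((contDiffAt_ofReal hx1).differentiableAt (by norm_num))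
      ((contDiffAt_ofReal hx2).differentiableAt (by norm_num))
  have d : ∀ {ψ : Cn n → ℝ} (k : Fin n), ContDiffAt ℝ 2 ψ z →
      DifferentiableAt ℝ (dzbar k (fun z => (ψ z : ℂ))) z := fun k h =>
    (ContDiffAt.dzbar (m := 1) (contDiffAt_ofReal h) (by norm_num)).differentiableAt (by norm_num)
  simp only [leviForm]
  rw [← add_re, ← Finset.sum_add_distrib]
  congr 1
  refine Finset.sum_congr rfl fun j _ => ?_
  rw [← Finset.sum_add_distrib]
  refine Finset.sum_congr rfl fun k _ => ?_
  rw [dz_congr (h1 k), dz_add (d k hψ) (d k hχ)]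
  ring

theorem fderiv_apply_coord (j : Fin n) (z v : Cn n) :
    fderiv ℝ (fun z : Cn n => z j) z v = v j := by
  have : HasFDerivAt (fun z : Cn n => z j)
    ((EuclideanSpace.proj j : Cn n →L[ℂ] ℂ).restrictScalars ℝ) z :=
    ((EuclideanSpace.proj j : Cn n →L[ℂ] ℂ).restrictScalars ℝ).hasFDerivAt
  rw [this.fderiv]; rfl

theorem differentiableAt_coord (j : Fin n) (z : Cn n) :
    DifferentiableAt ℝ (fun z : Cn n => z j) z :=
  ((EuclideanSpace.proj j : Cn n →L[ℂ] ℂ).restrictScalars ℝ).differentiableAt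

theorem dz_coord (j k : Fin n) (z : Cn n) : dz j (fun z => z k) z = if j = k then 1 else 0 := by
  simp only [dz, fderiv_apply_coord]
  by_cases h : j = k
  · subst h; simp; norm_num
  · simp [h, Ne.symm h]

theorem dzbar_coord (j k : Fin n) (z : Cn n) : dzbar j (fun z => z k) z = 0 := by
  simp only [dzbar, fderiv_apply_coord]
  by_cases h : j = k
  · subst h; simp
  · simp [Ne.symm h]

theorem ofReal_norm_sq (c : ℝ) (z : Cn n) :
    ((c * ‖z‖ ^ 2 : ℝ) : ℂ) = ∑ j, (c : ℂ) * (z j * star (z j)) := by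
  rw [EuclideanSpace.norm_sq_eq, ← Finset.mul_sum]
  push_cast
  congr 1
  refine Finset.sum_congr rfl fun j _ => ?_
  rw [star_def, mul_conj, Complex.normSq_eq_norm_sq]; norm_cast

theorem dzbar_norm_sq (c : ℝ) (k : Fin n) (z : Cn n) :
    dzbar k (fun z => ((c * ‖z‖ ^ 2 : ℝ) : ℂ)) z = c * z k := by
  have hd : ∀ j : Fin n, DifferentiableAt ℝ (fun z : Cn n => z j) z := fun j =>
    differentiableAt_coord j z
  have hs : ∀ j : Fin n, DifferentiableAt ℝ (fun z : Cn n => star (z j)) z := fun j => (hd j).star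
  have e : ∀ j, dzbar k (fun z => (c : ℂ) * (z j * star (z j))) z = if k = j then c * z j else 0 := by
    intro j
    rw [dzbar_const_mul (f := fun z : Cn n => z j * star (z j)) _ ((hd j).mul (hs j)), dzbar_mul (hd j) (hs j), dzbar_coord, dzbar_star,
      dz_coord]
    split_ifs <;> simp
  simp only [ofReal_norm_sq]
  have : dzbar k (fun z : Cn n => ∑ j, (c : ℂ) * (z j * star (z j))) z
      = ∑ j, dzbar k (fun z => (c : ℂ) * (z j * star (z j))) z := by
    have hh : ∀ j ∈ Finset.univ, DifferentiableAt ℝ (fun z : Cn n => (c : ℂ) * (z j * star (z j))) z :=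
      fun j _ => ((hd j).mul (hs j)).const_mul _
    simp only [dzbar, fderiv_fun_sum hh, sum_apply, Finset.mul_sum, mul_add,
      Finset.sum_add_distrib]
  rw [this]
  simp only [e]
  simp

theorem dz_norm_sq (c : ℝ) (k : Fin n) (z : Cn n) :
    dz k (fun z => ((c * ‖z‖ ^ 2 : ℝ) : ℂ)) z = c * star (z k) := by
  have := dzbar_norm_sq c k z
  rw [dzbar_ofReal] at this
  rw [← star_star (dz _ _ _), this]; simp

theorem leviForm_norm_sq (c : ℝ) (z w : Cn n) :
    leviForm (fun z => c * ‖z‖ ^ 2) z w = c * ‖w‖ ^ 2 := by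
  have h : ∀ j k, dz j (dzbar k (fun z : Cn n => ((c * ‖z‖ ^ 2 : ℝ) : ℂ))) z
      = if j = k then (c : ℂ) else 0 := by
    intro j k
    have : dzbar k (fun z : Cn n => ((c * ‖z‖ ^ 2 : ℝ) : ℂ)) = fun z => (c : ℂ) * z k := by
      ext z; exact dzbar_norm_sq c k z
    rw [this, dz_const_mul _ (differentiableAt_coord k z), dz_coord]
    simp
  simp only [leviForm, h]
  have : ∑ j, ∑ k, (if j = k then (c : ℂ) else 0) * w j * star (w k) = ((c * ‖w‖ ^ 2 : ℝ) : ℂ) := by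
    rw [ofReal_norm_sq]
    refine Finset.sum_congr rfl fun j _ => ?_
    simp; ring
  rw [this, ofReal_re]

theorem contDiff_leviForm (hr : ContDiff ℝ ∞ r) :
    ContDiff ℝ ∞ (fun x : Cn n × Cn n => leviForm r x.1 x.2) := by
  have hc : ∀ j : Fin n, ContDiff ℝ ∞ (fun x : Cn n × Cn n => x.2 j) := fun j =>
    ((EuclideanSpace.proj j : Cn n →L[ℂ] ℂ).restrictScalars ℝ).contDiff.comp contDiff_snd
  refine Complex.reCLM.contDiff.comp (ContDiff.sum fun j _ => ContDiff.sum fun k _ => ?_)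
  refine ContDiff.mul (ContDiff.mul ?_ (hc j)) ((starL' ℝ (A := ℂ)).contDiff.comp (hc k))
  exact (((contDiff_ofReal hr).dzbar (m := ∞) (by simp)).dz (m := ∞) (by simp)).comp contDiff_fst

theorem contDiff_delPairing (hr : ContDiff ℝ ∞ r) :
    ContDiff ℝ ∞ (fun x : Cn n × Cn n => delPairing r x.1 x.2) := by
  have hc : ∀ j : Fin n, ContDiff ℝ ∞ (fun x : Cn n × Cn n => x.2 j) := fun j =>
    ((EuclideanSpace.proj j : Cn n →L[ℂ] ℂ).restrictScalars ℝ).contDiff.comp contDiff_snd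
  refine ContDiff.sum fun j _ => ContDiff.mul ?_ (hc j)
  exact ((contDiff_ofReal hr).dz (m := ∞) (by simp)).comp contDiff_fst

/-- For a real function dr = 2 Re ∂r, so a direction in which r increases at a boundary point is
also one on which ∂r does not vanish. -/
theorem fderiv_eq_two_re_delPairing (hr : DifferentiableAt ℝ r z) (v : Cn n) :
    fderiv ℝ r z v = 2 * (delPairing r z v).re := by
  have hv : v = ∑ j, ((v j).re • EuclideanSpace.single j (1 : ℂ)
      + (v j).im • EuclideanSpace.single j I) := by
    ext k
    rw [WithLp.ofLp_sum, Finset.sum_apply, Finset.sum_eq_single k]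
    · simp [re_add_im]
    · intro j _ hj; simp [Ne.symm hj]
    · simp
  conv_lhs => rw [hv]
  simp only [map_sum, map_add, map_smul, smul_eq_mul, delPairing, re_sum, Finset.mul_sum]
  refine Finset.sum_congr rfl fun j _ => ?_
  simp only [dz, fderiv_ofReal_apply hr]
  simp
  ring

end Geometry

/-! ### From pseudoconvexity on the boundary to a lower bound for the Levi form inside. -/

section Geometry

open Filter Topology

variable {r : Cn n → ℝ} {Ω : Set (Cn n)} {z w p : Cn n}

theorem IsDefiningFunction.eq_zero_of_mem_frontier (h : IsDefiningFunction Ω r)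
    (hp : p ∈ frontier Ω) : r p = 0 := by
  have hΩ : IsOpen Ω := by
    rw [h.eq_neg]; exact isOpen_lt h.smooth.continuous continuous_const
  rw [hΩ.frontier_eq] at hp
  refine le_antisymm ?_ ?_
  · have : closure Ω ⊆ {z | r z ≤ 0} := by
      refine closure_minimal (fun z hz => ?_) (isClosed_le h.smooth.continuous continuous_const)
      rw [h.eq_neg] at hz; exact (show r z < 0 from hz).le
    exact this hp.1
  · by_contra hc
    exact hp.2 (by rw [h.eq_neg]; exact not_le.1 hc)

/-- A point near a boundary point is joined to the boundary by a short segment in a fixed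
transversal direction. -/
theorem IsDefiningFunction.exists_segment (h : IsDefiningFunction Ω r) {p₀ ν : Cn n}
    (hp₀ : p₀ ∈ frontier Ω) (hν : 0 < fderiv ℝ r p₀ ν) :
    ∃ c > 0, ∀ᶠ p in 𝓝 p₀, p ∈ Ω → ∃ t, 0 ≤ t ∧ t ≤ c * |r p| ∧ p + t • ν ∈ frontier Ω := by
  have hrd : Differentiable ℝ r := h.smooth.differentiable (by simp)
  have hr0 := h.eq_zero_of_mem_frontier hp₀
  have hΩ : IsOpen Ω := by
    rw [h.eq_neg]; exact isOpen_lt h.smooth.continuous continuous_const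
  -- Half of the slope at p₀, a lower bound for the slope of `r` along ν throughout a neighbourhood.
  -- After time |r(p)|/d the function has therefore risen from r(p) to at least 0.
  set d := fderiv ℝ r p₀ ν / 2 with hd
  have hd0 : 0 < d := by positivity
  have hev : ∀ᶠ x in 𝓝 p₀, d < fderiv ℝ r x ν := by
    have : Continuous (fun x => fderiv ℝ r x ν) :=
      (h.smooth.continuous_fderiv (by simp)).clm_apply continuous_const
    exact this.continuousAt.eventually (lt_mem_nhds (by rw [hd]; linarith))
  have hev2 : ∀ᶠ x in 𝓝 p₀ ×ˢ 𝓝 (0 : ℝ), d < fderiv ℝ r (x.1 + x.2 • ν) ν := by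
    have : ContinuousAt (fun x : Cn n × ℝ => x.1 + x.2 • ν) (p₀, 0) := by fun_prop
    rw [← nhds_prod_eq]
    refine this.eventually (p := fun x => d < fderiv ℝ r x ν) ?_
    simpa using hev
  obtain ⟨P, hP, T, hT, hPT⟩ := Filter.eventually_prod_iff.1 hev2
  obtain ⟨δ, hδ, hδT⟩ := Metric.eventually_nhds_iff.1 hT
  have hrc : Tendsto (fun p => d⁻¹ * |r p|) (𝓝 p₀) (𝓝 0) := by
    have : Continuous (fun p => d⁻¹ * |r p|) := by have := h.smooth.continuous; fun_prop
    simpa [hr0] using this.tendsto p₀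
  refine ⟨d⁻¹, by positivity, ?_⟩
  filter_upwards [hP, hrc.eventually (gt_mem_nhds hδ)] with p hp hpδ hpΩ
  have hrp : r p < 0 := by rw [h.eq_neg] at hpΩ; exact hpΩ
  set t₁ := d⁻¹ * |r p| with ht₁
  have ht₁0 : 0 < t₁ := mul_pos (inv_pos.2 hd0) (abs_pos.2 hrp.ne)
  have hder : ∀ t : ℝ, HasDerivAt (fun t : ℝ => r (p + t • ν)) (fderiv ℝ r (p + t • ν) ν) t := by
    intro t
    have h1 : HasDerivAt (fun t : ℝ => p + t • ν) ν t := by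
      simpa using ((hasDerivAt_id t).smul_const ν).const_add p
    exact (hrd _).hasFDerivAt.comp_hasDerivAt t h1
  have hcont : Continuous (fun t : ℝ => r (p + t • ν)) := by
    have := h.smooth.continuous; fun_prop
  have hmono : ∀ s ∈ Set.Icc 0 t₁, ∀ t ∈ Set.Icc 0 t₁, s ≤ t →
      d * (t - s) ≤ r (p + t • ν) - r (p + s • ν) := by
    refine (convex_Icc 0 t₁).mul_sub_le_image_sub_of_le_deriv hcont.continuousOn
      (fun t _ => (hder t).differentiableAt.differentiableWithinAt) fun t ht => ?_
    rw [interior_Icc] at ht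
    rw [(hder t).deriv]
    refine (hPT hp (hδT ?_)).le
    rw [dist_zero_right, Real.norm_of_nonneg ht.1.le]
    exact ht.2.trans hpδ
  have hend : 0 ≤ r (p + t₁ • ν) := by
    have := hmono 0 ⟨le_rfl, ht₁0.le⟩ t₁ ⟨ht₁0.le, le_rfl⟩ ht₁0.le
    rw [zero_smul, add_zero, sub_zero, ht₁, mul_inv_cancel_left₀ hd0.ne', abs_of_neg hrp] at this
    rw [ht₁, abs_of_neg hrp]
    linarith
  obtain ⟨t, ht, htr⟩ := intermediate_value_Icc ht₁0.le hcont.continuousOn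
    (show (0 : ℝ) ∈ Set.Icc (r (p + (0 : ℝ) • ν)) (r (p + t₁ • ν)) by
      simpa using ⟨hrp.le, hend⟩)
  refine ⟨t, ht.1, ht.2, ?_⟩
  simp only at htr
  rw [hΩ.frontier_eq]
  refine ⟨?_, fun hc => ?_⟩
  -- At the root `r` vanishes, so the point is not in Ω. It lies in the closure because `r` is
  -- strictly negative at the earlier times on the segment.
  · have ht0 : 0 < t := by
      refine lt_of_le_of_ne ht.1 fun h0 => ?_
      rw [← h0, zero_smul, add_zero] at htr
      exact hrp.ne htr
    have htend : Tendsto (fun s : ℝ => p + s • ν) (𝓝[<] t) (𝓝 (p + t • ν)) :=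
      ((by fun_prop : Continuous fun s : ℝ => p + s • ν).tendsto t).mono_left nhdsWithin_le_nhds
    refine mem_closure_of_tendsto htend ?_
    filter_upwards [Ioo_mem_nhdsLT ht0] with s hs
    have := hmono s ⟨hs.1.le, hs.2.le.trans ht.2⟩ t ht hs.2.le
    rw [h.eq_neg, Set.mem_ofPred_eq]
    have : 0 < d * (t - s) := mul_pos hd0 (by linarith [hs.2])
    linarith
  · rw [h.eq_neg, Set.mem_ofPred_eq, htr] at hc
    exact lt_irrefl _ hc

theorem delPairing_add (ψ : Cn n → ℝ) (z v w : Cn n) :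
    delPairing ψ z (v + w) = delPairing ψ z v + delPairing ψ z w := by
  simp [delPairing, mul_add, Finset.sum_add_distrib]

theorem delPairing_smul (ψ : Cn n → ℝ) (z : Cn n) (c : ℂ) (w : Cn n) :
    delPairing ψ z (c • w) = c * delPairing ψ z w := by
  simp only [delPairing, Finset.mul_sum, PiLp.smul_apply, smul_eq_mul]
  exact Finset.sum_congr rfl fun j _ => by ring

theorem leviForm_smul (ψ : Cn n → ℝ) (z : Cn n) (c : ℂ) (w : Cn n) :
    leviForm ψ z (c • w) = ‖c‖ ^ 2 * leviForm ψ z w := by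
  have : ∑ j, ∑ k, dz j (dzbar k (fun z => (ψ z : ℂ))) z * (c • w) j * star ((c • w) k)
      = ((‖c‖ ^ 2 : ℝ) : ℂ) * ∑ j, ∑ k, dz j (dzbar k (fun z => (ψ z : ℂ))) z * w j * star (w k) := by
    simp only [Finset.mul_sum, PiLp.smul_apply, smul_eq_mul, star_mul']
    refine Finset.sum_congr rfl fun j _ => Finset.sum_congr rfl fun k _ => ?_
    have e : ((‖c‖ ^ 2 : ℝ) : ℂ) = c * star c := by
      rw [star_def, mul_conj, Complex.normSq_eq_norm_sq]
    rw [e]; ring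
  simp only [leviForm, this, re_ofReal_mul]

/-- If |r| + |∂r(w)| stays away from zero near the given point, a large constant does it. Otherwise
the base point is on the boundary and the vector is complex tangential there. A nearby pair (p, w)
is then moved to a boundary point q = p + tν and a tangential vector w − (s/e)ν, at a cost of order
|r(p)| + |∂r(w)|. At the new pair the Levi form is nonnegative, and it is locally Lipschitz. -/
theorem IsDefiningFunction.eventually_leviForm_ge (h : IsDefiningFunction Ω r)
    (hps : ∀ p ∈ frontier Ω, ∀ w : Cn n, delPairing r p w = 0 → 0 ≤ leviForm r p w)
    {p₀ : Cn n} (hp₀ : p₀ ∈ closure Ω) (w₀ : Cn n) :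
    ∃ C, ∀ᶠ x in 𝓝 (p₀, w₀), x.1 ∈ Ω →
      -(C * |r x.1| + C * ‖delPairing r x.1 x.2‖) ≤ leviForm r x.1 x.2 := by
  have hΩ : IsOpen Ω := by
    rw [h.eq_neg]; exact isOpen_lt h.smooth.continuous continuous_const
  have cr : Continuous r := h.smooth.continuous
  have cL := (contDiff_leviForm h.smooth).continuous
  have cS := (contDiff_delPairing h.smooth).continuous
  -- The nondegenerate case: `g` is a positive continuous lower bound for |r| + |∂r(w)|, so this sum
  -- times a suitable constant outweighs a local bound M for the negative part of the Levi form.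
  have generic : ∀ g : Cn n × Cn n → ℝ, ContinuousAt g (p₀, w₀) → 0 < g (p₀, w₀) →
      (∀ᶠ x in 𝓝 (p₀, w₀), x.1 ∈ Ω → g x ≤ |r x.1| + ‖delPairing r x.1 x.2‖) →
      ∃ C, ∀ᶠ x in 𝓝 (p₀, w₀), x.1 ∈ Ω →
      -(C * |r x.1| + C * ‖delPairing r x.1 x.2‖) ≤ leviForm r x.1 x.2 := by
    intro g hg hg0 hgle
    set M := |leviForm r p₀ w₀| + 1 with hM
    have hM0 : 0 < M := by positivity
    have e1 : ∀ᶠ x in 𝓝 (p₀, w₀), -M < leviForm r x.1 x.2 := by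
      refine cL.continuousAt.eventually (lt_mem_nhds ?_)
      simp only [hM]; linarith [neg_abs_le (leviForm r p₀ w₀)]
    have e2 : ∀ᶠ x in 𝓝 (p₀, w₀), g (p₀, w₀) / 2 < g x :=
      hg.eventually (lt_mem_nhds (by linarith))
    refine ⟨2 * M / g (p₀, w₀), ?_⟩
    filter_upwards [e1, e2, hgle] with x h1 h2 h3 hx
    have h4 := h3 hx
    have : M ≤ 2 * M / g (p₀, w₀) * (|r x.1| + ‖delPairing r x.1 x.2‖) := by
      rw [div_mul_eq_mul_div, le_div_iff₀ hg0]
      nlinarith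
    linarith
  by_cases hin : p₀ ∈ Ω
  · have : r p₀ < 0 := by rw [h.eq_neg] at hin; exact hin
    refine generic (fun x => |r x.1|) (by fun_prop) (abs_pos.2 this.ne) ?_
    filter_upwards with x _
    exact le_add_of_nonneg_right (norm_nonneg _)
  have hfr : p₀ ∈ frontier Ω := by rw [hΩ.frontier_eq]; exact ⟨hp₀, hin⟩
  by_cases hs : delPairing r p₀ w₀ = 0
  swap
  · refine generic (fun x => ‖delPairing r x.1 x.2‖) cS.norm.continuousAt (norm_pos_iff.2 hs) ?_
    filter_upwards with x _
    exact le_add_of_nonneg_left (abs_nonneg _)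
  have hrd : Differentiable ℝ r := h.smooth.differentiable (by simp)
  obtain ⟨ν, hν⟩ : ∃ ν, 0 < fderiv ℝ r p₀ ν := by
    by_contra hc
    push Not at hc
    refine h.fderiv_ne_zero p₀ hfr (ContinuousLinearMap.ext fun v => le_antisymm (hc v) ?_)
    have := hc (-v)
    rw [map_neg] at this
    simpa using this
  have hsν : delPairing r p₀ ν ≠ 0 := by
    intro h0
    rw [fderiv_eq_two_re_delPairing (hrd p₀), h0] at hν
    simp at hν
  obtain ⟨c, hc, hseg⟩ := h.exists_segment hfr hν
  obtain ⟨KL, tL, htL, hL⟩ := (((contDiff_leviForm h.smooth).of_le (m := 1)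
    (by norm_cast)).contDiffAt (x := (p₀, w₀))).exists_lipschitzOnWith
  obtain ⟨KS, tS, htS, hS⟩ := (((contDiff_delPairing h.smooth).of_le (m := 1)
    (by norm_cast)).contDiffAt (x := (p₀, w₀))).exists_lipschitzOnWith
  set σ := ‖delPairing r p₀ ν‖ with hσ
  have hσ0 : 0 < σ := norm_pos_iff.2 hsν
  have cSν : Continuous (fun x : (Cn n × Cn n) × ℝ => delPairing r (x.1.1 + x.2 • ν) ν) :=
    cS.comp₂ (e := fun x : (Cn n × Cn n) × ℝ => x.1.1 + x.2 • ν) (f := fun _ => ν)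
      (by fun_prop) (by fun_prop)
  have cSw : Continuous (fun x : (Cn n × Cn n) × ℝ => delPairing r (x.1.1 + x.2 • ν) x.1.2) :=
    cS.comp₂ (e := fun x : (Cn n × Cn n) × ℝ => x.1.1 + x.2 • ν) (f := fun x => x.1.2)
      (by fun_prop) (by fun_prop)
  have ev1 : ∀ᶠ x in 𝓝 ((p₀, w₀), (0 : ℝ)), σ / 2 < ‖delPairing r (x.1.1 + x.2 • ν) ν‖ :=
    cSν.norm.continuousAt.eventually (lt_mem_nhds (by simp [← hσ, hσ0]))
  have ev2 : ∀ᶠ x in 𝓝 ((p₀, w₀), (0 : ℝ)), (x.1.1 + x.2 • ν, x.1.2) ∈ tS := by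
    refine (by fun_prop : Continuous fun x : (Cn n × Cn n) × ℝ =>
      (x.1.1 + x.2 • ν, x.1.2)).continuousAt.eventually_mem ?_
    simpa using htS
  have ev3 : ∀ᶠ x in 𝓝 ((p₀, w₀), (0 : ℝ)), (x.1.1 + x.2 • ν, x.1.2
      - (delPairing r (x.1.1 + x.2 • ν) x.1.2 / delPairing r (x.1.1 + x.2 • ν) ν) • ν) ∈ tL := by
    have hca : ContinuousAt (fun x : (Cn n × Cn n) × ℝ => (x.1.1 + x.2 • ν, x.1.2
        - (delPairing r (x.1.1 + x.2 • ν) x.1.2 / delPairing r (x.1.1 + x.2 • ν) ν) • ν))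
        ((p₀, w₀), (0 : ℝ)) := by
      refine ContinuousAt.prodMk (by fun_prop) (ContinuousAt.sub (by fun_prop)
        (ContinuousAt.smul (cSw.continuousAt.div cSν.continuousAt ?_) continuousAt_const))
      simpa using hsν
    refine hca.eventually_mem ?_
    simpa [hs] using htL
  have ev := ev1.and (ev2.and ev3)
  rw [nhds_prod_eq] at ev
  obtain ⟨P, hP, T, hT, hPT⟩ := Filter.eventually_prod_iff.1 ev
  obtain ⟨δ, hδ, hδT⟩ := Metric.eventually_nhds_iff.1 hT
  have hrc : Tendsto (fun x : Cn n × Cn n => c * |r x.1|) (𝓝 (p₀, w₀)) (𝓝 0) := by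
    have : Continuous (fun x : Cn n × Cn n => c * |r x.1|) := by fun_prop
    simpa [h.eq_zero_of_mem_frontier hfr] using this.tendsto (p₀, w₀)
  have hseg' : ∀ᶠ x in 𝓝 (p₀, w₀), x.1 ∈ Ω →
      ∃ t, 0 ≤ t ∧ t ≤ c * |r x.1| ∧ x.1 + t • ν ∈ frontier Ω :=
    (continuousAt_fst (p := (p₀, w₀))).eventually
      (p := fun p => p ∈ Ω → ∃ t, 0 ≤ t ∧ t ≤ c * |r p| ∧ p + t • ν ∈ frontier Ω) hseg
  -- Lipschitz constant of the Levi form times the length of the move. The base point moves by t‖ν‖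
  -- ≤ c|r|‖ν‖, the vector by at most (2/σ)‖s‖‖ν‖, and ‖s‖ exceeds |∂r(w)| at the original point by
  -- at most KS·t‖ν‖.
  refine ⟨KL * ‖ν‖ * (c + 2 / σ * (KS * ‖ν‖ * c) + 2 / σ), ?_⟩
  filter_upwards [hP, hrc.eventually (gt_mem_nhds hδ), hseg', htL, htS] with x hxP hxδ hxs hxL hxS hx
  obtain ⟨t, ht0, htc, htf⟩ := hxs hx
  obtain ⟨h1, h2, h3⟩ := hPT hxP (hδT (y := t) (by
    rw [dist_zero_right, Real.norm_of_nonneg ht0]; exact htc.trans_lt hxδ))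
  set q := x.1 + t • ν with hq
  set s := delPairing r q x.2 with hsdef
  set e := delPairing r q ν with he
  have he0 : e ≠ 0 := norm_pos_iff.1 (lt_trans (by positivity) h1)
  have hw0 : delPairing r q (x.2 - (s / e) • ν) = 0 := by
    rw [sub_eq_add_neg, ← neg_smul, delPairing_add, delPairing_smul, ← he, ← hsdef]
    field_simp
    ring
  have hL0 := hps q htf _ hw0
  have hdq : dist x.1 q = t * ‖ν‖ := by
    rw [hq, dist_self_add_right, norm_smul, Real.norm_of_nonneg ht0]
  have hS1 := hS.dist_le_mul x hxS _ h2
  have hL1 := hL.dist_le_mul x hxL _ h3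
  rw [Prod.dist_eq, hdq, dist_self, max_eq_left (by positivity), dist_comm, dist_eq_norm] at hS1
  have hs1 : ‖s‖ ≤ ‖delPairing r x.1 x.2‖ + KS * (t * ‖ν‖) := by
    have := norm_sub_norm_le s (delPairing r x.1 x.2)
    linarith
  have hse : ‖(s / e) • ν‖ ≤ 2 / σ * ‖s‖ * ‖ν‖ := by
    rw [norm_smul, norm_div]
    gcongr
    rw [div_le_iff₀ (lt_trans (by positivity) h1)]
    calc ‖s‖ = 2 / σ * ‖s‖ * (σ / 2) := by field_simp
      _ ≤ _ := by gcongr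
  have hdd : dist x (q, x.2 - (s / e) • ν) ≤ t * ‖ν‖ + 2 / σ * ‖s‖ * ‖ν‖ := by
    rw [Prod.dist_eq, hdq, dist_self_sub_right]
    exact max_le (le_add_of_nonneg_right (by positivity))
      (hse.trans (le_add_of_nonneg_left (by positivity)))
  have hfin : KL * dist x (q, x.2 - (s / e) • ν) ≤ KL * ‖ν‖ * (c + 2 / σ * (KS * ‖ν‖ * c) + 2 / σ)
      * |r x.1| + KL * ‖ν‖ * (c + 2 / σ * (KS * ‖ν‖ * c) + 2 / σ) * ‖delPairing r x.1 x.2‖ := by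
    calc KL * dist x (q, x.2 - (s / e) • ν)
        ≤ KL * (c * |r x.1| * ‖ν‖ + 2 / σ * (‖delPairing r x.1 x.2‖
          + KS * (c * |r x.1| * ‖ν‖)) * ‖ν‖) := by
          refine mul_le_mul_of_nonneg_left (hdd.trans ?_) KL.2
          gcongr
          exact hs1.trans (by gcongr)
      _ = KL * ‖ν‖ * (c + 2 / σ * (KS * ‖ν‖ * c)) * |r x.1|
          + KL * ‖ν‖ * (2 / σ) * ‖delPairing r x.1 x.2‖ := by ring
      _ ≤ _ := by
          have e1 : c + 2 / σ * (KS * ‖ν‖ * c) ≤ c + 2 / σ * (KS * ‖ν‖ * c) + 2 / σ :=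
            le_add_of_nonneg_right (by positivity)
          have e2 : 2 / σ ≤ c + 2 / σ * (KS * ‖ν‖ * c) + 2 / σ :=
            le_add_of_nonneg_left (by positivity)
          refine add_le_add (mul_le_mul_of_nonneg_right (mul_le_mul_of_nonneg_left e1
            (by positivity)) (abs_nonneg _)) (mul_le_mul_of_nonneg_right
            (mul_le_mul_of_nonneg_left e2 (by positivity)) (norm_nonneg _))
  rw [Real.dist_eq] at hL1
  have := (abs_le.1 hL1).1
  simp only at this hL1
  linarith

/-- The local bounds are made uniform by compactness of the closure of Ω times the unit sphere, and
homogeneity in w gives the powers of ‖w‖. -/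
theorem IsDefiningFunction.exists_leviForm_ge (h : IsDefiningFunction Ω r)
    (hb : Bornology.IsBounded Ω)
    (hps : ∀ p ∈ frontier Ω, ∀ w : Cn n, delPairing r p w = 0 → 0 ≤ leviForm r p w) :
    ∃ C, 0 ≤ C ∧ ∀ p ∈ Ω, ∀ w,
      -(C * |r p| * ‖w‖ ^ 2 + C * ‖w‖ * ‖delPairing r p w‖) ≤ leviForm r p w := by
  have hcpt : IsCompact (closure Ω ×ˢ Metric.sphere (0 : Cn n) 1) :=
    hb.isCompact_closure.prod (isCompact_sphere _ _)
  obtain ⟨C, hC⟩ : ∃ C, ∀ x ∈ closure Ω ×ˢ Metric.sphere (0 : Cn n) 1, x.1 ∈ Ω →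
      -(C * |r x.1| + C * ‖delPairing r x.1 x.2‖) ≤ leviForm r x.1 x.2 := by
    refine hcpt.induction_on (p := fun s => ∃ C, ∀ x ∈ s, x.1 ∈ Ω →
      -(C * |r x.1| + C * ‖delPairing r x.1 x.2‖) ≤ leviForm r x.1 x.2) ⟨0, by simp⟩ ?_ ?_ ?_
    · rintro s t hst ⟨C, hC⟩
      exact ⟨C, fun x hx => hC x (hst hx)⟩
    · rintro s t ⟨C, hC⟩ ⟨D, hD⟩
      refine ⟨max C D, fun x hx hxΩ => ?_⟩
      have key : ∀ E ≤ max C D, -(E * |r x.1| + E * ‖delPairing r x.1 x.2‖) ≤ leviForm r x.1 x.2 →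
          -(max C D * |r x.1| + max C D * ‖delPairing r x.1 x.2‖) ≤ leviForm r x.1 x.2 := by
        intro E hE h1
        refine le_trans (neg_le_neg ?_) h1
        gcongr
      rcases hx with hx | hx
      · exact key C (le_max_left _ _) (hC x hx hxΩ)
      · exact key D (le_max_right _ _) (hD x hx hxΩ)
    · rintro ⟨p, w⟩ hx
      obtain ⟨C, hC⟩ := h.eventually_leviForm_ge hps hx.1 w
      exact ⟨_, mem_nhdsWithin_of_mem_nhds hC, C, fun x hx => hx⟩
  refine ⟨max C 0, le_max_right _ _, fun p hp w => ?_⟩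
  by_cases hw : w = 0
  · subst hw; simp [leviForm]
  have hw0 : 0 < ‖w‖ := norm_pos_iff.2 hw
  set e : Cn n := ((‖w‖ : ℂ)⁻¹) • w with he
  have hwe : w = (‖w‖ : ℂ) • e := by
    rw [he, smul_smul, mul_inv_cancel₀ (by simpa using hw), one_smul]
  have hen : ‖e‖ = 1 := by
    rw [he, norm_smul, norm_inv, norm_real, norm_norm, inv_mul_cancel₀ hw0.ne']
  have h1 := hC (p, e) ⟨subset_closure hp, by simpa using hen⟩ hp
  simp only at h1
  have h2 : leviForm r p w = ‖w‖ ^ 2 * leviForm r p e := by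
    conv_lhs => rw [hwe, leviForm_smul, norm_real, norm_norm]
  have h3 : ‖delPairing r p w‖ = ‖w‖ * ‖delPairing r p e‖ := by
    conv_lhs => rw [hwe, delPairing_smul, norm_mul, norm_real, norm_norm]
  rw [h2, h3]
  have h4 : -(max C 0 * |r p| + max C 0 * ‖delPairing r p e‖) ≤ leviForm r p e := by
    refine le_trans (neg_le_neg ?_) h1
    gcongr <;> exact le_max_left _ _
  have := mul_le_mul_of_nonneg_left h4 (sq_nonneg ‖w‖)
  linarith

end Geometry

/-! ### The strictly plurisubharmonic exhaustion function. -/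

section Geometry

open Filter Topology

variable {r : Cn n → ℝ} {Ω : Set (Cn n)} {z w p : Cn n}

/-- A strictly plurisubharmonic exhaustion function with controlled gradient. -/
structure IsStrictExhaustion (Ω : Set (Cn n)) (ψ : Cn n → ℝ) (C : ℝ) : Prop where
  smooth : ContDiffOn ℝ ∞ ψ Ω
  isCompact : ∀ c, IsCompact {z | z ∈ Ω ∧ ψ z ≤ c}
  levi : ∀ z ∈ Ω, ∀ w, ‖w‖ ^ 2 ≤ leviForm ψ z w
  grad : ∀ z ∈ Ω, ∑ j, ‖dz j (fun z => (ψ z : ℂ)) z‖ ^ 2 ≤ C * Real.exp (2 * ψ z)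

theorem contDiff_norm_sq_mul (c : ℝ) : ContDiff ℝ ∞ (fun z : Cn n => c * ‖z‖ ^ 2) := by
  have : ContDiff ℝ ∞ (fun z : Cn n => ‖z‖ ^ 2) := contDiff_id.norm_sq ℂ
  exact contDiff_const.mul this

/-- The function is −log(−r) + A|z|². With ρ = −r and x = ρ⁻¹|∂r(w)|, the Levi form of the logarithm
is ρ⁻¹ times that of r plus x². The interior lower bound costs C|w|² + C|w|x, of which x² absorbs
the second part and A the rest. The gradient grows like 1/ρ, which is matched by e^ψ = ρ⁻¹e^{A|z|²}.
-/
theorem exists_strictExhaustion (hΩ : IsSmoothBoundedPseudoconvexDomain Ω) :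
    ∃ ψ C, 0 < C ∧ IsStrictExhaustion Ω ψ C := by
  obtain ⟨r, hr, hps⟩ := hΩ.pseudoconvex
  obtain ⟨C, hC0, hC⟩ := hr.exists_leviForm_ge hΩ.isBounded hps
  have hcl : IsCompact (closure Ω) := hΩ.isBounded.isCompact_closure
  have hneg : ∀ z ∈ Ω, r z < 0 := fun z hz => by rw [hr.eq_neg] at hz; exact hz
  obtain ⟨R₀, hR₀⟩ := hcl.exists_bound_of_continuousOn hr.smooth.continuous.continuousOn
  obtain ⟨R, hR⟩ := hcl.exists_bound_of_continuousOn (continuous_id (X := Cn n)).continuousOn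
  have hdc : Continuous (fun z => ∑ j, ‖dz j (fun z => (r z : ℂ)) z‖ ^ 2) :=
    continuous_finsetSum _ fun j _ =>
      (((contDiff_ofReal hr.smooth).dz (m := ∞) (by simp)).continuous.norm.pow 2)
  obtain ⟨D, hD⟩ := hcl.exists_bound_of_continuousOn hdc.continuousOn
  -- C pays for the term C|w|², C² (of which a quarter is used) for completing the square in x² −
  -- C|w|x, and 1 is the remaining strict positivity.
  set A := 1 + C + C ^ 2 with hA
  have hA0 : 0 < A := by positivity
  -- `Real.log` is even, so log r here is log(−r) on Ω.
  set ψ : Cn n → ℝ := fun z => -Real.log (r z) + A * ‖z‖ ^ 2 with hψ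
  have s1 : ∀ z ∈ Ω, ContDiffAt ℝ ∞ (fun z => -Real.log (r z)) z := fun z hz =>
    (hr.smooth.contDiffAt.log (hneg z hz).ne).neg
  have s2 : ∀ z, ContDiffAt ℝ ∞ (fun z : Cn n => A * ‖z‖ ^ 2) z := fun z =>
    (contDiff_norm_sq_mul A).contDiffAt
  have d1 : deriv (fun t : ℝ => -Real.log t) = fun t => -t⁻¹ := by
    ext t; rw [deriv.fun_neg, Real.deriv_log]
  have d2 : deriv (fun t : ℝ => -t⁻¹) = fun t => (t ^ 2)⁻¹ := by
    ext t; rw [deriv.fun_neg, deriv_inv, neg_neg]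
  refine ⟨ψ, 2 * |D| + 2 * A ^ 2 * R ^ 2 * R₀ ^ 2 + 1, by positivity, fun z hz =>
    ((s1 z hz).add (s2 z)).contDiffWithinAt, fun c => ?_, fun z hz w => ?_, fun z hz => ?_⟩
  · have hK : IsCompact (closure Ω ∩ {z | r z ≤ -Real.exp (-c)}) :=
      hcl.inter_right (isClosed_le hr.smooth.continuous continuous_const)
    have hKΩ : closure Ω ∩ {z | r z ≤ -Real.exp (-c)} ⊆ Ω := fun z hz => by
      rw [hr.eq_neg]
      exact lt_of_le_of_lt (show r z ≤ _ from hz.2) (neg_lt_zero.2 (Real.exp_pos _))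
    have hcont : ContinuousOn ψ (closure Ω ∩ {z | r z ≤ -Real.exp (-c)}) := fun z hz =>
      ((s1 z (hKΩ hz)).add (s2 z)).continuousAt.continuousWithinAt
    have : {z | z ∈ Ω ∧ ψ z ≤ c}
        = (closure Ω ∩ {z | r z ≤ -Real.exp (-c)}) ∩ ψ ⁻¹' Set.Iic c := by
      ext z
      constructor
      · rintro ⟨hz, hzc⟩
        refine ⟨⟨subset_closure hz, ?_⟩, hzc⟩
        have h1 : -Real.log (-(r z)) ≤ c := by
          rw [Real.log_neg_eq_log]
          have : 0 ≤ A * ‖z‖ ^ 2 := by positivity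
          simp only [hψ] at hzc
          linarith
        have h2 : Real.exp (-c) ≤ -(r z) := by
          rw [← Real.le_log_iff_exp_le (by linarith [hneg z hz])]; linarith
        change r z ≤ _
        linarith
      · rintro ⟨hz, hzc⟩
        exact ⟨hKΩ hz, hzc⟩
    rw [this]
    exact hK.of_isClosed_subset (hcont.preimage_isClosed_of_isClosed hK.isClosed isClosed_Iic)
      Set.inter_subset_left
  · have hrz := hneg z hz
    have h2 : (2 : WithTop ℕ∞) ≤ ∞ := by norm_cast
    rw [hψ, leviForm_add ((s1 z hz).of_le h2) ((s2 z).of_le h2), leviForm_norm_sq,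
      leviForm_comp (F := fun t => -Real.log t)
        ((Real.contDiffAt_log.2 hrz.ne).neg.of_le (by norm_cast)) (hr.smooth.contDiffAt.of_le h2), d1, d2]
    have h3 := hC z hz w
    set ρ := -r z with hρ
    have hρ0 : 0 < ρ := by linarith
    set s := ‖delPairing r z w‖
    have hs : 0 ≤ s := norm_nonneg _
    have e1 : |r z| = ρ := abs_of_neg hrz
    have e2 : r z = -ρ := by simp [hρ]
    rw [e1] at h3
    have e3 : -(r z)⁻¹ = ρ⁻¹ := by rw [e2, inv_neg, neg_neg]
    have e4 : (r z ^ 2)⁻¹ = ρ⁻¹ ^ 2 := by rw [e2, neg_sq, inv_pow]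
    simp only [e3, e4]
    have h5 := mul_le_mul_of_nonneg_left h3 (inv_pos.2 hρ0).le
    have e5 : ρ⁻¹ * -(C * ρ * ‖w‖ ^ 2 + C * ‖w‖ * s) = -(C * ‖w‖ ^ 2 + C * ‖w‖ * (ρ⁻¹ * s)) := by
      field_simp
    rw [e5] at h5
    have e6 : ρ⁻¹ ^ 2 * s ^ 2 = (ρ⁻¹ * s) ^ 2 := by ring
    rw [e6, hA]
    nlinarith [sq_nonneg (ρ⁻¹ * s - C * ‖w‖ / 2), sq_nonneg (C * ‖w‖)]
  · have hrz := hneg z hz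
    have hrd : DifferentiableAt ℝ r z := hr.smooth.contDiffAt.differentiableAt (by simp)
    have e : ∀ j, dz j (fun z => (ψ z : ℂ)) z
        = (-(r z)⁻¹ : ℝ) * dz j (fun z => (r z : ℂ)) z + A * star (z j) := by
      intro j
      have : (fun z => (ψ z : ℂ)) = fun z => ((-Real.log (r z) : ℝ) : ℂ) + ((A * ‖z‖ ^ 2 : ℝ) : ℂ) := by
        ext z; simp [hψ]
      rw [this, dz_add ((contDiffAt_ofReal (s1 z hz)).differentiableAt (by simp))
        ((contDiffAt_ofReal (s2 z)).differentiableAt (by simp)), dz_norm_sq,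
        dz_comp (F := fun t => -Real.log t) (Real.differentiableAt_log hrz.ne).neg hrd, d1]
    have h1 : ∀ j, ‖dz j (fun z => (ψ z : ℂ)) z‖ ^ 2
        ≤ 2 * ((r z ^ 2)⁻¹ * ‖dz j (fun z => (r z : ℂ)) z‖ ^ 2) + 2 * (A ^ 2 * ‖z j‖ ^ 2) := by
      intro j
      rw [e j]
      refine (norm_add_sq_le_two _ _).trans_eq ?_
      rw [norm_mul, norm_mul, norm_real, norm_real, norm_star, mul_pow, mul_pow, Real.norm_eq_abs,
        Real.norm_eq_abs, sq_abs, sq_abs, neg_sq, inv_pow]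
    have h2 : Real.exp (2 * ψ z) = (r z ^ 2)⁻¹ * Real.exp (2 * (A * ‖z‖ ^ 2)) := by
      have : 2 * ψ z = (2 : ℕ) * -Real.log (-r z) + 2 * (A * ‖z‖ ^ 2) := by
        simp only [hψ, Real.log_neg_eq_log]; push_cast; ring
      rw [this, Real.exp_add, Real.exp_nat_mul, Real.exp_neg, Real.exp_log (by linarith), inv_pow,
        neg_sq]
    have h3 : 1 ≤ Real.exp (2 * (A * ‖z‖ ^ 2)) := Real.one_le_exp (by positivity)
    have hr2 : 0 < r z ^ 2 := by have := hrz.ne; positivity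
    have h4 : r z ^ 2 ≤ R₀ ^ 2 := by
      have := hR₀ z (subset_closure hz)
      rw [Real.norm_eq_abs] at this
      rw [← sq_abs]; gcongr
    have h5 : ‖z‖ ^ 2 ≤ R ^ 2 := by
      have := hR z (subset_closure hz); gcongr; exact this
    have h6 : ∑ j, ‖dz j (fun z => (r z : ℂ)) z‖ ^ 2 ≤ |D| :=
      (le_abs_self _).trans ((hD z (subset_closure hz)).trans (le_abs_self D))
    calc ∑ j, ‖dz j (fun z => (ψ z : ℂ)) z‖ ^ 2
        ≤ 2 * ((r z ^ 2)⁻¹ * ∑ j, ‖dz j (fun z => (r z : ℂ)) z‖ ^ 2) + 2 * (A ^ 2 * ‖z‖ ^ 2) := by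
          rw [EuclideanSpace.norm_sq_eq]
          simp only [Finset.mul_sum, ← Finset.sum_add_distrib]
          exact Finset.sum_le_sum fun j _ => h1 j
      _ ≤ 2 * ((r z ^ 2)⁻¹ * |D|) + 2 * (A ^ 2 * R ^ 2) := by gcongr
      _ ≤ (r z ^ 2)⁻¹ * (2 * |D| + 2 * A ^ 2 * R ^ 2 * R₀ ^ 2 + 1) := by
          have : 1 ≤ (r z ^ 2)⁻¹ * R₀ ^ 2 := by
            rw [inv_mul_eq_div, one_le_div hr2]; exact h4
          have h7 : 2 * (A ^ 2 * R ^ 2) * 1 ≤ 2 * (A ^ 2 * R ^ 2) * ((r z ^ 2)⁻¹ * R₀ ^ 2) :=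
            mul_le_mul_of_nonneg_left this (by positivity)
          have h8 : 0 < (r z ^ 2)⁻¹ := by positivity
          nlinarith
      _ ≤ (2 * |D| + 2 * A ^ 2 * R ^ 2 * R₀ ^ 2 + 1) * Real.exp (2 * ψ z) := by
          rw [h2, ← mul_assoc, mul_comm (2 * |D| + _ + _)]
          exact le_mul_of_one_le_right (by positivity) h3

end Geometry

/-! ### Construction of the weights and cutoffs from the exhaustion function. -/

section Weights

open Filter Topology

/-- The antiderivative of `f` that vanishes at `0`. -/
def antideriv (f : ℝ → ℝ) (t : ℝ) : ℝ := ∫ s in (0 : ℝ)..t, f s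

variable {f g : ℝ → ℝ} {a t : ℝ}

theorem hasDerivAt_antideriv (hf : Continuous f) (t : ℝ) : HasDerivAt (antideriv f) (f t) t :=
  intervalIntegral.integral_hasDerivAt_right (hf.intervalIntegrable _ _)
    (hf.stronglyMeasurableAtFilter _ _) hf.continuousAt

theorem deriv_antideriv (hf : Continuous f) : deriv (antideriv f) = f :=
  funext fun t => (hasDerivAt_antideriv hf t).deriv

theorem contDiff_antideriv (hf : ContDiff ℝ ∞ f) : ContDiff ℝ ∞ (antideriv f) := by
  rw [contDiff_infty_iff_deriv, deriv_antideriv hf.continuous]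
  exact ⟨fun t => (hasDerivAt_antideriv hf.continuous t).differentiableAt, hf⟩

theorem antideriv_eq_zero (ha : 0 ≤ a) (hf : ∀ s ≤ a, f s = 0) (ht : t ≤ a) :
    antideriv f t = 0 := by
  rw [antideriv, intervalIntegral.integral_congr (g := fun _ => 0), intervalIntegral.integral_zero]
  intro s hs
  refine hf s ?_
  rcases Set.mem_uIcc.1 hs with h | h
  · exact h.2.trans ht
  · exact h.2.trans ha

theorem antideriv_mono (hf : Continuous f) (hg : Continuous g) (ht : 0 ≤ t)
    (h : ∀ s, 0 ≤ s → f s ≤ g s) : antideriv f t ≤ antideriv g t :=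
  intervalIntegral.integral_mono_on ht (hf.intervalIntegrable _ _) (hg.intervalIntegrable _ _)
    fun s hs => h s hs.1

/-- The function `t ↦ ∫₀ᵗ S(s - a) ds` with `S` the smooth transition; it equals `0` for `t ≤ a`
and grows with slope `1` for `t ≥ a + 1`. -/
def ramp (a : ℝ) : ℝ → ℝ := antideriv fun s => Real.smoothTransition (s - a)

/-- The function `t ↦ ∫₀ᵗ S(s - a) K e^{2s} ds`. -/
def expRamp (a K : ℝ) : ℝ → ℝ :=
  antideriv fun s => Real.smoothTransition (s - a) * (K * Real.exp (2 * s))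

theorem contDiff_smoothTransition_sub (a : ℝ) :
    ContDiff ℝ ∞ (fun s => Real.smoothTransition (s - a)) :=
  Real.smoothTransition.contDiff.comp (contDiff_id.sub contDiff_const)

theorem contDiff_expRamp_deriv (a K : ℝ) :
    ContDiff ℝ ∞ (fun s => Real.smoothTransition (s - a) * (K * Real.exp (2 * s))) :=
  (contDiff_smoothTransition_sub a).mul (contDiff_const.mul
    (Real.contDiff_exp.comp (contDiff_const.mul contDiff_id)))

theorem ramp_eq_zero (ha : 0 ≤ a) (ht : t ≤ a) : ramp a t = 0 :=
  antideriv_eq_zero ha (fun s hs => Real.smoothTransition.zero_of_nonpos (by linarith)) ht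

theorem expRamp_eq_zero {K : ℝ} (ha : 0 ≤ a) (ht : t ≤ a) : expRamp a K t = 0 :=
  antideriv_eq_zero ha (fun s hs => by
    rw [Real.smoothTransition.zero_of_nonpos (by linarith), zero_mul]) ht

theorem ramp_nonneg (ha : 0 ≤ a) (t : ℝ) : 0 ≤ ramp a t := by
  rcases le_total t a with h | h
  · rw [ramp_eq_zero ha h]
  · exact intervalIntegral.integral_nonneg (ha.trans h) fun s _ => Real.smoothTransition.nonneg _

theorem ramp_le (ht : 0 ≤ t) : ramp a t ≤ t := by
  have h := antideriv_mono (contDiff_smoothTransition_sub a).continuous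
    (continuous_const (y := (1 : ℝ))) ht fun s _ => Real.smoothTransition.le_one _
  rwa [show antideriv (fun _ => (1 : ℝ)) t = t by simp [antideriv]] at h

theorem sub_le_ramp (ha : 0 ≤ a) (t : ℝ) : t - (a + 1) ≤ ramp a t := by
  rcases le_total t (a + 1) with h | h
  · linarith [ramp_nonneg ha t]
  · have hi : ∀ x y : ℝ, IntervalIntegrable (fun s => Real.smoothTransition (s - a)) volume x y :=
      fun x y => (contDiff_smoothTransition_sub a).continuous.intervalIntegrable _ _
    have h1 : ramp a t = ramp a (a + 1) + ∫ s in (a + 1)..t, Real.smoothTransition (s - a) :=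
      (intervalIntegral.integral_add_adjacent_intervals (hi _ _) (hi _ _)).symm
    have h2 : ∫ s in (a + 1)..t, Real.smoothTransition (s - a) = ∫ s in (a + 1)..t, (1 : ℝ) :=
      intervalIntegral.integral_congr fun s hs => by
        rw [Set.uIcc_of_le h] at hs
        exact Real.smoothTransition.one_of_one_le (by linarith [hs.1])
    rw [h1, h2]
    have := ramp_nonneg ha (a + 1)
    simp
    linarith

/-- With η twice the ramp, this makes the smallest weight φ − 2η still dominate τ|z|². The ramp
starts one unit later, so its slope is bounded by that of the other function everywhere. -/
theorem four_mul_ramp_le_expRamp {K : ℝ} (hK : 4 ≤ K) (ha : 0 ≤ a) (t : ℝ) :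
    4 * ramp (a + 1) t ≤ expRamp a K t := by
  rcases le_total t 0 with h | h
  · rw [ramp_eq_zero (by linarith) (by linarith), expRamp_eq_zero ha (by linarith), mul_zero]
  · have e : 4 * ramp (a + 1) t
        = antideriv (fun s => 4 * Real.smoothTransition (s - (a + 1))) t :=
      (intervalIntegral.integral_const_mul _ _).symm
    rw [e]
    refine antideriv_mono
      (continuous_const.mul (contDiff_smoothTransition_sub _).continuous)
      (contDiff_expRamp_deriv a K).continuous h fun s hs => ?_
    have h1 : Real.smoothTransition (s - (a + 1)) ≤ Real.smoothTransition (s - a) :=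
      Real.smoothTransition.monotone (by linarith)
    have h2 : 1 ≤ Real.exp (2 * s) := Real.one_le_exp (by linarith)
    have h3 : 4 ≤ K * Real.exp (2 * s) := by nlinarith
    have h4 := Real.smoothTransition.nonneg (s - (a + 1))
    nlinarith

theorem deriv_expRamp (a K : ℝ) : deriv (expRamp a K)
    = fun s => Real.smoothTransition (s - a) * (K * Real.exp (2 * s)) :=
  deriv_antideriv (contDiff_expRamp_deriv a K).continuous

theorem deriv_deriv_expRamp_nonneg {K : ℝ} (hK : 0 ≤ K) (t : ℝ) :
    0 ≤ deriv (deriv (expRamp a K)) t := by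
  rw [deriv_expRamp]
  refine Monotone.deriv_nonneg (fun x y h => ?_)
  have := Real.smoothTransition.monotone (sub_le_sub_right h a)
  have h2 := Real.smoothTransition.nonneg (y - a)
  gcongr

theorem exists_bound_deriv_smoothTransition :
    ∃ D, 0 ≤ D ∧ ∀ t, |deriv Real.smoothTransition t| ≤ D := by
  have hc : Continuous (deriv Real.smoothTransition) :=
    (Real.smoothTransition.contDiff (n := 1)).continuous_deriv le_rfl
  obtain ⟨D, hD⟩ := (isCompact_Icc (a := (0 : ℝ)) (b := 1)).exists_bound_of_continuousOn
    hc.continuousOn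
  refine ⟨max D 0, le_max_right _ _, fun t => ?_⟩
  by_cases ht : t ∈ Set.Icc (0 : ℝ) 1
  · exact (hD t ht).trans (le_max_left _ _)
  · have : deriv Real.smoothTransition t = 0 := by
      rw [Set.mem_Icc, not_and_or, not_le, not_le] at ht
      rcases ht with h | h
      · have : Real.smoothTransition =ᶠ[𝓝 t] fun _ => 0 := by
          filter_upwards [gt_mem_nhds h] with s hs
          exact Real.smoothTransition.zero_of_nonpos hs.le
        rw [this.deriv_eq, deriv_const]
      · have : Real.smoothTransition =ᶠ[𝓝 t] fun _ => 1 := by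
          filter_upwards [lt_mem_nhds h] with s hs
          exact Real.smoothTransition.one_of_one_le hs.le
        rw [this.deriv_eq, deriv_const]
    rw [this, abs_zero]
    exact le_max_right _ _

variable {Ω : Set (Cn n)} {ψ : Cn n → ℝ} {C : ℝ}

theorem IsStrictExhaustion.exists_le (h : IsStrictExhaustion Ω ψ C) {K : Set (Cn n)}
    (hK : IsCompact K) (hKΩ : K ⊆ Ω) : ∃ c, ∀ z ∈ K, ψ z ≤ c := by
  obtain ⟨c, hc⟩ := hK.exists_bound_of_continuousOn (h.smooth.continuousOn.mono hKΩ)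
  exact ⟨c, fun z hz => (le_abs_self _).trans (hc z hz)⟩

open Classical in
/-- Cutoff functions built from an exhaustion function. -/
def exhaustionCutoff (Ω : Set (Cn n)) (ψ : Cn n → ℝ) (ν : ℕ) (z : Cn n) : ℝ :=
  if z ∈ Ω then 1 - Real.smoothTransition (ψ z - ν) else 0

theorem exhaustionCutoff_eventuallyEq (hΩ : IsOpen Ω) (ν : ℕ) {z : Cn n} (hz : z ∈ Ω) :
    exhaustionCutoff Ω ψ ν =ᶠ[𝓝 z] fun z => 1 - Real.smoothTransition (ψ z - ν) := by
  filter_upwards [hΩ.mem_nhds hz] with x hx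
  simp [exhaustionCutoff, hx]

theorem IsStrictExhaustion.isCutoffSeq (hΩ : IsOpen Ω) (h : IsStrictExhaustion Ω ψ C) :
    IsCutoffSeq Ω (exhaustionCutoff Ω ψ) := by
  have hsub : ∀ ν, tsupport (exhaustionCutoff Ω ψ ν) ⊆ {z | z ∈ Ω ∧ ψ z ≤ ν + 1} := by
    intro ν
    refine closure_minimal (fun z hz => ?_) (h.isCompact _).isClosed
    by_cases hzΩ : z ∈ Ω
    · refine ⟨hzΩ, ?_⟩
      by_contra hc
      refine hz ?_
      simp only [exhaustionCutoff, hzΩ, if_true]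
      rw [Real.smoothTransition.one_of_one_le (by linarith [not_le.1 hc]), sub_self]
    · exact absurd (by simp [exhaustionCutoff, hzΩ]) hz
  refine ⟨fun ν => contDiff_iff_contDiffAt.2 fun z => ?_, fun ν =>
    (h.isCompact _).of_isClosed_subset (isClosed_tsupport _) (hsub ν),
    fun ν z hz => (hsub ν hz).1, fun ν z => ?_, fun ν z => ?_, fun K hK hKΩ => ?_⟩
  · by_cases hz : z ∈ tsupport (exhaustionCutoff Ω ψ ν)
    · have hzΩ := (hsub ν hz).1
      refine ContDiffAt.congr_of_eventuallyEq ?_ (exhaustionCutoff_eventuallyEq hΩ ν hzΩ)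
      exact contDiffAt_const.sub (((contDiff_smoothTransition_sub (ν : ℝ)).contDiffAt).comp z
        (h.smooth.contDiffAt (hΩ.mem_nhds hzΩ)))
    · exact (contDiffAt_const (c := (0 : ℝ))).congr_of_eventuallyEq
        (notMem_tsupport_iff_eventuallyEq.1 hz)
  · rw [exhaustionCutoff]
    split_ifs
    · linarith [Real.smoothTransition.le_one (ψ z - ν)]
    · exact le_rfl
  · rw [exhaustionCutoff]
    split_ifs
    · linarith [Real.smoothTransition.nonneg (ψ z - ν)]
    · exact zero_le_one
  · obtain ⟨c, hc⟩ := h.exists_le hK hKΩ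
    filter_upwards [eventually_ge_atTop ⌈c + 1⌉₊] with ν hν z hz
    have hν' : c + 1 ≤ ν := (Nat.le_ceil _).trans (by exact_mod_cast hν)
    have hψz : ψ z < ν := by linarith [hc z hz]
    filter_upwards [exhaustionCutoff_eventuallyEq hΩ ν (hKΩ hz),
      (h.smooth.continuousOn.continuousAt (hΩ.mem_nhds (hKΩ hz))).eventually
        (gt_mem_nhds hψz)] with x hx hx2
    rw [hx, Real.smoothTransition.zero_of_nonpos (by linarith), sub_zero]

theorem sum_norm_dz_comp_sq {F : ℝ → ℝ} {z : Cn n} (hF : DifferentiableAt ℝ F (ψ z))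
    (hψ : DifferentiableAt ℝ ψ z) :
    ∑ j, ‖dz j (fun z => ((F (ψ z) : ℝ) : ℂ)) z‖ ^ 2
      = deriv F (ψ z) ^ 2 * ∑ j, ‖dz j (fun z => (ψ z : ℂ)) z‖ ^ 2 := by
  rw [Finset.mul_sum]
  refine Finset.sum_congr rfl fun j _ => ?_
  rw [dz_comp hF hψ, norm_mul, mul_pow, norm_real, Real.norm_eq_abs, sq_abs]

/-- The gradient of the cutoff is at most const·e^ψ uniformly in ν, and ψ exceeds the ramp by at
most a + 1. The resulting constant depends on `a` but not on ν, which is all that removing the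
cutoffs requires. -/
theorem IsStrictExhaustion.grad_cutoff_le (hΩ : IsOpen Ω) (hC : 0 < C)
    (h : IsStrictExhaustion Ω ψ C) (a : ℝ) (ha : 0 ≤ a) : ∃ Λ, ∀ ν, ∀ z ∈ Ω,
    ∑ j, ‖dz j (fun z => (exhaustionCutoff Ω ψ ν z : ℂ)) z‖ ^ 2
      ≤ Λ * Real.exp (2 * ramp a (ψ z)) := by
  obtain ⟨D, hD0, hD⟩ := exists_bound_deriv_smoothTransition
  refine ⟨D ^ 2 * C * Real.exp (2 * (a + 1)), fun ν z hz => ?_⟩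
  have e : ∀ j, dz j (fun z => (exhaustionCutoff Ω ψ ν z : ℂ)) z
      = dz j (fun z => ((1 - Real.smoothTransition (ψ z - ν) : ℝ) : ℂ)) z := fun j => by
    refine dz_congr ?_
    filter_upwards [exhaustionCutoff_eventuallyEq hΩ ν hz] with x hx
    rw [hx]
  have hd : HasDerivAt (fun s : ℝ => 1 - Real.smoothTransition (s - ν))
      (-deriv Real.smoothTransition (ψ z - ν)) (ψ z) := by
    have h1 := ((Real.smoothTransition.contDiff (n := 1)).differentiable
      (by norm_num) (ψ z - ν)).hasDerivAt
    simpa using (h1.comp (ψ z) ((hasDerivAt_id (ψ z)).sub_const (ν : ℝ))).const_sub 1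
  simp only [e]
  rw [sum_norm_dz_comp_sq (F := fun s => 1 - Real.smoothTransition (s - ν)) hd.differentiableAt
    ((h.smooth.contDiffAt (hΩ.mem_nhds hz)).differentiableAt (by simp)), hd.deriv, neg_sq]
  have h1 : deriv Real.smoothTransition (ψ z - ν) ^ 2 ≤ D ^ 2 := by
    rw [← sq_abs]
    have := hD (ψ z - ν)
    gcongr
  have h2 : Real.exp (2 * ψ z) ≤ Real.exp (2 * (a + 1)) * Real.exp (2 * ramp a (ψ z)) := by
    rw [← Real.exp_add]
    gcongr
    linarith [sub_le_ramp ha (ψ z)]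
  calc _ ≤ D ^ 2 * (C * Real.exp (2 * ψ z)) :=
        mul_le_mul h1 (h.grad z hz) (Finset.sum_nonneg fun _ _ => by positivity) (by positivity)
    _ ≤ D ^ 2 * (C * (Real.exp (2 * (a + 1)) * Real.exp (2 * ramp a (ψ z)))) := by gcongr
    _ = _ := by ring

/-- Take η_m = 2·ramp(ψ), so that e^{η_m} dominates the gradients of the cutoffs, and φ_m = τ|z|² +
F_m(ψ) with F_m increasing and convex. Convexity makes the Levi form of φ_m at least (τ + F_m')|w|²,
and F_m' grows like e^{2ψ}, fast enough to beat 2|∂η_m|² + τe^{η_m}. Both η_m and F_m(ψ) vanish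
where ψ ≤ m, so the weights equal τ|z|² there. -/
theorem exists_weightSeq (hΩ : IsOpen Ω) (hC : 0 < C) (h : IsStrictExhaustion Ω ψ C) {τ : ℝ}
    (hτ : 0 < τ) : ∃ κ₁ κ₂ κ₃ : ℕ → Cn n → ℝ,
      IsWeightSeq Ω (fun z => τ * ‖z‖ ^ 2) κ₁ ∧ IsWeightSeq Ω (fun z => τ * ‖z‖ ^ 2) κ₂ ∧
      IsWeightSeq Ω (fun z => τ * ‖z‖ ^ 2) κ₃ ∧
      ∀ m, WeightedEstimate Ω (κ₁ m) (κ₂ m) (κ₃ m) τ := by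
  -- 8C covers 2|∂η|², τ covers τe^η, and 4 is what φ − 2η ≥ τ|z|² needs.
  set K := 8 * C + τ + 4 with hK
  -- The shift to m + 1 matters: when η starts to grow, the transition in F_m' has already reached
  -- 1, so F_m' = Ke^{2ψ} is fully available.
  set η : ℕ → Cn n → ℝ := fun m z => 2 * ramp (m + 1) (ψ z) with hη
  set φ : ℕ → Cn n → ℝ := fun m z => τ * ‖z‖ ^ 2 + expRamp m K (ψ z) with hφ
  have ha : ∀ m : ℕ, (0 : ℝ) ≤ m + 1 := fun m => by positivity
  have sR : ∀ a, ContDiff ℝ ∞ (ramp a) := fun a =>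
    contDiff_antideriv (contDiff_smoothTransition_sub a)
  have sE : ∀ a, ContDiff ℝ ∞ (expRamp a K) := fun a =>
    contDiff_antideriv (contDiff_expRamp_deriv a K)
  have sη : ∀ m, ContDiffOn ℝ ∞ (η m) Ω := fun m =>
    contDiffOn_const.mul ((sR _).comp_contDiffOn h.smooth)
  have sφ : ∀ m, ContDiffOn ℝ ∞ (φ m) Ω := fun m =>
    (contDiff_norm_sq_mul τ).contDiffOn.add ((sE _).comp_contDiffOn h.smooth)
  have hzero : ∀ K, IsCompact K → K ⊆ Ω → ∀ᶠ m : ℕ in atTop, ∀ z ∈ K,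
      η m z = 0 ∧ φ m z = τ * ‖z‖ ^ 2 := by
    intro K hK hKΩ
    obtain ⟨c, hc⟩ := h.exists_le hK hKΩ
    filter_upwards [eventually_ge_atTop ⌈c⌉₊] with m hm z hz
    have hm' : c ≤ m := (Nat.le_ceil _).trans (by exact_mod_cast hm)
    have := hc z hz
    simp only [hη, hφ]
    rw [ramp_eq_zero (ha m) (by linarith), expRamp_eq_zero (by positivity) (by linarith)]
    simp
  have hηnn : ∀ m z, 0 ≤ η m z := fun m z => mul_nonneg zero_le_two (ramp_nonneg (ha m) _)
  have hκ : ∀ m z, τ * ‖z‖ ^ 2 ≤ φ m z - 2 * η m z := fun m z => by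
    have := four_mul_ramp_le_expRamp (a := m) (K := K) (by linarith) (by positivity) (ψ z)
    simp only [hη, hφ]
    linarith
  refine ⟨fun m z => φ m z - 2 * η m z, fun m z => φ m z - η m z, φ,
    ⟨fun m => (sφ m).continuousOn.sub (continuousOn_const.mul (sη m).continuousOn),
      fun m z _ => hκ m z, fun K hK hKΩ => ?_⟩,
    ⟨fun m => (sφ m).continuousOn.sub (sη m).continuousOn,
      fun m z _ => by linarith [hκ m z, hηnn m z], fun K hK hKΩ => ?_⟩,
    ⟨fun m => (sφ m).continuousOn, fun m z _ => by linarith [hκ m z, hηnn m z],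
      fun K hK hKΩ => ?_⟩, fun m => ?_⟩
  · filter_upwards [hzero K hK hKΩ] with m hm z hz
    rw [(hm z hz).1, (hm z hz).2]; ring
  · filter_upwards [hzero K hK hKΩ] with m hm z hz
    rw [(hm z hz).1, (hm z hz).2]; ring
  · filter_upwards [hzero K hK hKΩ] with m hm z hz
    exact (hm z hz).2
  obtain ⟨Λ, hΛ⟩ := h.grad_cutoff_le hΩ hC (m + 1) (ha m)
  refine weightedEstimate_of_leviForm hΩ (sφ m) (sη m) hτ.le (fun z hz w => ?_)
    (h.isCutoffSeq hΩ) hΛ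
  have cψ : ContDiffAt ℝ 2 ψ z := (h.smooth.contDiffAt (hΩ.mem_nhds hz)).of_le (by norm_cast)
  have dψ : DifferentiableAt ℝ ψ z := cψ.differentiableAt (by norm_num)
  have hlevi : leviForm (φ m) z w = τ * ‖w‖ ^ 2 + (deriv (expRamp m K) (ψ z) * leviForm ψ z w
      + deriv (deriv (expRamp m K)) (ψ z) * ‖delPairing ψ z w‖ ^ 2) := by
    rw [← leviForm_comp ((sE _).contDiffAt.of_le (by norm_cast)) cψ, ← leviForm_norm_sq τ z w]
    exact leviForm_add ((contDiff_norm_sq_mul τ).contDiffAt.of_le (by norm_cast))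
        (((sE _).contDiffAt.of_le (by norm_cast)).comp z cψ)
  have hgrad : ∑ j, ‖dz j (fun z => (η m z : ℂ)) z‖ ^ 2
      ≤ 4 * Real.smoothTransition (ψ z - (m + 1)) * (C * Real.exp (2 * ψ z)) := by
    have hd : HasDerivAt (fun s => 2 * ramp (m + 1) s)
        (2 * Real.smoothTransition (ψ z - (m + 1))) (ψ z) :=
      (hasDerivAt_antideriv (contDiff_smoothTransition_sub _).continuous _).const_mul 2
    rw [sum_norm_dz_comp_sq (F := fun s => 2 * ramp (m + 1) s) hd.differentiableAt dψ, hd.deriv]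
    refine mul_le_mul ?_ (h.grad z hz) (Finset.sum_nonneg fun _ _ => by positivity) (by
      have := Real.smoothTransition.nonneg (ψ z - (m + 1)); positivity)
    have h1 := Real.smoothTransition.nonneg (ψ z - (m + 1))
    have h2 := Real.smoothTransition.le_one (ψ z - (m + 1))
    nlinarith
  have hkey : 2 * (4 * Real.smoothTransition (ψ z - (m + 1)) * (C * Real.exp (2 * ψ z)))
      + τ * Real.exp (η m z) ≤ τ + deriv (expRamp m K) (ψ z) := by
    rw [deriv_expRamp]
    simp only [hη]
    have hE := Real.exp_pos (2 * ψ z)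
    rcases le_total (ψ z) (m + 1) with h1 | h1
    · rw [ramp_eq_zero (ha m) h1, Real.smoothTransition.zero_of_nonpos (by linarith)]
      have := Real.smoothTransition.nonneg (ψ z - m)
      simp
      positivity
    · have hm0 : (0 : ℝ) ≤ m := by positivity
      rw [Real.smoothTransition.one_of_one_le (show 1 ≤ ψ z - m by linarith)]
      have h2 : Real.exp (2 * ramp (m + 1) (ψ z)) ≤ Real.exp (2 * ψ z) := by
        gcongr
        exact ramp_le (by linarith)
      have h3 := Real.smoothTransition.le_one (ψ z - (m + 1))
      have h4 : Real.smoothTransition (ψ z - (m + 1)) * (C * Real.exp (2 * ψ z))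
          ≤ 1 * (C * Real.exp (2 * ψ z)) := by gcongr
      have h5 := mul_le_mul_of_nonneg_left h2 hτ.le
      rw [hK]
      nlinarith
  have hχ : 0 ≤ deriv (expRamp m K) (ψ z) := by
    rw [deriv_expRamp]
    have := Real.smoothTransition.nonneg (ψ z - m)
    positivity
  have h1 := mul_le_mul_of_nonneg_left (h.levi z hz w) hχ
  have h2 := mul_nonneg (deriv_deriv_expRamp_nonneg (a := m) (K := K) (by positivity) (ψ z))
    (sq_nonneg ‖delPairing ψ z w‖)
  have h3 : (2 * ∑ j, ‖dz j (fun z => (η m z : ℂ)) z‖ ^ 2 + τ * Real.exp (η m z)) * ‖w‖ ^ 2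
      ≤ (τ + deriv (expRamp m K) (ψ z)) * ‖w‖ ^ 2 := by
    refine mul_le_mul_of_nonneg_right ?_ (sq_nonneg _)
    linarith
  rw [hlevi]
  linarith

end Weights

/-! ### Distributional derivatives and C¹ coefficients. -/

section ProductRule

open Filter Topology

variable {Ω : Set (Cn n)} {g w p φ : Cn n → ℂ}

theorem TendstoL2.restrict {ι : Type*} {l : Filter ι} {F : ι → Cn n → ℂ} {f : Cn n → ℂ}
    (h : TendstoL2 F l f volume) (Ω : Set (Cn n)) : TendstoL2 F l f (volume.restrict Ω) :=
  ⟨fun i => (h.memLp i).restrict _, h.memLp_lim.restrict _,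
    tendsto_of_tendsto_of_tendsto_of_le_of_le tendsto_const_nhds h.tendsto (fun _ => zero_le)
      fun _ => eLpNorm_mono_measure _ Measure.restrict_le_self⟩

theorem dzbar_mollify_eq {ρ : Cn n → ℂ} (hρ : ContDiff ℝ ∞ ρ) (hρc : HasCompactSupport ρ)
    (hg : ContDiff ℝ 1 g) (hc : HasCompactSupport g) (j : Fin n) :
    dzbar j (mollify ρ g) = mollify ρ (dzbar j g) := by
  ext x
  rw [dzbar_mollify hρ hρc hg.continuous.locallyIntegrable]
  have hρx : ContDiff ℝ 1 (fun y => ρ (x - y)) :=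
    (hρ.of_le (by norm_cast)).comp (contDiff_const.sub contDiff_id)
  have hdg : Continuous (dzbar j g) := (hg.dzbar (m := 0) (by norm_num)).continuous
  have hdρ : Continuous (dzbar j (fun y => ρ (x - y))) :=
    (hρx.dzbar (m := 0) (by norm_num)).continuous
  have i1 : Integrable (fun y => dzbar j g y * ρ (x - y)) :=
    (hdg.mul hρx.continuous).integrable_of_hasCompactSupport hc.dzbar.mul_right
  have i2 : Integrable (fun y => g y * dzbar j (fun y => ρ (x - y)) y) :=
    (hg.continuous.mul hdρ).integrable_of_hasCompactSupport hc.mul_right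
  have h := integral_dzbar_eq_zero (j := j) (hg.mul hρx) hc.mul_right
  have e : ∀ y, dzbar j (fun y => g y * ρ (x - y)) y
      = dzbar j g y * ρ (x - y) + g y * dzbar j (fun y => ρ (x - y)) y := fun y =>
    dzbar_mul (hg.differentiable (by norm_num) y) (hρx.differentiable (by norm_num) y)
  have h' : ∫ y, (dzbar j g y * ρ (x - y) + g y * dzbar j (fun y => ρ (x - y)) y) = 0 := by
    rw [← h]; exact integral_congr_ae (ae_of_all _ fun y => (e y).symm)
  rw [integral_add i1 i2] at h'
  rw [neg_eq_iff_add_eq_zero, add_comm]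
  exact h'

/-- Mollification, with indices shifted until the supports fit into Ω. It is needed because ∂f/∂z_j
is only C¹, so its product with a test function is not an admissible test function. -/
theorem exists_test_approx (hΩ : IsOpen Ω) (hφ : ContDiff ℝ 1 φ) (hc : HasCompactSupport φ)
    (hs : tsupport φ ⊆ Ω) : ∃ F : ℕ → Cn n → ℂ, (∀ i, IsTestFunction Ω (F i)) ∧
      TendstoL2 F atTop φ volume ∧
      ∀ j, TendstoL2 (fun i => dzbar j (F i)) atTop (dzbar j φ) volume := by
  obtain ⟨δ, hδ, hδΩ⟩ := hc.isCompact.exists_cthickening_subset_open hΩ hs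
  obtain ⟨N, hN⟩ := eventually_atTop.1 (tendsto_one_div_add.eventually (gt_mem_nhds hδ))
  have hsub : ∀ i, N ≤ i → tsupport (mollify (molKer i) φ) ⊆ Ω := by
    intro i hi
    refine (closure_minimal (fun x hx => ?_) Metric.isClosed_cthickening).trans hδΩ
    by_contra hcon
    refine hx (mollify_eq_zero hφ.continuous.aestronglyMeasurable fun y hy => ?_)
    by_contra hy0
    refine hcon (Metric.mem_cthickening_of_dist_le x y δ _ (subset_tsupport _ hy0) ?_)
    rw [dist_comm]
    exact (Metric.mem_ball.1 hy).le.trans (hN i hi).le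
  have hL := memLp_of_hasCompactSupport hφ.continuous hc
  have hd : ∀ j, Continuous (dzbar j φ) := fun j => (hφ.dzbar (m := 0) (by norm_num)).continuous
  have hshift : Tendsto (fun i => i + N) atTop atTop := tendsto_add_atTop_nat N
  refine ⟨fun i => mollify (molKer (i + N)) φ, fun i => ⟨contDiff_mollify (molKer_smooth _)
    (molKer_hasCompactSupport _) hφ.continuous.locallyIntegrable,
    hasCompactSupport_mollify (molKer_hasCompactSupport _) hc, hsub _ (by omega)⟩, ?_, fun j => ?_⟩
  · have h := tendstoL2_mollify hL hc
    exact ⟨fun i => h.memLp _, h.memLp_lim, h.tendsto.comp hshift⟩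
  · have h := tendstoL2_mollify (memLp_of_hasCompactSupport (hd j) hc.dzbar) hc.dzbar
    have e : ∀ i, dzbar j (mollify (molKer (i + N)) φ) = mollify (molKer (i + N)) (dzbar j φ) :=
      fun i => dzbar_mollify_eq (molKer_smooth _) (molKer_hasCompactSupport _) hφ hc j
    simp only [e]
    exact ⟨fun i => h.memLp _, h.memLp_lim, h.tendsto.comp hshift⟩

/-- A distributional identity extends to `C¹` test functions. -/
theorem weak_dzbar_of_contDiff_one (hΩ : IsOpen Ω) (hg : MemL2 Ω g) (hw : MemL2 Ω w) {j : Fin n}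
    (h : ∀ φ, IsTestFunction Ω φ → ∫ z in Ω, g z * dzbar j φ z = -∫ z in Ω, w z * φ z)
    (hφ : ContDiff ℝ 1 φ) (hc : HasCompactSupport φ) (hs : tsupport φ ⊆ Ω) :
    ∫ z in Ω, g z * dzbar j φ z = -∫ z in Ω, w z * φ z := by
  obtain ⟨F, hF, hFφ, hFd⟩ := exists_test_approx hΩ hφ hc hs
  have key : ∀ {g : Cn n → ℂ} {F : ℕ → Cn n → ℂ} {φ : Cn n → ℂ}, MemL2 Ω g →
      TendstoL2 F atTop φ volume →
      Tendsto (fun i => ∫ z in Ω, g z * F i z) atTop (𝓝 (∫ z in Ω, g z * φ z)) := by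
    intro g F φ hg hF
    have := (hF.restrict Ω).integral_mul_star (TendstoL2.const (memLp_star hg))
    simpa only [star_star, mul_comm] using this
  refine tendsto_nhds_unique (key hg (hFd j)) ?_
  exact (key hw hFφ).neg.congr fun i => (h _ (hF i)).symm

theorem continuous_test_mul (hΩ : IsOpen Ω) (hφ : IsTestFunction Ω φ) (hp : ContinuousOn p Ω) :
    Continuous (fun z => φ z * p z) :=
  continuous_of_tsupport fun _ hz => hφ.smooth.continuous.continuousAt.mul
    (hp.continuousAt (hΩ.mem_nhds (hφ.tsupport_subset (tsupport_mul_subset hz))))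

theorem memLp_test_mul (hΩ : IsOpen Ω) (hφ : IsTestFunction Ω φ) (hp : ContinuousOn p Ω) :
    MemLp (fun z => φ z * p z) 2 (volume.restrict Ω) :=
  (memLp_of_hasCompactSupport (continuous_test_mul hΩ hφ hp)
    hφ.hasCompactSupport.mul_right).restrict _

theorem continuousOn_dzbar (hΩ : IsOpen Ω) (hp : ContDiffOn ℝ 1 p Ω) (j : Fin n) :
    ContinuousOn (dzbar j p) Ω := fun z hz =>
  (ContDiffAt.dzbar (m := 0) (hp.contDiffAt (hΩ.mem_nhds hz))
    (by norm_num)).continuousAt.continuousWithinAt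

/-- The product rule for the distributional `∂̄` with a `C¹` coefficient. -/
theorem weak_dzbar_mul (hΩ : IsOpen Ω) (hg : MemL2 Ω g) (hw : MemL2 Ω w) {j : Fin n}
    (h : ∀ φ, IsTestFunction Ω φ → ∫ z in Ω, g z * dzbar j φ z = -∫ z in Ω, w z * φ z)
    (hp : ContDiffOn ℝ 1 p Ω) (hφ : IsTestFunction Ω φ) :
    ∫ z in Ω, (p z * g z) * dzbar j φ z = -∫ z in Ω, (p z * w z + dzbar j p z * g z) * φ z := by
  have hs : tsupport (fun z => φ z * p z) ⊆ Ω := tsupport_mul_subset.trans hφ.tsupport_subset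
  have hC1 : ContDiff ℝ 1 (fun z => φ z * p z) := by
    refine contDiff_iff_contDiffAt.2 fun z => ?_
    by_cases hz : z ∈ tsupport φ
    · exact (hφ.smooth.of_le (by norm_cast)).contDiffAt.mul
        (hp.contDiffAt (hΩ.mem_nhds (hφ.tsupport_subset hz)))
    · refine (contDiffAt_const (c := (0 : ℂ))).congr_of_eventuallyEq ?_
      filter_upwards [notMem_tsupport_iff_eventuallyEq.1 hz] with x hx
      simp [hx]
  have h1 := weak_dzbar_of_contDiff_one hΩ hg hw h hC1 hφ.hasCompactSupport.mul_right hs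
  have i1 : Integrable (fun z => g z * (dzbar j φ z * p z)) (volume.restrict Ω) :=
    integrable_mul_of_memLp hg (memLp_test_mul hΩ (hφ.dzbar j) hp.continuousOn)
  have i2 : Integrable (fun z => g z * (φ z * dzbar j p z)) (volume.restrict Ω) :=
    integrable_mul_of_memLp hg (memLp_test_mul hΩ hφ (continuousOn_dzbar hΩ hp j))
  have i3 : Integrable (fun z => w z * (φ z * p z)) (volume.restrict Ω) :=
    integrable_mul_of_memLp hw (memLp_test_mul hΩ hφ hp.continuousOn)
  have e1 : ∫ z in Ω, g z * dzbar j (fun z => φ z * p z) z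
      = (∫ z in Ω, g z * (dzbar j φ z * p z)) + ∫ z in Ω, g z * (φ z * dzbar j p z) := by
    rw [← integral_add i1 i2]
    refine setIntegral_congr_fun hΩ.measurableSet fun z hz => ?_
    rw [dzbar_mul (hφ.smooth.differentiable (by simp) z)
      ((hp.contDiffAt (hΩ.mem_nhds hz)).differentiableAt (by norm_num))]
    ring
  have e2 : ∫ z in Ω, (p z * w z + dzbar j p z * g z) * φ z
      = (∫ z in Ω, w z * (φ z * p z)) + ∫ z in Ω, g z * (φ z * dzbar j p z) := by
    rw [← integral_add i3 i2]
    refine integral_congr_ae (ae_of_all _ fun z => ?_)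
    ring
  have e3 : ∫ z in Ω, (p z * g z) * dzbar j φ z = ∫ z in Ω, g z * (dzbar j φ z * p z) :=
    integral_congr_ae (ae_of_all _ fun z => by ring)
  rw [e1] at h1
  rw [e2, e3]
  linear_combination h1

theorem memL2_mul_of_bounded (hΩ : IsOpen Ω) (hp : ContinuousOn p Ω) {M : ℝ}
    (hM : ∀ z ∈ Ω, ‖p z‖ ≤ M) (hg : MemL2 Ω g) : MemL2 Ω (fun z => p z * g z) := by
  refine MemLp.of_le_mul hg ((hp.aestronglyMeasurable hΩ.measurableSet).mul
    hg.aestronglyMeasurable) (c := M) (ae_restrict_of_forall_mem hΩ.measurableSet fun z hz => ?_)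
  rw [norm_mul]
  gcongr
  exact hM z hz

theorem normSqL2_mul_le (hΩ : IsOpen Ω) (hp : ContinuousOn p Ω) {M : ℝ}
    (hM : ∀ z ∈ Ω, ‖p z‖ ≤ M) (hg : MemL2 Ω g) :
    normSqL2 Ω (fun z => p z * g z) ≤ M ^ 2 * normSqL2 Ω g := by
  rw [normSqL2, normSqL2, ← integral_const_mul]
  refine setIntegral_mono_on (integrable_normSq (memL2_mul_of_bounded hΩ hp hM hg))
    ((integrable_normSq hg).const_mul _) hΩ.measurableSet fun z hz => ?_
  rw [norm_mul, mul_pow]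
  have := hM z hz
  gcongr

/-- Through the defining identity of the adjoint, stability of Dom(∂̄) under such multipliers also
yields the rules for ∂̄* with a weight and for ∂̄*(fu). -/
theorem IsDbarFun.mul (hΩ : IsOpen Ω) {w : Fin n → Cn n → ℂ} (h : IsDbarFun Ω g w)
    (hp : ContDiffOn ℝ 1 p Ω) {M : ℝ} (hM : ∀ z ∈ Ω, ‖p z‖ ≤ M)
    (hM' : ∀ j, ∀ z ∈ Ω, ‖dzbar j p z‖ ≤ M) :
    IsDbarFun Ω (fun z => p z * g z) (fun j z => p z * w j z + dzbar j p z * g z) :=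
  ⟨memL2_mul_of_bounded hΩ hp.continuousOn hM h.memL2, fun j =>
    (memL2_mul_of_bounded hΩ hp.continuousOn hM (h.memL2_dbar j)).add
      (memL2_mul_of_bounded hΩ (continuousOn_dzbar hΩ hp j) (hM' j) h.memL2),
    fun j _ hφ => weak_dzbar_mul hΩ h.memL2 (h.memL2_dbar j) (h.weak j) hp hφ⟩

end ProductRule

/-! ### Antisymmetric coefficients of ∂̄u and Riesz representation of weak derivatives. -/

section BasicEstimate

open Filter Topology

variable {Ω : Set (Cn n)} {φ ψ : Cn n → ℂ}

theorem normSqL2_nonneg (Ω : Set (Cn n)) (g : Cn n → ℂ) : 0 ≤ normSqL2 Ω g :=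
  integral_nonneg fun z => by positivity

theorem normSqForm2_nonneg (Ω : Set (Cn n)) (G : Fin n → Fin n → Cn n → ℂ) :
    0 ≤ normSqForm2 Ω G :=
  Finset.sum_nonneg fun _ _ => Finset.sum_nonneg fun _ _ => normSqL2_nonneg _ _

theorem normSqL2_neg (Ω : Set (Cn n)) (g : Cn n → ℂ) :
    normSqL2 Ω (fun z => -g z) = normSqL2 Ω g := by
  simp [normSqL2]

theorem normSqL2_add_le {f g : Cn n → ℂ} (hf : MemL2 Ω f) (hg : MemL2 Ω g) :
    normSqL2 Ω (fun z => f z + g z) ≤ 2 * normSqL2 Ω f + 2 * normSqL2 Ω g := by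
  rw [normSqL2, normSqL2, normSqL2, ← integral_const_mul, ← integral_const_mul,
    ← integral_add ((integrable_normSq hf).const_mul 2) ((integrable_normSq hg).const_mul 2)]
  have i1 : Integrable (fun z => ‖f z + g z‖ ^ 2) (volume.restrict Ω) :=
    integrable_normSq (MemLp.add hf hg)
  exact integral_mono i1 (((integrable_normSq hf).const_mul 2).add
    ((integrable_normSq hg).const_mul 2)) fun z => norm_add_sq_le_two _ _

/-- The `(0,2)`-form with antisymmetric coefficients that agrees with `G` for `j < k`. -/
def antisymm (G : Fin n → Fin n → Cn n → ℂ) (j k : Fin n) : Cn n → ℂ :=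
  if j < k then G j k else if k < j then fun z => -G k j z else fun _ => 0

theorem IsDbarForm.memL2_antisymm {u : Fin n → Cn n → ℂ} {G : Fin n → Fin n → Cn n → ℂ}
    (h : IsDbarForm Ω u G) (j k : Fin n) : MemL2 Ω (antisymm G j k) := by
  unfold antisymm
  split_ifs
  · exact h.memL2_dbar j k
  · exact (h.memL2_dbar k j).neg
  · exact MemLp.zero

/-- `normSqForm2` counts only the entries with j < k. The equation for (k, j) is the negative of
that for (j, k), so the other entries can be rebuilt from these without invoking uniqueness of
distributional derivatives. -/
theorem IsDbarForm.weakDbar_antisymm {u : Fin n → Cn n → ℂ} {G : Fin n → Fin n → Cn n → ℂ}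
    (h : IsDbarForm Ω u G) : WeakDbar Ω u (antisymm G) := by
  intro j k φ hφ
  unfold antisymm
  split_ifs with h1 h2
  · exact h.weak j k φ hφ
  · have := h.weak k j φ hφ
    have e : ∫ z in Ω, (u k z * dzbar j φ z - u j z * dzbar k φ z)
        = -∫ z in Ω, (u j z * dzbar k φ z - u k z * dzbar j φ z) := by
      rw [← integral_neg]; exact integral_congr_ae (ae_of_all _ fun z => by ring)
    rw [e, this, ← integral_neg]
    congr 1
    exact integral_congr_ae (ae_of_all _ fun z => by ring)
  · obtain rfl : j = k := le_antisymm (not_lt.1 h2) (not_lt.1 h1)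
    simp

theorem half_sum_normSq_antisymm (G : Fin n → Fin n → Cn n → ℂ) :
    1 / 2 * ∑ j, ∑ k, normSqL2 Ω (antisymm G j k) = normSqForm2 Ω G := by
  have h0 : normSqL2 Ω (fun _ : Cn n => (0 : ℂ)) = 0 := by simp [normSqL2]
  have e : ∀ j k, normSqL2 Ω (antisymm G j k)
      = (if j < k then normSqL2 Ω (G j k) else 0) + if k < j then normSqL2 Ω (G k j) else 0 := by
    intro j k
    unfold antisymm
    split_ifs with h1 h2 h2
    · exact absurd (h1.trans h2) (lt_irrefl _)
    · simp
    · simp [normSqL2_neg]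
    · simp [h0]
  simp only [e, Finset.sum_add_distrib]
  rw [Finset.sum_comm (f := fun j k => if k < j then normSqL2 Ω (G k j) else 0), normSqForm2]
  have e2 : ∀ j, ∑ k, (if j < k then normSqL2 Ω (G j k) else 0)
      = ∑ k ∈ Finset.Ioi j, normSqL2 Ω (G j k) := fun j => by
    rw [← Finset.sum_filter]
    congr 1; ext k; simp
  simp only [e2]
  ring

theorem IsTestFunction.zero (Ω : Set (Cn n)) : IsTestFunction Ω (fun _ => 0) :=
  ⟨contDiff_const, HasCompactSupport.zero, by simp [tsupport, Function.support]⟩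

theorem IsTestFunction.add (h : IsTestFunction Ω φ) (h' : IsTestFunction Ω ψ) :
    IsTestFunction Ω (fun z => φ z + ψ z) :=
  ⟨h.smooth.add h'.smooth, h.hasCompactSupport.add h'.hasCompactSupport,
    (tsupport_add φ ψ).trans (Set.union_subset h.tsupport_subset h'.tsupport_subset)⟩

theorem IsTestFunction.const_mul (h : IsTestFunction Ω φ) (c : ℂ) :
    IsTestFunction Ω (fun z => c * φ z) := by
  have := h.mul_left (f := fun _ => c) contDiff_const
  simpa only [mul_comm] using this

theorem IsTestFunction.memLp (h : IsTestFunction Ω φ) : MemLp φ 2 (volume.restrict Ω) :=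
  (memLp_of_hasCompactSupport h.smooth.continuous h.hasCompactSupport).restrict _

/-- The graph of `∂/∂z_k` on test functions. -/
def dzGraph (Ω : Set (Cn n)) (k : Fin n) : Submodule ℂ (L2Fun Ω × L2Fun Ω) where
  carrier := {p | ∃ (φ : Cn n → ℂ) (h : IsTestFunction Ω φ),
    p = (h.memLp.toLp φ, (h.dz k).memLp.toLp (dz k φ))}
  zero_mem' := by
    refine ⟨_, IsTestFunction.zero Ω, ?_⟩
    have : dz k (fun _ : Cn n => (0 : ℂ)) = fun _ => 0 := by ext z; simp
    simp only [this]
    rfl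
  add_mem' := by
    rintro _ _ ⟨φ, h, rfl⟩ ⟨ψ, h', rfl⟩
    refine ⟨_, h.add h', Prod.ext rfl ?_⟩
    simp only [Prod.snd_add]
    rw [← MemLp.toLp_add]
    congr 1
    ext z
    exact (dz_add (h.smooth.differentiable (by simp) z)
      (h'.smooth.differentiable (by simp) z)).symm
  smul_mem' := by
    rintro c _ ⟨φ, h, rfl⟩
    refine ⟨_, h.const_mul c, Prod.ext rfl ?_⟩
    simp only [Prod.smul_snd]
    rw [← MemLp.toLp_const_smul]
    congr 1
    ext z
    exact (dz_const_mul c (h.smooth.differentiable (by simp) z)).symm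

/-- The hypothesis says that ∂φ/∂z_k ↦ (u, ∂φ/∂z_k) is bounded by the L² norm of φ, so Riesz
represents it by an L² function, which up to sign is the weak derivative. Here the dual estimate
becomes an estimate of ∂u/∂z̄_k. -/
theorem exists_weak_dzbar {u : Cn n → ℂ} (hu : MemL2 Ω u) {k : Fin n} {C : ℝ} (hC : 0 ≤ C)
    (h : ∀ φ, IsTestFunction Ω φ →
      ‖∫ z in Ω, u z * star (dz k φ z)‖ ^ 2 ≤ C * normSqL2 Ω φ) :
    ∃ V, MemL2 Ω V ∧ normSqL2 Ω V ≤ C ∧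
      ∀ φ, IsTestFunction Ω φ → ∫ z in Ω, u z * dzbar k φ z = -∫ z in Ω, V z * φ z := by
  have hu' : MemLp u 2 (volume.restrict Ω) := hu
  obtain ⟨g, hg, hgS⟩ := exists_inner_eq_of_norm_inner_le (dzGraph Ω k) (hu'.toLp u)
    (C := √C) (Real.sqrt_nonneg _) (by
      rintro _ _ ⟨φ, hφ, he⟩
      obtain ⟨rfl, rfl⟩ := Prod.ext_iff.1 he
      have a := inner_toLp_eq hu' (hφ.dz k).memLp
      rw [norm_inner_symm]
      refine (pow_le_pow_iff_left₀ (norm_nonneg _) (by positivity) two_ne_zero).1 ?_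
      rw [mul_pow, Real.sq_sqrt hC]
      refine (congrArg (fun x : ℂ => ‖x‖ ^ 2) a).trans_le ((h φ hφ).trans_eq ?_)
      exact congrArg (C * ·) (norm_toLp_sq hφ.memLp).symm)
  refine ⟨fun z => -g z, (Lp.memLp g).neg, ?_, fun φ hφ => ?_⟩
  · rw [normSqL2_neg]
    have : normSqL2 Ω g = ‖g‖ ^ 2 := by
      rw [← Lp.toLp_coeFn g (Lp.memLp g)]
      refine Eq.trans ?_ (norm_toLp_sq _).symm
      rw [Lp.toLp_coeFn]; rfl
    rw [this]
    calc ‖g‖ ^ 2 ≤ √C ^ 2 := by gcongr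
      _ = C := Real.sq_sqrt hC
  · have h1 := hgS _ _ ⟨_, hφ.star, rfl⟩
    rw [← inner_conj_symm, ← inner_conj_symm (hu'.toLp u)] at h1
    have h2 := (starRingEnd ℂ).injective h1
    have a1 := inner_toLp_eq (Lp.memLp g) hφ.star.memLp
    rw [Lp.toLp_coeFn] at a1
    rw [a1, inner_toLp_eq hu' (hφ.star.dz k).memLp] at h2
    simp only [star_star, dz_star] at h2
    rw [← h2, ← integral_neg]
    exact integral_congr_ae (ae_of_all _ fun z => by ring)

end BasicEstimate

/-! ### The basic estimate on a pseudoconvex domain. -/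

section BasicEstimate

open Filter Topology

variable {Ω : Set (Cn n)} {κ : Cn n → ℝ} {f : Cn n → ℂ} {c τ R : ℝ}

theorem integrableOn_normSq_mul_exp (hΩ : IsOpen Ω) (hκ : ContinuousOn κ Ω)
    (h : ∀ z ∈ Ω, Real.exp (-κ z) ≤ c) (hf : MemL2 Ω f) :
    IntegrableOn (fun z => ‖f z‖ ^ 2 * Real.exp (-κ z)) Ω := by
  refine ((integrable_normSq hf).const_mul c).mono' ((hf.aestronglyMeasurable.norm.pow 2).mul
    ((Real.continuous_exp.comp_continuousOn hκ.neg).aestronglyMeasurable hΩ.measurableSet))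
    (ae_restrict_of_forall_mem hΩ.measurableSet fun z hz => ?_)
  rw [Real.norm_of_nonneg (by positivity), mul_comm]
  have := h z hz
  gcongr

theorem normSqW_le_mul_normSqL2 (hΩ : IsOpen Ω) (hκ : ContinuousOn κ Ω)
    (h : ∀ z ∈ Ω, Real.exp (-κ z) ≤ c) (hf : MemL2 Ω f) :
    normSqW Ω κ f ≤ c * normSqL2 Ω f := by
  rw [normSqW, normSqL2, ← integral_const_mul]
  refine setIntegral_mono_on (integrableOn_normSq_mul_exp hΩ hκ h hf)
    ((integrable_normSq hf).const_mul c) hΩ.measurableSet fun z hz => ?_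
  rw [mul_comm]
  have := h z hz
  gcongr

theorem normSqL2_le_mul_normSqW (hΩ : IsOpen Ω) (hκ : ContinuousOn κ Ω) (h0 : ∀ z ∈ Ω, 0 ≤ κ z)
    (h : ∀ z ∈ Ω, 1 ≤ c * Real.exp (-κ z)) (hf : MemL2 Ω f) :
    normSqL2 Ω f ≤ c * normSqW Ω κ f := by
  rw [normSqW, normSqL2, ← integral_const_mul]
  refine setIntegral_mono_on (integrable_normSq hf) ((integrableOn_normSq_mul_exp (c := 1) hΩ hκ
    (fun z hz => Real.exp_le_one_iff.2 (neg_nonpos.2 (h0 z hz))) hf).const_mul c)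
    hΩ.measurableSet fun z hz => ?_
  have := h z hz
  nlinarith [sq_nonneg ‖f z‖]

/-- The adjoint of `∂̄` with respect to the weight `e^{-τ|z|²}`. -/
theorem IsDbarAdjoint.weighted (hΩ : IsOpen Ω) (hR : ∀ z ∈ Ω, ‖z‖ ≤ R) (hτ : 0 ≤ τ)
    {u : Fin n → Cn n → ℂ} {v : Cn n → ℂ} (h : IsDbarAdjoint Ω u v) :
    (∀ j, MemL2 Ω (fun z => star (z j) * u j z)) ∧
    ∀ g w, IsDbarFun Ω g w →
      ∑ j, ∫ z in Ω, u j z * star (w j z) * (Real.exp (-(τ * ‖z‖ ^ 2)) : ℝ)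
        = ∫ z in Ω, (v z + τ * ∑ j, star (z j) * u j z) * star (g z)
            * (Real.exp (-(τ * ‖z‖ ^ 2)) : ℝ) := by
  have hzu : ∀ j, MemL2 Ω (fun z => star (z j) * u j z) := fun j =>
    memL2_mul_of_bounded (M := R) hΩ (by fun_prop) (fun z hz => by
      rw [norm_star]; exact (PiLp.norm_apply_le z j).trans (hR z hz)) (h.memL2 j)
  refine ⟨hzu, fun g w hgw => ?_⟩
  -- Apply the unweighted adjoint relation to pg; the derivative of this exponential factor produces
  -- the term τ∑ z̄_j u_j.
  set p : Cn n → ℂ := fun z => ((Real.exp (-(τ * ‖z‖ ^ 2)) : ℝ) : ℂ) with hp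
  have hpn : ∀ z, ‖p z‖ ≤ 1 := fun z => by
    rw [hp, norm_real, Real.norm_eq_abs, Real.abs_exp, Real.exp_le_one_iff]
    simp only [Left.neg_nonpos_iff]; positivity
  have hps : ContDiff ℝ 1 p := (contDiff_ofReal (Real.contDiff_exp.comp
    (contDiff_norm_sq_mul τ).neg)).of_le (by norm_cast)
  have hpd : ∀ j z, dzbar j p z = -(τ * z j) * p z := by
    intro j z
    have := dzbar_comp (j := j) (F := fun s : ℝ => Real.exp (-s)) (ψ := fun z : Cn n => τ * ‖z‖ ^ 2)
      (z := z) (by fun_prop) ((contDiff_norm_sq_mul τ).differentiable (by simp) z)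
    rw [dzbar_norm_sq] at this
    rw [hp, this]
    have hd : deriv (fun s : ℝ => Real.exp (-s)) (τ * ‖z‖ ^ 2) = -Real.exp (-(τ * ‖z‖ ^ 2)) := by
      have := ((hasDerivAt_id (τ * ‖z‖ ^ 2)).neg).exp
      simpa using this.deriv
    rw [hd]; push_cast; ring
  have hpg := hgw.mul hΩ hps.contDiffOn (M := 1 + τ * |R|) (fun z _ => (hpn z).trans (by
    have := mul_nonneg hτ (abs_nonneg R); linarith)) (fun j z hz => by
      rw [hpd, norm_mul, norm_neg, norm_mul, norm_real, Real.norm_of_nonneg hτ]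
      have h1 : ‖z j‖ ≤ |R| := (PiLp.norm_apply_le z j).trans ((hR z hz).trans (le_abs_self R))
      calc τ * ‖z j‖ * ‖p z‖ ≤ τ * |R| * 1 := by gcongr; exact hpn z
        _ ≤ _ := by linarith)
  have h1 := h.adjoint _ _ hpg
  simp only [innerL2, hpd] at h1
  have hpm : ∀ {f : Cn n → ℂ}, MemL2 Ω f → MemL2 Ω (fun z => p z * f z) := fun hf =>
    memL2_mul_of_bounded hΩ hps.continuous.continuousOn (fun z _ => hpn z) hf
  have hpstar : ∀ z, star (p z) = p z := fun z => by simp only [hp, star_def, conj_ofReal]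
  have i1 : ∀ j, Integrable (fun z => u j z * star (w j z) * p z) (volume.restrict Ω) := fun j =>
    (integrable_mul_star (h.memL2 j) (hpm (hgw.memL2_dbar j))).congr (ae_of_all _ fun z => by
      simp only [star_mul', hpstar]; ring)
  have i2 : ∀ j, Integrable (fun z => (star (z j) * u j z) * star (g z) * p z)
      (volume.restrict Ω) := fun j =>
    (integrable_mul_star (hzu j) (hpm hgw.memL2)).congr (ae_of_all _ fun z => by
      simp only [star_mul', hpstar]; ring)
  have i3 : Integrable (fun z => v z * star (g z) * p z) (volume.restrict Ω) :=
    (integrable_mul_star h.memL2_adjoint (hpm hgw.memL2)).congr (ae_of_all _ fun z => by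
      simp only [star_mul', hpstar]; ring)
  have e1 : ∀ j, ∫ z in Ω, u j z * star (p z * w j z + -(τ * z j) * p z * g z)
      = (∫ z in Ω, u j z * star (w j z) * p z)
        - τ * ∫ z in Ω, (star (z j) * u j z) * star (g z) * p z := by
    intro j
    rw [← integral_const_mul, ← integral_sub (i1 j) ((i2 j).const_mul _)]
    refine integral_congr_ae (ae_of_all _ fun z => ?_)
    simp only [star_add, star_mul', star_neg, hpstar]
    simp only [star_def, conj_ofReal]
    ring
  have e2 : ∫ z in Ω, v z * star (p z * g z) = ∫ z in Ω, v z * star (g z) * p z :=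
    integral_congr_ae (ae_of_all _ fun z => by simp only [star_mul', hpstar]; ring)
  have e3 : ∫ z in Ω, (v z + τ * ∑ j, star (z j) * u j z) * star (g z) * p z
      = (∫ z in Ω, v z * star (g z) * p z)
        + τ * ∑ j, ∫ z in Ω, (star (z j) * u j z) * star (g z) * p z := by
    rw [← integral_finsetSum _ fun j _ => i2 j, ← integral_const_mul,
      ← integral_add i3 ((integrable_finsetSum _ fun j _ => i2 j).const_mul _)]
    refine integral_congr_ae (ae_of_all _ fun z => ?_)
    simp only [add_mul, Finset.mul_sum, Finset.sum_mul, mul_assoc]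
  simp only [e1, Finset.sum_sub_distrib, ← Finset.mul_sum] at h1
  rw [e2] at h1
  rw [e3, ← h1]
  ring

/-- Use `limit_estimate` with the bounded weight τ|z|², for which weighted and unweighted norms are
comparable. Relative to it the adjoint of `u` is ∂̄*u + τ∑ z̄_j u_j; on a bounded domain and for
small τ the extra term is absorbed by τ‖u‖² on the left. -/
theorem basic_estimate (hΩ : IsSmoothBoundedPseudoconvexDomain Ω) :
    ∃ C, 0 ≤ C ∧ ∀ u G v, IsDbarForm Ω u G → IsDbarAdjoint Ω u v →
      normSqForm Ω u ≤ C * (normSqForm2 Ω G + normSqL2 Ω v) ∧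
      ∃ V : Fin n → Fin n → Cn n → ℂ, (∀ j k, MemL2 Ω (V j k)) ∧
        (∀ j k φ, IsTestFunction Ω φ →
          ∫ z in Ω, u j z * dzbar k φ z = -∫ z in Ω, V j k z * φ z) ∧
        ∀ j k, normSqL2 Ω (V j k) ≤ C * (normSqForm2 Ω G + normSqL2 Ω v) := by
  have hO := hΩ.isOpen
  obtain ⟨ψ, Cψ, hC, hψ⟩ := exists_strictExhaustion hΩ
  obtain ⟨R, hR⟩ := hΩ.isBounded.exists_norm_le
  -- Chosen so that 8τR² ≤ 1. The zero-order term costs 4τ²R²N, which is then at most (τ/2)N. The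
  -- weight exponent also stays below 1, so e^{τ|z|²} ≤ e < 3 compares the norms.
  set τ : ℝ := 1 / (8 * (R ^ 2 + 1)) with hτdef
  have hτ : 0 < τ := by positivity
  have hτR : 8 * (τ * R ^ 2) ≤ 1 := by
    rw [hτdef, one_div, ← mul_assoc, mul_comm 8, mul_assoc, inv_mul_le_one₀ (by positivity)]
    linarith
  obtain ⟨κ₁, κ₂, κ₃, hκ₁, hκ₂, hκ₃, hE⟩ := exists_weightSeq hO hC hψ hτ
  set κ₀ : Cn n → ℝ := fun z => τ * ‖z‖ ^ 2 with hκ₀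
  have hc : ContinuousOn κ₀ Ω := (contDiff_norm_sq_mul τ).continuous.continuousOn
  have h0 : ∀ z ∈ Ω, 0 ≤ κ₀ z := fun z _ => by simp only [hκ₀]; positivity
  have hM : ∀ z ∈ Ω, κ₀ z ≤ 1 := fun z hz => by
    have : ‖z‖ ^ 2 ≤ R ^ 2 := by have := hR z hz; gcongr
    have := mul_le_mul_of_nonneg_left this hτ.le
    simp only [hκ₀]; linarith [mul_nonneg hτ.le (sq_nonneg R)]
  have he1 : ∀ z ∈ Ω, Real.exp (-κ₀ z) ≤ 1 := fun z hz =>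
    Real.exp_le_one_iff.2 (neg_nonpos.2 (h0 z hz))
  have he2 : ∀ z ∈ Ω, Real.exp (-(-κ₀ z)) ≤ 3 := fun z hz => by
    rw [neg_neg]
    exact (Real.exp_le_exp.2 (hM z hz)).trans Real.exp_one_lt_three.le
  have he3 : ∀ z ∈ Ω, 1 ≤ 3 * Real.exp (-κ₀ z) := fun z hz => by
    have := he2 z hz
    rw [neg_neg] at this
    rw [Real.exp_neg, ← div_eq_mul_inv, one_le_div (Real.exp_pos _)]
    exact this
  refine ⟨24 / τ + 24, by positivity, fun u G v hG hv => ?_⟩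
  obtain ⟨hzu, hadj⟩ := hv.weighted hO hR hτ.le
  set b : Cn n → ℂ := fun z => v z + τ * ∑ j, star (z j) * u j z with hb
  have hsum : MemL2 Ω (fun z => ∑ j, star (z j) * u j z) := memLp_finsetSum _ fun j _ => hzu j
  have hbm : MemL2 Ω b := MemLp.add hv.memL2_adjoint (hsum.const_mul _)
  obtain ⟨hest, hdual⟩ := limit_estimate hτ hO hc h0 hM hκ₁ hκ₂ hκ₃ hE hG.memL2
    hG.memL2_antisymm hbm hG.weakDbar_antisymm hadj
  set Q := normSqForm2 Ω G + normSqL2 Ω v with hQ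
  set B := 2 * normSqW Ω κ₀ b + 1 / 2 * ∑ j, ∑ k, normSqW Ω κ₀ (antisymm G j k) with hB
  have hQ1 := normSqForm2_nonneg Ω G
  have hQ2 := normSqL2_nonneg Ω v
  set N := ∑ j, normSqW Ω κ₀ (u j) with hN
  have hGle : 1 / 2 * ∑ j, ∑ k, normSqW Ω κ₀ (antisymm G j k) ≤ normSqForm2 Ω G := by
    rw [← half_sum_normSq_antisymm G]
    refine mul_le_mul_of_nonneg_left (Finset.sum_le_sum fun j _ => Finset.sum_le_sum fun k _ => ?_)
      (by norm_num)
    have := normSqW_le_mul_normSqL2 hO hc he1 (hG.memL2_antisymm j k)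
    linarith
  have hble : normSqW Ω κ₀ b ≤ 2 * normSqL2 Ω v + 2 * (τ ^ 2 * R ^ 2 * N) := by
    have hi : ∀ {f : Cn n → ℂ}, MemL2 Ω f →
        IntegrableOn (fun z => ‖f z‖ ^ 2 * Real.exp (-κ₀ z)) Ω := fun hf =>
      integrableOn_normSq_mul_exp hO hc he1 hf
    have hNi : N = ∫ z in Ω, ∑ j, ‖u j z‖ ^ 2 * Real.exp (-κ₀ z) := by
      rw [integral_finsetSum _ fun j _ => hi (hG.memL2 j)]; rfl
    have h1 : normSqW Ω κ₀ v ≤ normSqL2 Ω v := by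
      simpa using normSqW_le_mul_normSqL2 hO hc he1 hv.memL2_adjoint
    have h2 : normSqW Ω κ₀ b ≤ 2 * normSqW Ω κ₀ v + 2 * (τ ^ 2 * R ^ 2 * N) := by
      rw [hNi, normSqW, normSqW, ← integral_const_mul, ← integral_const_mul, ← integral_const_mul,
        ← integral_add ((hi hv.memL2_adjoint).const_mul 2) (((integrable_finsetSum _ fun j _ =>
          hi (hG.memL2 j)).const_mul _).const_mul _)]
      refine setIntegral_mono_on (hi hbm) (((hi hv.memL2_adjoint).const_mul 2).add
        (((integrable_finsetSum _ fun j _ => hi (hG.memL2 j)).const_mul _).const_mul _))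
        hO.measurableSet fun z hz => ?_
      have h3 := norm_add_sq_le_two (v z) (τ * ∑ j, star (z j) * u j z)
      have h4 : ‖(τ : ℂ) * ∑ j, star (z j) * u j z‖ ^ 2 ≤ τ ^ 2 * R ^ 2 * ∑ j, ‖u j z‖ ^ 2 := by
        rw [norm_mul, mul_pow, norm_real, Real.norm_eq_abs, sq_abs, mul_assoc]
        refine mul_le_mul_of_nonneg_left ((norm_sum_mul_sq_le _ _).trans ?_) (sq_nonneg _)
        simp only [norm_star]
        rw [← EuclideanSpace.norm_sq_eq]
        have := hR z hz
        gcongr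
      have h5 : ‖b z‖ ^ 2 ≤ 2 * ‖v z‖ ^ 2 + 2 * (τ ^ 2 * R ^ 2 * ∑ j, ‖u j z‖ ^ 2) := by
        simp only [hb]; linarith
      have h6 := mul_le_mul_of_nonneg_right h5 (Real.exp_pos (-κ₀ z)).le
      refine h6.trans_eq ?_
      rw [← Finset.sum_mul]
      ring
    linarith
  -- Together with τN ≤ B this absorbs half of τN and yields both τN ≤ 8Q and B ≤ 8Q; the final
  -- constants 24/τ and 24 are these times the factor 3.
  have hBle : B ≤ 4 * Q + τ / 2 * N := by
    have h1 : τ ^ 2 * R ^ 2 * N ≤ τ / 8 * N := by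
      refine mul_le_mul_of_nonneg_right ?_ (Finset.sum_nonneg fun j _ => normSqW_nonneg _ _ _)
      nlinarith
    rw [hB, hQ]
    linarith
  have hNQ : τ * N ≤ 8 * Q := by linarith
  have hB8 : B ≤ 8 * Q := by linarith
  have hQ0 : 0 ≤ Q := add_nonneg hQ1 hQ2
  have hcoef : ∀ a : ℝ, a ≤ 24 / τ * Q ∨ a ≤ 24 * Q → a ≤ (24 / τ + 24) * Q := by
    intro a ha
    have : 0 ≤ 24 / τ * Q := by positivity
    rcases ha with ha | ha <;> linarith
  refine ⟨hcoef _ (Or.inl ?_), ?_⟩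
  · have h1 : normSqForm Ω u ≤ 3 * N := by
      rw [normSqForm, hN, Finset.mul_sum]
      exact Finset.sum_le_sum fun j _ => normSqL2_le_mul_normSqW hO hc h0 he3 (hG.memL2 j)
    rw [div_mul_eq_mul_div, le_div_iff₀ hτ]
    nlinarith
  · have hV : ∀ j k, ∃ V, MemL2 Ω V ∧ normSqL2 Ω V ≤ 3 * (8 * Q) ∧
        ∀ φ, IsTestFunction Ω φ → ∫ z in Ω, u j z * dzbar k φ z = -∫ z in Ω, V z * φ z := by
      intro j k
      refine exists_weak_dzbar (hG.memL2 j) (by positivity) fun φ hφ => ?_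
      -- A family `T` with a single nonzero entry isolates one derivative ∂u_j/∂z̄_k.
      have h1 := hdual (fun j' k' => if j' = j ∧ k' = k then φ else fun _ => 0) fun j' k' => by
        split_ifs
        · exact hφ
        · exact IsTestFunction.zero Ω
      have e1 : ∑ j', ∑ k', ∫ z in Ω, u j' z
          * star (dz k' (if j' = j ∧ k' = k then φ else fun _ => 0) z)
          = ∫ z in Ω, u j z * star (dz k φ z) := by
        rw [Finset.sum_eq_single j, Finset.sum_eq_single k]
        · simp
        · intro k' _ hk'; simp [hk']
        · simp
        · intro j' _ hj'; simp [hj']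
        · simp
      have e2 : ∑ j', ∑ k', normSqW Ω (fun z => -κ₀ z)
          (if j' = j ∧ k' = k then φ else fun _ => 0) = normSqW Ω (fun z => -κ₀ z) φ := by
        rw [Finset.sum_eq_single j, Finset.sum_eq_single k]
        · simp
        · intro k' _ hk'; simp [hk', normSqW]
        · simp
        · intro j' _ hj'; simp [hj', normSqW]
        · simp
      rw [e1, e2] at h1
      have h2 := normSqW_le_mul_normSqL2 hO hc.neg he2 hφ.memLp
      have h3 := normSqL2_nonneg Ω φ
      have h4 := normSqW_nonneg Ω (fun z => -κ₀ z) φ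
      calc _ ≤ _ := h1
        _ ≤ normSqW Ω (fun z => -κ₀ z) φ * (8 * Q) := mul_le_mul_of_nonneg_left hB8 h4
        _ ≤ 3 * normSqL2 Ω φ * (8 * Q) := mul_le_mul_of_nonneg_right h2 (by positivity)
        _ = _ := by ring
    choose V hVm hVb hVw using hV
    exact ⟨V, hVm, hVw, fun j k => hcoef _ (Or.inr ((hVb j k).trans (by linarith)))⟩

end BasicEstimate

/-! ### The commutator identity and the estimate of the contraction ∑_j (∂f/∂z_j) u_j. -/

section Multiplier

open Filter Topology

variable {Ω : Set (Cn n)} {f : Cn n → ℂ}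

/-- Being C² on the closed set provides, near each of its points, a Taylor series with continuous
coefficients up to the boundary. These are locally bounded, compactness makes the bound uniform, and
inside Ω they are the true derivatives. -/
theorem exists_bound_iteratedFDeriv (hΩ : IsOpen Ω) (hb : Bornology.IsBounded Ω)
    (hf : ContDiffOn ℝ 2 f (closure Ω)) :
    ∃ M, ∀ z ∈ Ω, ∀ i ≤ 2, ‖iteratedFDeriv ℝ i f z‖ ≤ M := by
  obtain ⟨M, hM⟩ : ∃ M, ∀ z ∈ closure Ω, z ∈ Ω → ∀ i ≤ 2, ‖iteratedFDeriv ℝ i f z‖ ≤ M := by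
    refine hb.isCompact_closure.induction_on (p := fun s => ∃ M, ∀ z ∈ s, z ∈ Ω → ∀ i ≤ 2,
      ‖iteratedFDeriv ℝ i f z‖ ≤ M) ⟨0, by simp⟩ ?_ ?_ ?_
    · rintro s t hst ⟨M, hM⟩
      exact ⟨M, fun z hz => hM z (hst hz)⟩
    · rintro s t ⟨M, hM⟩ ⟨M', hM'⟩
      refine ⟨max M M', fun z hz hzΩ i hi => ?_⟩
      rcases hz with hz | hz
      · exact (hM z hz hzΩ i hi).trans (le_max_left _ _)
      · exact (hM' z hz hzΩ i hi).trans (le_max_right _ _)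
    · intro p hp
      obtain ⟨u, hu, P, hP⟩ := hf p hp 2 le_rfl
      rw [Set.insert_eq_of_mem hp] at hu
      have hpu : p ∈ u := mem_of_mem_nhdsWithin hp hu
      obtain ⟨W, hW, hpW, hWu⟩ := mem_nhdsWithin.1 hu
      have hc : ∀ i ≤ 2, ∀ᶠ z in 𝓝[u] p, ‖P z i‖ < ‖P p i‖ + 1 := fun i hi =>
        ((hP.cont i (by exact_mod_cast hi)) p hpu).norm.eventually (gt_mem_nhds (lt_add_one _))
      have hev : ∀ᶠ z in 𝓝[closure Ω] p, ∀ i ≤ 2, ‖P z i‖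
          < ‖P p 0‖ + ‖P p 1‖ + ‖P p 2‖ + 1 := by
        have hle : 𝓝[closure Ω] p ≤ 𝓝[u] p := nhdsWithin_le_iff.2 hu
        filter_upwards [hle (hc 0 (by norm_num)), hle (hc 1 (by norm_num)),
          hle (hc 2 le_rfl)] with z h0 h1 h2 i hi
        have a0 := norm_nonneg (P p 0)
        have a1 := norm_nonneg (P p 1)
        have a2 := norm_nonneg (P p 2)
        interval_cases i <;> linarith
      refine ⟨{z | ∀ i ≤ 2, ‖P z i‖ < ‖P p 0‖ + ‖P p 1‖ + ‖P p 2‖ + 1} ∩ (W ∩ closure Ω),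
        inter_mem hev (inter_mem (mem_nhdsWithin_of_mem_nhds (hW.mem_nhds hpW))
          self_mem_nhdsWithin), ‖P p 0‖ + ‖P p 1‖ + ‖P p 2‖ + 1, fun z hz hzΩ i hi => ?_⟩
      -- On the closure the coefficients need not be unique, but on this open set they must be the
      -- iterated derivatives.
      have ho : IsOpen (W ∩ Ω) := hW.inter hΩ
      have hP' : HasFTaylorSeriesUpToOn 2 f P (W ∩ Ω) :=
        hP.mono fun x hx => hWu ⟨hx.1, subset_closure hx.2⟩
      have e := hP'.eq_iteratedFDerivWithin_of_uniqueDiffOn (m := i) (by exact_mod_cast hi)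
        ho.uniqueDiffOn ⟨hz.2.1, hzΩ⟩
      rw [iteratedFDerivWithin_of_isOpen i ho ⟨hz.2.1, hzΩ⟩] at e
      rw [← e]
      exact (hz.1 i hi).le
  exact ⟨M, fun z hz => hM z (subset_closure hz) hz⟩

theorem norm_wirtinger_le {L : Cn n →L[ℝ] ℂ} (j : Fin n) {c : ℂ} (hc : ‖c‖ = 1) :
    ‖(1 / 2 : ℂ) * (L (EuclideanSpace.single j 1) + c * L (EuclideanSpace.single j I))‖ ≤ ‖L‖ := by
  have h1 : ‖L (EuclideanSpace.single j 1)‖ ≤ ‖L‖ := by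
    simpa using L.le_opNorm (EuclideanSpace.single j (1 : ℂ))
  have h2 : ‖c * L (EuclideanSpace.single j I)‖ ≤ ‖L‖ := by
    rw [norm_mul, hc, one_mul]
    simpa using L.le_opNorm (EuclideanSpace.single j I)
  rw [norm_mul]
  have h3 := norm_add_le (L (EuclideanSpace.single j 1)) (c * L (EuclideanSpace.single j I))
  norm_num
  linarith

theorem norm_dz_le (j : Fin n) (f : Cn n → ℂ) (z : Cn n) : ‖dz j f z‖ ≤ ‖fderiv ℝ f z‖ := by
  have := norm_wirtinger_le (L := fderiv ℝ f z) j (c := -I) (by simp)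
  rwa [dz_eq_wirtinger]

theorem norm_dzbar_le (j : Fin n) (f : Cn n → ℂ) (z : Cn n) : ‖dzbar j f z‖ ≤ ‖fderiv ℝ f z‖ :=
  norm_wirtinger_le j (by simp)

theorem norm_dzbar_dz_le (j k : Fin n) {z : Cn n} (hf : ContDiffAt ℝ 2 f z) :
    ‖dzbar k (dz j f) z‖ ≤ ‖fderiv ℝ (fderiv ℝ f) z‖ := by
  have hd : DifferentiableAt ℝ (fderiv ℝ f) z :=
    (hf.fderiv_right (m := 1) (by norm_num)).differentiableAt (by norm_num)
  refine (norm_dzbar_le k _ z).trans ?_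
  refine ContinuousLinearMap.opNorm_le_bound _ (by positivity) fun e => ?_
  have h1 : ∀ v, fderiv ℝ (fun x => fderiv ℝ f x v) z e = fderiv ℝ (fderiv ℝ f) z e v := fun v => by
    rw [fderiv_clm_apply hd (differentiableAt_const v)]
    simp
  rw [dz_eq_wirtinger, fderiv_wirtinger hf, h1, h1]
  exact (norm_wirtinger_le j (by simp)).trans (ContinuousLinearMap.le_opNorm _ _)

theorem exists_bound_derivatives (hΩ : IsOpen Ω) (hb : Bornology.IsBounded Ω)
    (hf : ContDiffOn ℝ 2 f (closure Ω)) :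
    ∃ M, 0 ≤ M ∧ ∀ z ∈ Ω, ‖f z‖ ≤ M ∧ (∀ j, ‖dz j f z‖ ≤ M) ∧ (∀ j, ‖dzbar j f z‖ ≤ M) ∧
      ∀ j k, ‖dzbar k (dz j f) z‖ ≤ M := by
  obtain ⟨M, hM⟩ := exists_bound_iteratedFDeriv hΩ hb hf
  refine ⟨max M 0, le_max_right _ _, fun z hz => ?_⟩
  have h0 := (hM z hz 0 (by norm_num)).trans (le_max_left M 0)
  have h1 := (hM z hz 1 (by norm_num)).trans (le_max_left M 0)
  have h2 := (hM z hz 2 le_rfl).trans (le_max_left M 0)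
  rw [norm_iteratedFDeriv_zero] at h0
  rw [norm_iteratedFDeriv_one] at h1
  rw [← norm_iteratedFDeriv_fderiv, norm_iteratedFDeriv_one] at h2
  have hfz : ContDiffAt ℝ 2 f z := (hf.mono subset_closure).contDiffAt (hΩ.mem_nhds hz)
  exact ⟨h0, fun j => (norm_dz_le j f z).trans h1, fun j => (norm_dzbar_le j f z).trans h1,
    fun j k => (norm_dzbar_dz_le j k hfz).trans h2⟩

theorem normSqL2_sum_le {g : Fin n → Cn n → ℂ} (hg : ∀ j, MemL2 Ω (g j)) :
    normSqL2 Ω (fun z => ∑ j, g j z) ≤ n * ∑ j, normSqL2 Ω (g j) := by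
  have hi : Integrable (fun z => (n : ℝ) * ∑ j, ‖g j z‖ ^ 2) (volume.restrict Ω) :=
    (integrable_finsetSum _ fun j _ => integrable_normSq (hg j)).const_mul _
  have e : ∑ j, normSqL2 Ω (g j) = ∫ z in Ω, ∑ j, ‖g j z‖ ^ 2 :=
    (integral_finsetSum _ fun j _ => integrable_normSq (hg j)).symm
  rw [e, ← integral_const_mul]
  refine integral_mono (integrable_normSq (memLp_finsetSum _ fun j _ => hg j)) hi fun z => ?_
  calc ‖∑ j, g j z‖ ^ 2 ≤ (∑ j, ‖g j z‖) ^ 2 := by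
        gcongr
        exact norm_sum_le _ _
    _ ≤ _ := by
        simpa using sq_sum_le_card_mul_sum_sq (s := Finset.univ) (f := fun j => ‖g j z‖)

/-- The contraction `∑_j ∂f/∂z_j u_j` lies in the domain of `∂̄`. -/
theorem isDbarFun_contraction (hΩ : IsOpen Ω) (hf : ContDiffOn ℝ 2 f Ω) {M : ℝ}
    (h1 : ∀ z ∈ Ω, ∀ j, ‖dz j f z‖ ≤ M) (h2 : ∀ z ∈ Ω, ∀ j k, ‖dzbar k (dz j f) z‖ ≤ M)
    {u : Fin n → Cn n → ℂ} {V : Fin n → Fin n → Cn n → ℂ} (hu : ∀ j, MemL2 Ω (u j))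
    (hV : ∀ j k, MemL2 Ω (V j k)) (hw : ∀ j k φ, IsTestFunction Ω φ →
      ∫ z in Ω, u j z * dzbar k φ z = -∫ z in Ω, V j k z * φ z) :
    IsDbarFun Ω (fun z => ∑ j, dz j f z * u j z)
      (fun k z => ∑ j, (dz j f z * V j k z + dzbar k (dz j f) z * u j z)) := by
  have hfj : ∀ j, ContDiffOn ℝ 1 (dz j f) Ω := fun j z hz =>
    (ContDiffAt.dz (m := 1) (hf.contDiffAt (hΩ.mem_nhds hz)) (by norm_num)).contDiffWithinAt
  have m1 : ∀ j, MemL2 Ω (fun z => dz j f z * u j z) := fun j =>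
    memL2_mul_of_bounded hΩ (hfj j).continuousOn (fun z hz => h1 z hz j) (hu j)
  have m2 : ∀ j k, MemL2 Ω (fun z => dz j f z * V j k z + dzbar k (dz j f) z * u j z) :=
    fun j k => MemLp.add (memL2_mul_of_bounded hΩ (hfj j).continuousOn (fun z hz => h1 z hz j)
      (hV j k)) (memL2_mul_of_bounded hΩ (continuousOn_dzbar hΩ (hfj j) k)
      (fun z hz => h2 z hz j k) (hu j))
  refine ⟨memLp_finsetSum _ fun j _ => m1 j, fun k => memLp_finsetSum _ fun j _ => m2 j k,
    fun k φ hφ => ?_⟩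
  simp only [Finset.sum_mul]
  rw [integral_finsetSum _ fun j _ => integrable_mul_of_memLp (m1 j) (hφ.dzbar k).memLp,
    integral_finsetSum _ fun j _ => integrable_mul_of_memLp (m2 j k) hφ.memLp,
    ← Finset.sum_neg_distrib]
  exact Finset.sum_congr rfl fun j _ => weak_dzbar_mul hΩ (hu j) (hV j k) (hw j k) (hfj j) hφ

/-- `∂̄*(fu) = f ∂̄*u - ∑_j ∂f/∂z_j u_j`. -/
theorem IsDbarAdjoint.mul (hΩ : IsOpen Ω) (hf : ContDiffOn ℝ 1 f Ω) {M : ℝ}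
    (h0 : ∀ z ∈ Ω, ‖f z‖ ≤ M) (h1 : ∀ z ∈ Ω, ∀ j, ‖dz j f z‖ ≤ M)
    {u : Fin n → Cn n → ℂ} {v : Cn n → ℂ} (h : IsDbarAdjoint Ω u v) :
    IsDbarAdjoint Ω (fun j z => f z * u j z) (fun z => f z * v z - ∑ j, dz j f z * u j z) := by
  have hdz : ∀ j, ContinuousOn (dz j f) Ω := fun j z hz =>
    (ContDiffAt.dz (m := 0) (hf.contDiffAt (hΩ.mem_nhds hz))
      (by norm_num)).continuousAt.continuousWithinAt
  have mfv : MemL2 Ω (fun z => f z * v z) :=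
    memL2_mul_of_bounded hΩ hf.continuousOn h0 h.memL2_adjoint
  have mfu : ∀ j, MemL2 Ω (fun z => f z * u j z) := fun j =>
    memL2_mul_of_bounded hΩ hf.continuousOn h0 (h.memL2 j)
  have mdu : ∀ j, MemL2 Ω (fun z => dz j f z * u j z) := fun j =>
    memL2_mul_of_bounded hΩ (hdz j) (fun z hz => h1 z hz j) (h.memL2 j)
  have msum : MemL2 Ω (fun z => ∑ j, dz j f z * u j z) := memLp_finsetSum _ fun j _ => mdu j
  refine ⟨mfu, MemLp.sub mfv msum, fun g w hgw => ?_⟩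
  have hfs : ContDiffOn ℝ 1 (fun z => star (f z)) Ω :=
    (starL' ℝ (A := ℂ)).contDiff.comp_contDiffOn hf
  have hpg := hgw.mul hΩ hfs (M := M) (fun z hz => by rw [norm_star]; exact h0 z hz)
    fun j z hz => by rw [dzbar_star, norm_star]; exact h1 z hz j
  have h3 := h.adjoint _ _ hpg
  simp only [innerL2, dzbar_star] at h3 ⊢
  have i1 : ∀ j, Integrable (fun z => f z * u j z * star (w j z)) (volume.restrict Ω) := fun j =>
    integrable_mul_star (mfu j) (hgw.memL2_dbar j)
  have i2 : ∀ j, Integrable (fun z => dz j f z * u j z * star (g z)) (volume.restrict Ω) :=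
    fun j => integrable_mul_star (mdu j) hgw.memL2
  have i3 : Integrable (fun z => f z * v z * star (g z)) (volume.restrict Ω) :=
    integrable_mul_star mfv hgw.memL2
  have e1 : ∀ j, ∫ z in Ω, u j z * star (star (f z) * w j z + star (dz j f z) * g z)
      = (∫ z in Ω, f z * u j z * star (w j z)) + ∫ z in Ω, dz j f z * u j z * star (g z) := by
    intro j
    rw [← integral_add (i1 j) (i2 j)]
    refine integral_congr_ae (ae_of_all _ fun z => ?_)
    simp only [star_add, star_mul', star_star]
    ring
  have e2 : ∫ z in Ω, v z * star (star (f z) * g z) = ∫ z in Ω, f z * v z * star (g z) :=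
    integral_congr_ae (ae_of_all _ fun z => by simp only [star_mul', star_star]; ring)
  have e3 : ∫ z in Ω, (f z * v z - ∑ j, dz j f z * u j z) * star (g z)
      = (∫ z in Ω, f z * v z * star (g z)) - ∑ j, ∫ z in Ω, dz j f z * u j z * star (g z) := by
    rw [← integral_finsetSum _ fun j _ => i2 j,
      ← integral_sub i3 (integrable_finsetSum _ fun j _ => i2 j)]
    refine integral_congr_ae (ae_of_all _ fun z => ?_)
    simp only [sub_mul, Finset.sum_mul]
  simp only [e1, Finset.sum_add_distrib] at h3
  rw [e3, ← e2, ← h3]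
  ring

/-- Cauchy–Schwarz followed by 2√(ab) ≤ a + b, with `s` distributing the weight between the factors.
-/
theorem norm_integral_mul_star_le {F G : Cn n → ℂ} (hF : MemL2 Ω F) (hG : MemL2 Ω G) {s : ℝ}
    (hs : 0 < s) :
    ‖∫ z in Ω, F z * star (G z)‖ ≤ normSqL2 Ω F / (2 * s) + s / 2 * normSqL2 Ω G := by
  have h := norm_integral_mul_star_sq_le hF hG
  set a := normSqL2 Ω F / (2 * s) with ha
  set b := s / 2 * normSqL2 Ω G with hb
  have ha0 : 0 ≤ a := div_nonneg (normSqL2_nonneg _ _) (by positivity)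
  have hb0 : 0 ≤ b := mul_nonneg (by positivity) (normSqL2_nonneg _ _)
  have hab : normSqL2 Ω F * normSqL2 Ω G = 4 * a * b := by
    rw [ha, hb]; field_simp; ring
  refine (pow_le_pow_iff_left₀ (norm_nonneg _) (add_nonneg ha0 hb0) two_ne_zero).1
    (h.trans ?_)
  change normSqL2 Ω F * normSqL2 Ω G ≤ _
  rw [hab]
  nlinarith [sq_nonneg (a - b)]

/-- The contraction of `∂f` with `u` is controlled by `fu` up to a small multiple of the energy. -/
theorem exists_contraction_estimate (hΩ : IsSmoothBoundedPseudoconvexDomain Ω)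
    (hf : ContDiffOn ℝ 2 f (closure Ω)) : ∃ A D : ℝ, 0 < A ∧ 0 < D ∧
    ∀ u G v, IsDbarForm Ω u G → IsDbarAdjoint Ω u v →
      MemL2 Ω (fun z => ∑ j, dz j f z * u j z) ∧ ∀ s > 0,
      normSqL2 Ω (fun z => ∑ j, dz j f z * u j z)
        ≤ A / s * normSqForm Ω (fun j z => f z * u j z)
          + s * D * (normSqForm2 Ω G + normSqL2 Ω v) := by
  have hO := hΩ.isOpen
  obtain ⟨M, hM0, hM⟩ := exists_bound_derivatives hO hΩ.isBounded hf
  obtain ⟨C, hC0, hC⟩ := basic_estimate hΩ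
  have hf2 : ContDiffOn ℝ 2 f Ω := hf.mono subset_closure
  have hf1 : ContDiffOn ℝ 1 f Ω := hf2.of_le (by norm_num)
  -- The first constant collects |f̄h|² ≤ nM²|fu|² and the term ‖fu‖² from the second pairing, the
  -- latter accounting for its +1; the other collects the bound on ∂̄h and the term from ∂̄*u. The
  -- summands 1 also keep both positive when M or n is 0.
  refine ⟨n * M ^ 2 + 1, n * (n * (n * (4 * M ^ 2 * C))) + 1, by positivity, by positivity,
    fun u G v hG hv => ?_⟩
  obtain ⟨hu, V, hVm, hVw, hVb⟩ := hC u G v hG hv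
  set Q := normSqForm2 Ω G + normSqL2 Ω v with hQ
  have hQ1 := normSqForm2_nonneg Ω G
  have hQ2 := normSqL2_nonneg Ω v
  set h : Cn n → ℂ := fun z => ∑ j, dz j f z * u j z with hh
  set w : Fin n → Cn n → ℂ := fun k z => ∑ j, (dz j f z * V j k z + dzbar k (dz j f) z * u j z)
    with hw
  set X := normSqForm Ω (fun j z => f z * u j z) with hX
  have hdb : IsDbarFun Ω h w := isDbarFun_contraction hO hf2 (fun z hz => (hM z hz).2.1)
    (fun z hz => (hM z hz).2.2.2) hG.memL2 hVm hVw
  have hadj := hv.mul hO hf1 (fun z hz => (hM z hz).1) (fun z hz => (hM z hz).2.1)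
  refine ⟨hdb.memL2, fun s hs => ?_⟩
  have mfv : MemL2 Ω (fun z => f z * v z) :=
    memL2_mul_of_bounded hO hf1.continuousOn (fun z hz => (hM z hz).1) hv.memL2_adjoint
  have mfh : MemL2 Ω (fun z => star (f z) * h z) :=
    memL2_mul_of_bounded hO hf1.continuousOn.star
      (fun z hz => by rw [norm_star]; exact (hM z hz).1) hdb.memL2
  -- (fu, ∂̄h) = (∂̄*(fu), h), and ∂̄*(fu) contains −h, so ‖h‖² can be solved for.
  have key := hadj.adjoint _ _ hdb
  have e1 : innerL2 Ω (fun z => f z * v z - ∑ j, dz j f z * u j z) h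
      = (∫ z in Ω, v z * star (star (f z) * h z)) - (normSqL2 Ω h : ℂ) := by
    have i1 : Integrable (fun z => v z * star (star (f z) * h z)) (volume.restrict Ω) :=
      integrable_mul_star hv.memL2_adjoint mfh
    have i2 : Integrable (fun z => ((‖h z‖ ^ 2 : ℝ) : ℂ)) (volume.restrict Ω) :=
      (integrable_normSq hdb.memL2).ofReal
    rw [normSqL2, ← integral_complex_ofReal, ← integral_sub i1 i2, innerL2]
    refine integral_congr_ae (ae_of_all _ fun z => ?_)
    have : ((‖h z‖ ^ 2 : ℝ) : ℂ) = h z * star (h z) := by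
      rw [star_def, mul_conj, Complex.normSq_eq_norm_sq]
    simp only [this, star_mul', star_star]
    rw [hh]
    ring
  rw [e1] at key
  have hnorm : normSqL2 Ω h ≤ ‖∫ z in Ω, v z * star (star (f z) * h z)‖
      + ∑ k, ‖innerL2 Ω (fun z => f z * u k z) (w k)‖ := by
    have e2 : (normSqL2 Ω h : ℂ) = (∫ z in Ω, v z * star (star (f z) * h z))
        - ∑ k, innerL2 Ω (fun z => f z * u k z) (w k) := by rw [key]; ring
    calc normSqL2 Ω h = ‖(normSqL2 Ω h : ℂ)‖ := by
          rw [norm_real, Real.norm_of_nonneg (normSqL2_nonneg _ _)]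
      _ ≤ _ := by
          rw [e2]
          exact (norm_sub_le _ _).trans (add_le_add le_rfl (norm_sum_le _ _))
  -- The factor f̄ moved onto h recombines with the `u j`, since |f̄h| = |fh|. This is how the term
  -- containing ∂̄*u also gains from the smallness of fu.
  have hfh : normSqL2 Ω (fun z => star (f z) * h z) ≤ n * M ^ 2 * X := by
    have hfu : ∀ j, MemL2 Ω (fun z => f z * u j z) := hadj.memL2
    have hX' : X = ∫ z in Ω, ∑ j, ‖f z * u j z‖ ^ 2 :=
      (integral_finsetSum _ fun j _ => integrable_normSq (hfu j)).symm
    rw [hX', normSqL2, ← integral_const_mul]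
    refine setIntegral_mono_on (integrable_normSq mfh) ((integrable_finsetSum _ fun j _ =>
      integrable_normSq (hfu j)).const_mul _) hO.measurableSet fun z hz => ?_
    have e3 : ‖star (f z) * h z‖ = ‖∑ j, dz j f z * (f z * u j z)‖ := by
      rw [norm_mul, norm_star, ← norm_mul, hh, Finset.mul_sum]
      congr 1
      exact Finset.sum_congr rfl fun j _ => by ring
    rw [e3]
    refine (norm_sum_mul_sq_le _ _).trans (mul_le_mul_of_nonneg_right ?_
      (Finset.sum_nonneg fun _ _ => by positivity))
    calc ∑ j, ‖dz j f z‖ ^ 2 ≤ ∑ _j : Fin n, M ^ 2 := Finset.sum_le_sum fun j _ => by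
          have := (hM z hz).2.1 j
          gcongr
      _ = n * M ^ 2 := by simp
  have hwk : ∀ k, normSqL2 Ω (w k) ≤ n * (n * (4 * M ^ 2 * C)) * Q := by
    intro k
    have m1 : ∀ j, MemL2 Ω (fun z => dz j f z * V j k z) := fun j =>
      memL2_mul_of_bounded hO (fun z hz => (ContDiffAt.dz (m := 0)
        (hf1.contDiffAt (hO.mem_nhds hz)) (by norm_num)).continuousAt.continuousWithinAt)
        (fun z hz => (hM z hz).2.1 j) (hVm j k)
    have hfj : ∀ j, ContDiffOn ℝ 1 (dz j f) Ω := fun j z hz =>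
      (ContDiffAt.dz (m := 1) (hf2.contDiffAt (hO.mem_nhds hz)) (by norm_num)).contDiffWithinAt
    have m2 : ∀ j, MemL2 Ω (fun z => dzbar k (dz j f) z * u j z) := fun j =>
      memL2_mul_of_bounded hO (continuousOn_dzbar hO (hfj j) k)
        (fun z hz => (hM z hz).2.2.2 j k) (hG.memL2 j)
    refine (normSqL2_sum_le fun j => MemLp.add (m1 j) (m2 j)).trans ?_
    rw [mul_assoc]
    refine mul_le_mul_of_nonneg_left ?_ (Nat.cast_nonneg n)
    calc _ ≤ ∑ _j : Fin n, 4 * M ^ 2 * C * Q := Finset.sum_le_sum fun j _ => by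
          have b1 := normSqL2_mul_le hO (hfj j).continuousOn (fun z hz => (hM z hz).2.1 j) (hVm j k)
          have b2 := normSqL2_mul_le hO (continuousOn_dzbar hO (hfj j) k)
            (fun z hz => (hM z hz).2.2.2 j k) (hG.memL2 j)
          have b3 : normSqL2 Ω (u j) ≤ C * Q := (Finset.single_le_sum
            (f := fun j => normSqL2 Ω (u j)) (fun _ _ => normSqL2_nonneg _ _)
            (Finset.mem_univ j)).trans hu
          have b4 := hVb j k
          have b5 := mul_le_mul_of_nonneg_left b3 (sq_nonneg M)
          have b6 := mul_le_mul_of_nonneg_left b4 (sq_nonneg M)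
          refine (normSqL2_add_le (m1 j) (m2 j)).trans ?_
          linarith
      _ = _ := by simp; ring
  -- The parameter is inverted because here the factor controlled by fu is the second one; it has to
  -- carry the large weight 1/s, and ∂̄*u the small weight s.
  have t1 := norm_integral_mul_star_le (Ω := Ω) (s := s⁻¹) hv.memL2_adjoint mfh (by positivity)
  have t2 : ∀ k, ‖innerL2 Ω (fun z => f z * u k z) (w k)‖
      ≤ normSqL2 Ω (fun z => f z * u k z) / (2 * s) + s / 2 * normSqL2 Ω (w k) := fun k =>
    norm_integral_mul_star_le (hadj.memL2 k) (hdb.memL2_dbar k) hs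
  have t3 : ∑ k, ‖innerL2 Ω (fun z => f z * u k z) (w k)‖
      ≤ X / (2 * s) + s / 2 * (n * (n * (n * (4 * M ^ 2 * C))) * Q) := by
    refine (Finset.sum_le_sum fun k _ => t2 k).trans ?_
    rw [Finset.sum_add_distrib, ← Finset.sum_div, ← Finset.mul_sum]
    refine add_le_add le_rfl (mul_le_mul_of_nonneg_left ?_ (by positivity))
    refine (Finset.sum_le_sum fun k _ => hwk k).trans_eq ?_
    simp; ring
  have hX0 : 0 ≤ X := Finset.sum_nonneg fun _ _ => normSqL2_nonneg _ _
  have t4 : normSqL2 Ω v / (2 * s⁻¹) ≤ s / 2 * Q := by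
    have : normSqL2 Ω v / (2 * s⁻¹) = s / 2 * normSqL2 Ω v := by field_simp
    rw [this]
    exact mul_le_mul_of_nonneg_left (by linarith) (by positivity)
  have t5 : s⁻¹ / 2 * normSqL2 Ω (fun z => star (f z) * h z) ≤ s⁻¹ / 2 * (n * M ^ 2 * X) :=
    mul_le_mul_of_nonneg_left hfh (by positivity)
  have t6 : (n * M ^ 2 + 1) / s * X = 2 * (s⁻¹ / 2 * (n * M ^ 2 * X)) + 2 * (X / (2 * s)) := by
    field_simp
  have p1 : 0 ≤ s⁻¹ / 2 * (n * M ^ 2 * X) := by positivity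
  have p2 : 0 ≤ X / (2 * s) := by positivity
  have p3 : 0 ≤ s / 2 * (n * (n * (n * (4 * M ^ 2 * C))) * Q) := by positivity
  have p4 : 0 ≤ s / 2 * Q := by positivity
  rw [t6]
  linarith

end Multiplier


end DbarNeumann

end

theorem proposition4p1 (n : ℕ) (Ω : Set (DbarNeumann.Cn n))
    (hΩ : DbarNeumann.IsSmoothBoundedPseudoconvexDomain Ω)
    (f : DbarNeumann.Cn n → ℂ) (hf : ContDiffOn ℝ 2 f (closure Ω))
    (hmult : DbarNeumann.IsCompactnessMultiplier Ω f) :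
    DbarNeumann.IsAllowable Ω (fun j z => DbarNeumann.dz j f z) := by
  intro ε hε
  obtain ⟨A, D, hA, hD, h⟩ := DbarNeumann.exists_contraction_estimate hΩ hf
  -- Makes sD = ε/2. With s fixed, the multiplier tolerance εs/(2A) makes the contribution of
  -- (A/s)‖fu‖² to the energy the other ε/2.
  set s := ε / (2 * D) with hs
  have hs0 : 0 < s := by positivity
  obtain ⟨C, hC, hm⟩ := hmult.2 (ε * s / (2 * A)) (by positivity)
  refine ⟨A / s * C, by positivity, fun u G v hG hv => ?_⟩
  obtain ⟨hmem, hest⟩ := h u G v hG hv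
  refine ⟨hmem, (hest s hs0).trans ?_⟩
  have h1 := mul_le_mul_of_nonneg_left (hm u G v hG hv) (show 0 ≤ A / s by positivity)
  have e1 : s * D = ε / 2 := by rw [hs]; field_simp
  have e2 : A / s * (ε * s / (2 * A)) = ε / 2 := by field_simp
  rw [mul_add, ← mul_assoc, e2] at h1
  rw [e1]
  linarith
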